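/- **Setting.** Let $N\ge 1$, $c>0$, and let $S^-\subset\mathbb R^N$ be a bounded open set bounded by a Lyapunov surface $S=\partial S^-$ (a $C^1$ hypersurface with Hölder continuous normal, $S^-$ lying locally on one side of it), with exterior unit normal $n$. Put $D=S^-\times(0,\infty)$. Let $G$ be a locally integrable function on $D$, and let $u_0,\dot u_0,u_S,p$ be given real functions on $\overline{S^-}$, $S^-$, $S\times[0,\infty)$, $S\times(0,\infty)$. A *wave front* is a $C^1$ hypersurface $F\subset D$ whose normal $(\nu_x,\nu_t)$ can be chosen with $\nu_x\neq0$ and $\nu_t=-c\|\nu_x\|$ (a characteristic hypersurface). The side into which $(\nu_x,\nu_t)$ points is called the side ahead of the front, and $m=\nu_x/\|\nu_x\|$. A *classical solution* (possibly with shock waves) of $$\Delta u-\frac1{c^2}\frac{\partial^2u}{\partial t^2}=G\quad\text{in } D$$ is a continuous function $u$ on $\overline{S^-}\times[0,\infty)$ for which there are finitely or countably many wave fronts $F_k$, and finitely or countably many exceptional closed sets $Z_k$ of finite $(N-1)$-dimensional Hausdorff measure (codimension two in space-time; they contain edges and intersections of fronts and their traces on the boundary of $D$), such that, with $Z=\bigcup_kZ_k$: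 * $D_{\mathrm{reg}}=D\setminus\big(\bigcup_kF_k\cup Z\big)$ is open, and $u$ is $C^2$ and satisfies the equation on it; * at every point of $F_k\setminus Z$ the functions $u,u_t,\nabla u$, restricted to $D_{\mathrm{reg}}$, have limits from either side of $F_k$, and the jumps $[\cdot]$ across $F_k$ (limit ahead minus limit behind) satisfy the Hadamard conditions $[u]=0$ and $[u_t+c\,m\cdot\nabla u]=0$; * the energy density $E=\tfrac12\big(c^{-2}u_t^2+\|\nabla u\|^2\big)$ is integrable over $S^-\times(0,T)$ for every $T>0$. The initial conditions are $u(x,0)=u_0(x)$ for $x\in\overline{S^-}$, and $u_t\to\dot u_0(x)$ at $(x,0)$ along $D_{\mathrm{reg}}$ for every $x\in S^-$ with $(x,0)\notin Z$. Such a $u$ is a classical solution of the *first (Dirichlet) BVP* if also $u=u_S$ on $S\times[0,\infty)$. It is a classical solution of the *second (Neumann) BVP* if instead, at every $(x,t)\in S\times(0,\infty)$ with $(x,t)\notin Z$, the derivatives $u_t$ and $\nabla u$ have limits along $D_{\mathrm{reg}}$ and the limit of $\nabla u$ has normal component $\partial u/\partial n=n(x)\cdot\nabla u=p(x,t)$.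 **Theorem 2.2.** The first BVP has at most one classical solution, and the second BVP has at most one classical solution: if $u$ and $v$ are classical solutions of the same problem (with the same $G,u_0,\dot u_0$ and the same $u_S$, respectively $p$; the fronts and exceptional sets of $u$ and $v$ may differ), then $u=v$ on $\overline{S^-}\times[0,\infty)$. -/

import Mathlib

open Set Filter Topology MeasureTheory
open scoped NNReal InnerProductSpace

/-- Euclidean space `ℝ^N`. -/
abbrev Space (N : ℕ) : Type := EuclideanSpace ℝ (Fin N)

/-- Space-time: pairs `(x, t)`. -/
abbrev Spacetime (N : ℕ) : Type := Space N × ℝ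

/-- The time derivative `u_t (x, t)`. -/
noncomputable def timeDeriv {N : ℕ} (u : Spacetime N → ℝ) (q : Spacetime N) : ℝ :=
  deriv (fun s => u (q.1, s)) q.2

/-- The spatial gradient `(u_{,1}, …, u_{,N}) (x, t)`. -/
noncomputable def spaceGrad {N : ℕ} (u : Spacetime N → ℝ) (q : Spacetime N) : Space N :=
  gradient (fun y => u (y, q.2)) q.1

/-- The wave operator `Δ u - c⁻² u_tt`. -/
noncomputable def waveOp {N : ℕ} (c : ℝ) (u : Spacetime N → ℝ) (q : Spacetime N) : ℝ :=
  Laplacian.laplacian (fun y => u (y, q.2)) q.1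
    - (1 / c ^ 2) * iteratedDeriv 2 (fun s => u (q.1, s)) q.2

/-- The energy density `E = ½ (u_τ² + ∑ u_{,j}²)`, where `τ = c t`. -/
noncomputable def energyDensity {N : ℕ} (c : ℝ) (u : Spacetime N → ℝ) (q : Spacetime N) : ℝ :=
  (1 / 2) * ((timeDeriv u q / c) ^ 2 + ‖spaceGrad u q‖ ^ 2)

/-! ### Domains -/

/-- In the open set `W`, the set `Ω` is the sublevel set `{ρ < 0}` of a `C¹` function without
critical points; so `frontier Ω ∩ W = {ρ = 0}`, and `∇ρ` points out of `Ω` there. -/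
structure IsBoundaryChart {N : ℕ} (Ω W : Set (Space N)) (ρ : Space N → ℝ) : Prop where
  isOpen : IsOpen W
  contDiffOn : ContDiffOn ℝ 1 ρ W
  grad_ne_zero : ∀ y ∈ W, gradient ρ y ≠ 0
  inter_eq : Ω ∩ W = {y ∈ W | ρ y < 0}

/-- A bounded open set bounded by a Lyapunov surface: the boundary is a `C¹` hypersurface, with
the set on one side of it, whose normal is Hölder continuous. -/
structure IsLyapunovDomain {N : ℕ} (Ω : Set (Space N)) : Prop where
  isOpen : IsOpen Ω
  isBounded : Bornology.IsBounded Ω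
  boundary : ∀ x ∈ frontier Ω, ∃ (W : Set (Space N)) (ρ : Space N → ℝ),
    x ∈ W ∧ IsBoundaryChart Ω W ρ ∧
      ∃ C α : ℝ≥0, 0 < α ∧ α ≤ 1 ∧ HolderOnWith C α (gradient ρ) W

/-- `n` is the exterior unit normal to the boundary of `Ω` at the boundary point `x`. -/
def IsExteriorUnitNormal {N : ℕ} (Ω : Set (Space N)) (x n : Space N) : Prop :=
  ∃ (W : Set (Space N)) (ρ : Space N → ℝ), x ∈ W ∧ IsBoundaryChart Ω W ρ ∧
    n = ‖gradient ρ x‖⁻¹ • gradient ρ x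

/-- The open cylinder `Ω × (0, ∞)`. -/
def openCylinder {N : ℕ} (Ω : Set (Space N)) : Set (Spacetime N) := Ω ×ˢ Ioi (0 : ℝ)

/-- The closed cylinder `closure Ω × [0, ∞)`. -/
def closedCylinder {N : ℕ} (Ω : Set (Space N)) : Set (Spacetime N) := closure Ω ×ˢ Ici (0 : ℝ)

/-! ### Wave fronts -/

/-- In the open set `W`, the set `F` is the zero set of a `C¹` function `ψ`, and along `F` the
normal `(ν_x, ν_t) = (∇ψ, ψ_t)` is nonzero and characteristic, `ν_τ² = ‖ν_x‖²` with `ν_t = c ν_τ`,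
and is oriented by `ν_τ < 0`; that is, `ν_x ≠ 0` and `ν_t = - c ‖ν_x‖`. -/
structure IsFrontChart {N : ℕ} (c : ℝ) (F W : Set (Spacetime N)) (ψ : Spacetime N → ℝ) :
    Prop where
  isOpen : IsOpen W
  contDiffOn : ContDiffOn ℝ 1 ψ W
  inter_eq : F ∩ W = {q ∈ W | ψ q = 0}
  grad_ne_zero : ∀ q ∈ F ∩ W, spaceGrad ψ q ≠ 0
  characteristic : ∀ q ∈ F ∩ W, timeDeriv ψ q = -c * ‖spaceGrad ψ q‖

/-- A wave front: a characteristic `C¹` hypersurface in space-time. The empty set is allowed. -/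
def IsWaveFront {N : ℕ} (c : ℝ) (F : Set (Spacetime N)) : Prop :=
  ∀ q ∈ F, ∃ (W : Set (Spacetime N)) (ψ : Spacetime N → ℝ), q ∈ W ∧ IsFrontChart c F W ψ

/-- The jump conditions at the point `q` of the front `F`, for a function `u` that is smooth on
the open set `R` away from the fronts. The first derivatives of `u` have limits from either side
of the front: `(a₁, g₁)` ahead of it, where `ψ > 0`, and `(a₂, g₂)` behind it, where `ψ < 0`. With
`n = ∇ψ / ‖∇ψ‖`, the unit normal in `ℝ^N` in the direction of propagation, the jump of
`u_t + c n_i u_{,i}` vanishes. So does the jump of `u`. -/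
def HadamardConditionsAt {N : ℕ} (c : ℝ) (u : Spacetime N → ℝ) (R F : Set (Spacetime N))
    (q : Spacetime N) : Prop :=
  ∃ (W : Set (Spacetime N)) (ψ : Spacetime N → ℝ), q ∈ W ∧ IsFrontChart c F W ψ ∧
    (∃ b : ℝ, Tendsto u (𝓝[R ∩ {y ∈ W | 0 < ψ y}] q) (𝓝 b) ∧
      Tendsto u (𝓝[R ∩ {y ∈ W | ψ y < 0}] q) (𝓝 b)) ∧
    ∃ (a₁ a₂ : ℝ) (g₁ g₂ : Space N),
      Tendsto (timeDeriv u) (𝓝[R ∩ {y ∈ W | 0 < ψ y}] q) (𝓝 a₁) ∧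
      Tendsto (spaceGrad u) (𝓝[R ∩ {y ∈ W | 0 < ψ y}] q) (𝓝 g₁) ∧
      Tendsto (timeDeriv u) (𝓝[R ∩ {y ∈ W | ψ y < 0}] q) (𝓝 a₂) ∧
      Tendsto (spaceGrad u) (𝓝[R ∩ {y ∈ W | ψ y < 0}] q) (𝓝 g₂) ∧
      a₁ + c * ⟪‖spaceGrad ψ q‖⁻¹ • spaceGrad ψ q, g₁⟫_ℝ =
        a₂ + c * ⟪‖spaceGrad ψ q‖⁻¹ • spaceGrad ψ q, g₂⟫_ℝ

/-- The part of the open cylinder off the fronts `F k` and off the exceptional sets `Z k`. -/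
def regularRegion {N : ℕ} (Ω : Set (Space N)) (F Z : ℕ → Set (Spacetime N)) :
    Set (Spacetime N) :=
  openCylinder Ω \ ((⋃ k, F k) ∪ ⋃ k, Z k)

/-! ### Classical solutions and the boundary value problems -/

/-- `u` is a classical solution (possibly with shock waves) of `Δ u - c⁻² u_tt = G` in
`Ω × (0, ∞)`, whose fronts are the `F k`. The closed sets `Z k`, of codimension two in space-time
(finite `(N-1)`-dimensional Hausdorff measure), hold the edges of the fronts, the points in which
fronts meet, and their traces on the boundary of the cylinder; there no derivative of `u` need
have one-sided limits. Both sequences may contain empty sets. -/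
structure IsClassicalSolution {N : ℕ} (c : ℝ) (Ω : Set (Space N)) (G : Spacetime N → ℝ)
    (u : Spacetime N → ℝ) (F Z : ℕ → Set (Spacetime N)) : Prop where
  front_subset : ∀ k, F k ⊆ openCylinder Ω
  front : ∀ k, IsWaveFront c (F k)
  isClosed_exceptional : ∀ k, IsClosed (Z k)
  measure_exceptional : ∀ k, Measure.hausdorffMeasure ((N : ℝ) - 1) (Z k) < ⊤
  isOpen_regular : IsOpen (regularRegion Ω F Z)
  continuousOn : ContinuousOn u (closedCylinder Ω)
  contDiffOn : ContDiffOn ℝ 2 u (regularRegion Ω F Z)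
  waveEq : ∀ q ∈ regularRegion Ω F Z, waveOp c u q = G q
  hadamard : ∀ k, ∀ q ∈ F k \ ⋃ j, Z j, HadamardConditionsAt c u (regularRegion Ω F Z) (F k) q
  /-- The energy is finite: `E` is integrable over `Ω × (0, T)`. -/
  finiteEnergy : ∀ T : ℝ, IntegrableOn (energyDensity c u) (Ω ×ˢ Ioo (0 : ℝ) T)

/-- The initial conditions `u (x, 0) = u₀ x` on `closure Ω` and `u_t (x, 0) = v₀ x` on `Ω`, the
latter off the exceptional sets. -/
structure HasInitialData {N : ℕ} (Ω : Set (Space N)) (u₀ v₀ : Space N → ℝ)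
    (u : Spacetime N → ℝ) (F Z : ℕ → Set (Spacetime N)) : Prop where
  value : ∀ x ∈ closure Ω, u (x, 0) = u₀ x
  velocity : ∀ x ∈ Ω, (x, (0 : ℝ)) ∉ ⋃ j, Z j →
    Tendsto (timeDeriv u) (𝓝[regularRegion Ω F Z] (x, 0)) (𝓝 (v₀ x))

/-- The Dirichlet condition `u = uS` on `S × [0, ∞)`, where `S` is the boundary of `Ω`. -/
def HasDirichletData {N : ℕ} (Ω : Set (Space N)) (uS : Spacetime N → ℝ)
    (u : Spacetime N → ℝ) : Prop :=
  ∀ x ∈ frontier Ω, ∀ t : ℝ, 0 ≤ t → u (x, t) = uS (x, t)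

/-- The Neumann condition `∂u/∂n = p` on `S × (0, ∞)` off the exceptional sets: the first
derivatives of `u` have limits at the boundary point, and the limit of the gradient has the normal
component `p`. -/
def HasNeumannData {N : ℕ} (Ω : Set (Space N)) (p : Spacetime N → ℝ)
    (u : Spacetime N → ℝ) (F Z : ℕ → Set (Spacetime N)) : Prop :=
  ∀ x ∈ frontier Ω, ∀ t : ℝ, 0 < t → (x, t) ∉ ⋃ j, Z j →
    (∃ a : ℝ, Tendsto (timeDeriv u) (𝓝[regularRegion Ω F Z] (x, t)) (𝓝 a)) ∧
    ∃ g : Space N, Tendsto (spaceGrad u) (𝓝[regularRegion Ω F Z] (x, t)) (𝓝 g) ∧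
      ∀ n : Space N, IsExteriorUnitNormal Ω x n → ⟪n, g⟫_ℝ = p (x, t)

/-- `u` is a classical solution of the first (Dirichlet) boundary value problem. -/
def SolvesFirstBVP {N : ℕ} (c : ℝ) (Ω : Set (Space N)) (G : Spacetime N → ℝ)
    (u₀ v₀ : Space N → ℝ) (uS : Spacetime N → ℝ) (u : Spacetime N → ℝ) : Prop :=
  ∃ F Z : ℕ → Set (Spacetime N), IsClassicalSolution c Ω G u F Z ∧
    HasInitialData Ω u₀ v₀ u F Z ∧ HasDirichletData Ω uS u

/-- `u` is a classical solution of the second (Neumann) boundary value problem. -/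
def SolvesSecondBVP {N : ℕ} (c : ℝ) (Ω : Set (Space N)) (G : Spacetime N → ℝ)
    (u₀ v₀ : Space N → ℝ) (p : Spacetime N → ℝ) (u : Spacetime N → ℝ) : Prop :=
  ∃ F Z : ℕ → Set (Spacetime N), IsClassicalSolution c Ω G u F Z ∧
    HasInitialData Ω u₀ v₀ u F Z ∧ HasNeumannData Ω p u F Z

/-! Put w = u - v. The usual multiplier w_t jumps across the fronts, and u and v have different
fronts. The proof therefore uses the more regular multiplier φ(x,t) = ∫_t^T w(x,s) ds, which is
continuous, with ∇φ = ∫_t^T ∇w ds and φ_t = -w. For the flux (∇w, -w_t/c²), which is divergence free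
because the sources G cancel, the product rule reads div(φ · flux) = ∇φ·∇w + w w_t/c². Integrated
over Ω × (0,T), the left side contributes nothing: φ vanishes at t = T, w_t vanishes at t = 0, and
in the Neumann problem the normal component of ∇w vanishes on the lateral boundary. Exchanging the
two time variables gives ∫ ∇φ·∇w = ½ ∫_Ω |∫_0^T ∇w dt|² dx ≥ 0 (`integral_inner_tail_nonneg`). Hence
∫∫_{Ω×(0,T)} w w_t ≤ 0 for every T, which formally says ½ ∫_Ω w(·,T)² ≤ 0. `eqOn_of_integral_nonpos`
draws the conclusion w = 0 after averaging in T, so that no trace of w_t on a time slice is needed.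

In the Dirichlet problem ∇w need not have limits at the lateral boundary. There w is first replaced
in φ by H(w), where H is C¹, close to the identity and zero near 0. Since w is continuous and
vanishes on the lateral boundary, this φ vanishes near it. The truncation is then removed by
dominated convergence, using that ∇w = 0 almost everywhere on {w = 0}.

The technical core is that all these identities hold in the sense of distributions across countably
many fronts and exceptional sets, which need not be locally finite. Three facts carry it. A closed
set of finite codimension-two Hausdorff measure is removable for a locally square integrable field,
because it has cutoff functions bounded in H¹ with shrinking supports (`WeakDiv.of_diff_hausdorff`);
finite energy supplies the square integrability. A C¹ hypersurface is removable where the field is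
bounded and its normal component has the same limit from both sides (`WeakDiv.of_diff_graph`,
`LocallyRemovable.of_hypersurface`); on a characteristic surface the Hadamard condition says exactly
this for the wave flux. Finally, Baire's theorem allows countably many closed removable pieces to be
removed at once (`WeakDiv.of_locallyRemovable`). The initial plane and the lateral boundary are
treated in the same way, after extension of the fields by zero. -/

set_option linter.unusedSectionVars false

/-! ### Weak divergence -/

/-- `φ` is a `C¹` function with compact support in `O`. -/
structure IsTestFun {E : Type*} [NormedAddCommGroup E] [NormedSpace ℝ E] (φ : E → ℝ)
    (O : Set E) : Prop where
  contDiff : ContDiff ℝ 1 φ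
  hasCompactSupport : HasCompactSupport φ
  tsupport_subset : tsupport φ ⊆ O

/-- The distributional identity `div V = h` in the open set `O`. -/
def WeakDiv {E : Type*} [NormedAddCommGroup E] [NormedSpace ℝ E] [MeasurableSpace E]
    (μ : Measure E) (V : E → E) (h : E → ℝ) (O : Set E) : Prop :=
  ∀ φ : E → ℝ, IsTestFun φ O → ∫ q, (fderiv ℝ φ q (V q) + φ q * h q) ∂μ = 0

section WeakDivBasics

variable {E : Type*} [NormedAddCommGroup E] [NormedSpace ℝ E]

theorem IsTestFun.mono {φ : E → ℝ} {O O' : Set E} (hφ : IsTestFun φ O) (h : O ⊆ O') :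
    IsTestFun φ O' :=
  ⟨hφ.contDiff, hφ.hasCompactSupport, hφ.tsupport_subset.trans h⟩

theorem contDiff_mul_of_tsupport_subset {φ f : E → ℝ} {O : Set E} (hφ : ContDiff ℝ 1 φ)
    (hO : IsOpen O) (hs : tsupport φ ⊆ O) (hf : ContDiffOn ℝ 1 f O) :
    ContDiff ℝ 1 (fun q => f q * φ q) := by
  rw [contDiff_iff_contDiffAt]
  intro q
  by_cases hq : q ∈ tsupport φ
  · exact (hf.contDiffAt (hO.mem_nhds (hs hq))).mul hφ.contDiffAt
  · have : (fun q => f q * φ q) =ᶠ[𝓝 q] fun _ => 0 := by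
      have h1 := notMem_tsupport_iff_eventuallyEq.1 hq
      filter_upwards [h1] with p hp
      simp [hp]
    exact (contDiffAt_const (c := (0 : ℝ))).congr_of_eventuallyEq this

theorem IsTestFun.mul_left {φ f : E → ℝ} {O O' : Set E} (hφ : IsTestFun φ O) (hO : IsOpen O')
    (hs : tsupport φ ⊆ O') (hf : ContDiffOn ℝ 1 f O') : IsTestFun (fun q => f q * φ q) O :=
  ⟨contDiff_mul_of_tsupport_subset hφ.contDiff hO hs hf, hφ.hasCompactSupport.mul_left,
    (tsupport_mul_subset_right).trans hφ.tsupport_subset⟩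

theorem IsTestFun.fderiv_mul_left {φ f : E → ℝ} {O O' : Set E} (hφ : IsTestFun φ O)
    (hO : IsOpen O') (hs : tsupport φ ⊆ O') (hf : ContDiffOn ℝ 1 f O') (q v : E) :
    fderiv ℝ (fun q => f q * φ q) q v = f q * fderiv ℝ φ q v + φ q * fderiv ℝ f q v := by
  by_cases hq : q ∈ tsupport φ
  · have h1 : DifferentiableAt ℝ f q :=
      (hf.contDiffAt (hO.mem_nhds (hs hq))).differentiableAt one_ne_zero
    have h2 : DifferentiableAt ℝ φ q := hφ.contDiff.contDiffAt.differentiableAt one_ne_zero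
    rw [fderiv_fun_mul h1 h2]
    simp
  · have h1 := notMem_tsupport_iff_eventuallyEq.1 hq
    have h2 : (fun q => f q * φ q) =ᶠ[𝓝 q] fun _ => 0 := by
      filter_upwards [h1] with p hp
      simp [hp]
    rw [h2.fderiv_eq, h1.fderiv_eq, h1.self_of_nhds]
    simp

variable [MeasurableSpace E] [BorelSpace E] [FiniteDimensional ℝ E] {μ : Measure E}
  {V V' : E → E} {h h' : E → ℝ} {O O' : Set E}

theorem integrable_mul_of_tsupport_subset {φ : E → ℝ} (hφ : IsTestFun φ O)
    (hh : LocallyIntegrableOn h O μ) : Integrable (fun q => φ q * h q) μ := by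
  have hc := hφ.hasCompactSupport
  have h1 : IntegrableOn h (tsupport φ) μ := hh.integrableOn_compact_subset hφ.tsupport_subset hc
  have h2 : IntegrableOn (fun q => φ q * h q) (tsupport φ) μ :=
    h1.continuousOn_mul hφ.contDiff.continuous.continuousOn hc
  refine (integrableOn_iff_integrable_of_support_subset ?_).1 h2
  intro q hq
  exact subset_tsupport _ (left_ne_zero_of_mul hq)

theorem integrable_fderiv_of_tsupport_subset {φ : E → ℝ} (hφ : IsTestFun φ O)
    (hV : LocallyIntegrableOn V O μ) : Integrable (fun q => fderiv ℝ φ q (V q)) μ := by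
  have hc := hφ.hasCompactSupport
  have h1 : IntegrableOn V (tsupport φ) μ := hV.integrableOn_compact_subset hφ.tsupport_subset hc
  have hd : Continuous (fderiv ℝ φ) := hφ.contDiff.continuous_fderiv one_ne_zero
  obtain ⟨C, hC⟩ := hd.bounded_above_of_compact_support (hc.fderiv (𝕜 := ℝ))
  have h2 : IntegrableOn (fun q => fderiv ℝ φ q (V q)) (tsupport φ) μ := by
    refine (h1.norm.const_mul C).mono' ?_ ?_
    · exact (ContinuousLinearMap.apply ℝ ℝ : E →L[ℝ] (E →L[ℝ] ℝ) →L[ℝ] ℝ).flip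
        |>.aestronglyMeasurable_comp₂ hd.aestronglyMeasurable h1.aestronglyMeasurable
    · refine Eventually.of_forall fun q => ?_
      exact ((fderiv ℝ φ q).le_opNorm _).trans (by gcongr; exact hC q)
  refine (integrableOn_iff_integrable_of_support_subset ?_).1 h2
  intro q hq
  by_contra hq'
  apply hq
  have := notMem_tsupport_iff_eventuallyEq.1 hq'
  simp [this.fderiv_eq]

theorem WeakDiv.mono (H : WeakDiv μ V h O) (hO : O' ⊆ O) : WeakDiv μ V h O' :=
  fun φ hφ => H φ (hφ.mono hO)

theorem WeakDiv.congr_ae (H : WeakDiv μ V h O) (hV : ∀ᵐ q ∂μ, q ∈ O → V q = V' q)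
    (hh : ∀ᵐ q ∂μ, q ∈ O → h q = h' q) : WeakDiv μ V' h' O := by
  intro φ hφ
  rw [← H φ hφ]
  refine integral_congr_ae ?_
  filter_upwards [hV, hh] with q h1 h2
  by_cases hq : q ∈ tsupport φ
  · rw [h1 (hφ.tsupport_subset hq), h2 (hφ.tsupport_subset hq)]
  · have := notMem_tsupport_iff_eventuallyEq.1 hq
    simp [this.fderiv_eq, this.self_of_nhds]

theorem WeakDiv.of_forall_eq_zero (hV : ∀ q ∈ O, V q = 0) (hh : ∀ q ∈ O, h q = 0) :
    WeakDiv μ V h O := by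
  have H : WeakDiv μ (fun _ : E => (0 : E)) (fun _ => (0 : ℝ)) O := fun φ _ => by simp
  exact H.congr_ae (Eventually.of_forall fun q hq => (hV q hq).symm)
    (Eventually.of_forall fun q hq => (hh q hq).symm)

theorem WeakDiv.add (H : WeakDiv μ V h O) (H' : WeakDiv μ V' h' O)
    (hV : LocallyIntegrableOn V O μ) (hh : LocallyIntegrableOn h O μ)
    (hV' : LocallyIntegrableOn V' O μ) (hh' : LocallyIntegrableOn h' O μ) :
    WeakDiv μ (fun q => V q + V' q) (fun q => h q + h' q) O := by
  intro φ hφ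
  have e : ∀ q, fderiv ℝ φ q (V q + V' q) + φ q * (h q + h' q) =
      (fderiv ℝ φ q (V q) + φ q * h q) + (fderiv ℝ φ q (V' q) + φ q * h' q) := by
    intro q; rw [map_add]; ring
  simp_rw [e]
  rw [integral_add, H φ hφ, H' φ hφ, add_zero]
  · exact (integrable_fderiv_of_tsupport_subset hφ hV).add
      (integrable_mul_of_tsupport_subset hφ hh)
  · exact (integrable_fderiv_of_tsupport_subset hφ hV').add
      (integrable_mul_of_tsupport_subset hφ hh')

theorem WeakDiv.const_smul (H : WeakDiv μ V h O) (a : ℝ) :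
    WeakDiv μ (fun q => a • V q) (fun q => a * h q) O := by
  intro φ hφ
  have e : ∀ q, fderiv ℝ φ q (a • V q) + φ q * (a * h q) =
      a * (fderiv ℝ φ q (V q) + φ q * h q) := by
    intro q; rw [map_smul, smul_eq_mul]; ring
  simp_rw [e]
  rw [integral_const_mul, H φ hφ, mul_zero]

theorem WeakDiv.sub (H : WeakDiv μ V h O) (H' : WeakDiv μ V' h' O)
    (hV : LocallyIntegrableOn V O μ) (hh : LocallyIntegrableOn h O μ)
    (hV' : LocallyIntegrableOn V' O μ) (hh' : LocallyIntegrableOn h' O μ) :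
    WeakDiv μ (fun q => V q - V' q) (fun q => h q - h' q) O := by
  have := H.add (H'.const_smul (-1)) hV hh (hV'.smul (-1 : ℝ)) (hh'.smul (-1 : ℝ))
  refine this.congr_ae (Eventually.of_forall fun q _ => ?_) (Eventually.of_forall fun q _ => ?_)
  · simp [sub_eq_add_neg]
  · ring

/-- Subtracting from a test function its product with a cutoff that is admissible on its own does
not change the pairing. -/
theorem WeakDiv.integral_eq_of_one_sub (hV : LocallyIntegrableOn V O μ)
    (hh : LocallyIntegrableOn h O μ) {φ η : E → ℝ} (hφ : IsTestFun φ O)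
    (hη : IsTestFun (fun q => η q * φ q) O) (H : WeakDiv μ V h O')
    (hs : tsupport (fun q => (1 - η q) * φ q) ⊆ O') :
    ∫ q, (fderiv ℝ φ q (V q) + φ q * h q) ∂μ =
      ∫ q, (fderiv ℝ (fun q => η q * φ q) q (V q) + η q * φ q * h q) ∂μ := by
  have ht : IsTestFun (fun q => (1 - η q) * φ q) O' := by
    refine ⟨?_, hφ.hasCompactSupport.mul_left, hs⟩
    have : (fun q => (1 - η q) * φ q) = fun q => φ q - η q * φ q := by ext q; ring
    rw [this]
    exact hφ.contDiff.sub hη.contDiff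
  have h0 := H _ ht
  have e : ∀ q, fderiv ℝ (fun q => (1 - η q) * φ q) q (V q) + (1 - η q) * φ q * h q =
      (fderiv ℝ φ q (V q) + φ q * h q) -
        (fderiv ℝ (fun q => η q * φ q) q (V q) + η q * φ q * h q) := by
    intro q
    have : (fun q => (1 - η q) * φ q) = fun q => φ q - η q * φ q := by ext q; ring
    rw [this, fderiv_fun_sub (hφ.contDiff.differentiable one_ne_zero q)
      (hη.contDiff.differentiable one_ne_zero q)]
    simp only [FunLike.coe_sub, Pi.sub_apply]
    ring
  simp_rw [e] at h0
  rw [integral_sub] at h0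
  · linarith
  · exact (integrable_fderiv_of_tsupport_subset hφ hV).add
      (integrable_mul_of_tsupport_subset hφ hh)
  · exact (integrable_fderiv_of_tsupport_subset hη hV).add
      (integrable_mul_of_tsupport_subset hη hh)

theorem exists_bump_subset {O : Set E} (hO : IsOpen O) {q : E} (hq : q ∈ O) :
    ∃ (f : E → ℝ) (B : Set E), IsOpen B ∧ q ∈ B ∧ (∀ p ∈ B, f p = 1) ∧ ContDiff ℝ 1 f ∧
      HasCompactSupport f ∧ tsupport f ⊆ O ∧ ∀ p, f p ∈ Icc (0 : ℝ) 1 := by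
  obtain ⟨ε, hε, hB⟩ := Metric.isOpen_iff.1 hO q hq
  let f : ContDiffBump q := ⟨ε / 4, ε / 2, by positivity, by linarith⟩
  refine ⟨f, Metric.ball q (ε / 4), Metric.isOpen_ball, Metric.mem_ball_self (by positivity),
    fun p hp => f.one_of_mem_closedBall (Metric.ball_subset_closedBall hp), f.contDiff,
    f.hasCompactSupport, ?_, fun p => ⟨f.nonneg, f.le_one⟩⟩
  rw [f.tsupport_eq]
  exact (Metric.closedBall_subset_ball (by show ε / 2 < ε; linarith)).trans hB

/-- Weak divergence identities can be checked locally. -/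
theorem WeakDiv.of_locally (hV : LocallyIntegrableOn V O μ) (hh : LocallyIntegrableOn h O μ)
    (H : ∀ q ∈ O, ∃ U, IsOpen U ∧ q ∈ U ∧ WeakDiv μ V h U) : WeakDiv μ V h O := by
  have key : ∀ q ∈ O, ∃ (f : E → ℝ) (B : Set E), IsOpen B ∧ q ∈ B ∧ (∀ p ∈ B, f p = 1) ∧
      ContDiff ℝ 1 f ∧ WeakDiv μ V h (tsupport f) := by
    intro q hq
    obtain ⟨U, hU, hqU, hW⟩ := H q hq
    obtain ⟨f, B, hB, hqB, h1, h2, -, h4, -⟩ := exists_bump_subset hU hqU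
    exact ⟨f, B, hB, hqB, h1, h2, hW.mono h4⟩
  choose! f B hB hqB hf1 hf2 hf3 using key
  -- Each factor 1 - f q can be inserted without changing the pairing, since f q times a test
  -- function is admissible where the identity is known. After finitely many factors the product
  -- vanishes on the support of φ; no partition of unity is needed.
  have prod : ∀ s : Finset E, (∀ q ∈ s, q ∈ O) → ∀ φ, IsTestFun φ O →
      IsTestFun (fun p => (∏ q ∈ s, (1 - f q p)) * φ p) O ∧
      ∫ p, (fderiv ℝ φ p (V p) + φ p * h p) ∂μ =
        ∫ p, (fderiv ℝ (fun p => (∏ q ∈ s, (1 - f q p)) * φ p) p (V p) +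
          (∏ q ∈ s, (1 - f q p)) * φ p * h p) ∂μ := by
    classical
    intro s
    induction s using Finset.induction_on with
    | empty => intro _ φ hφ; simpa using hφ
    | insert q s hqs ih =>
      intro hs φ hφ
      have hqO := hs q (Finset.mem_insert_self _ _)
      obtain ⟨i1, i2⟩ := ih (fun p hp => hs p (Finset.mem_insert_of_mem hp)) φ hφ
      have e : (fun p => (∏ q ∈ insert q s, (1 - f q p)) * φ p) =
          fun p => (1 - f q p) * ((∏ q ∈ s, (1 - f q p)) * φ p) := by
        ext p; rw [Finset.prod_insert hqs]; ring
      have c1 : ContDiff ℝ 1 (fun p => 1 - f q p) := contDiff_const.sub (hf2 q hqO)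
      have t1 := i1.mul_left isOpen_univ (subset_univ _) c1.contDiffOn
      rw [e]
      refine ⟨t1, i2.trans ?_⟩
      have := WeakDiv.integral_eq_of_one_sub hV hh i1 t1 (hf3 q hqO) ?_
      · rw [this]
        refine integral_congr_ae (Eventually.of_forall fun p => ?_)
        simp only [Finset.prod_insert hqs]
        ring
      · have : (fun p => (1 - (1 - f q p)) * ((∏ q ∈ s, (1 - f q p)) * φ p)) =
          fun p => f q p * ((∏ q ∈ s, (1 - f q p)) * φ p) := by ext p; ring
        rw [this]
        exact tsupport_mul_subset_left
  intro φ hφ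
  obtain ⟨s, hs, hcov⟩ := hφ.hasCompactSupport.isCompact.elim_nhds_subcover B
    (fun q hq => (hB q (hφ.tsupport_subset hq)).mem_nhds (hqB q (hφ.tsupport_subset hq)))
  rw [(prod s (fun q hq => hφ.tsupport_subset (hs q hq)) φ hφ).2]
  have z' : ∀ p, (∏ q ∈ s, (1 - f q p)) * φ p = 0 := by
    intro p
    by_cases hp : p ∈ tsupport φ
    · obtain ⟨x, hx, hpx⟩ := mem_iUnion₂.1 (hcov hp)
      rw [Finset.prod_eq_zero hx, zero_mul]
      rw [hf1 x (hφ.tsupport_subset (hs x hx)) p hpx, sub_self]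
    · rw [image_eq_zero_of_notMem_tsupport hp, mul_zero]
  have z : (fun p => (∏ q ∈ s, (1 - f q p)) * φ p) = fun _ => 0 := funext z'
  rw [z]
  simp [z']

/-- The closed set `C` is locally removable for the identity `div V = h` in `O`. -/
def LocallyRemovable (μ : Measure E) (V : E → E) (h : E → ℝ) (O C : Set E) : Prop :=
  ∀ q ∈ C ∩ O, ∃ U, IsOpen U ∧ q ∈ U ∧ ∀ U' ⊆ U, IsOpen U' → WeakDiv μ V h (U' \ C) →
    WeakDiv μ V h U'

/-- By Baire's theorem, a countable union of closed locally removable sets is removable if it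
contains the set in whose complement the identity holds locally. -/
theorem WeakDiv.of_locallyRemovable {ι : Type*} [Countable ι] (hO : IsOpen O)
    (hV : LocallyIntegrableOn V O μ) (hh : LocallyIntegrableOn h O μ) (C : ι → Set E)
    (hC : ∀ i, IsClosed (C i)) (hR : ∀ i, LocallyRemovable μ V h O (C i))
    (H : ∀ q ∈ O \ ⋃ i, C i, ∃ U, IsOpen U ∧ q ∈ U ∧ WeakDiv μ V h U) : WeakDiv μ V h O := by
  let N : Set E := ⋃₀ {U | IsOpen U ∧ U ⊆ O ∧ WeakDiv μ V h U}
  have hNo : IsOpen N := isOpen_sUnion fun U hU => hU.1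
  have hNO : N ⊆ O := sUnion_subset fun U hU => hU.2.1
  have hN : WeakDiv μ V h N := by
    refine WeakDiv.of_locally (hV.mono_set hNO) (hh.mono_set hNO) ?_
    rintro q ⟨U, hU, hq⟩
    exact ⟨U, hU.1, hq, hU.2.2⟩
  suffices O ⊆ N from hN.mono this
  by_contra hcon
  -- K is the set of points near which the identity fails. Being locally closed in a
  -- finite-dimensional space it is a Baire space, and the closed sets C i cover it. So some C i
  -- contains a relatively open piece of K; near that piece the complement of C i lies in N, and
  -- removability of C i puts the piece into N, a contradiction.
  let K : Set E := O \ N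
  have hKne : K.Nonempty := nonempty_of_not_subset hcon
  have hKlc : IsLocallyClosed K := hO.isLocallyClosed.inter hNo.isClosed_compl.isLocallyClosed
  have : LocallyCompactSpace K := hKlc.locallyCompactSpace
  have : Nonempty K := hKne.to_subtype
  have hcov : ⋃ i, (Subtype.val ⁻¹' (C i) : Set K) = univ := by
    rw [eq_univ_iff_forall]
    rintro ⟨q, hq⟩
    by_contra hq'
    have : q ∉ ⋃ i, C i := by simpa using hq'
    obtain ⟨U, hU, hqU, hW⟩ := H q ⟨hq.1, this⟩
    exact hq.2 ⟨U ∩ O, ⟨hU.inter hO, inter_subset_right, hW.mono inter_subset_left⟩, hqU, hq.1⟩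
  obtain ⟨i, ⟨q, hqK⟩, hqi⟩ := nonempty_interior_of_iUnion_of_closed
    (fun i => (hC i).preimage continuous_subtype_val) hcov
  obtain ⟨G, hGo, hG⟩ := isOpen_induced_iff.1 (isOpen_interior (s := (Subtype.val ⁻¹' (C i) : Set K)))
  have hqG : q ∈ G := by
    have : (⟨q, hqK⟩ : K) ∈ Subtype.val ⁻¹' G := by rw [hG]; exact hqi
    exact this
  have hGC : ∀ p ∈ G, p ∈ O → p ∉ N → p ∈ C i := by
    intro p hp hpO hpN
    have : (⟨p, hpO, hpN⟩ : K) ∈ Subtype.val ⁻¹' G := hp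
    rw [hG] at this
    have h2 : (⟨p, hpO, hpN⟩ : K) ∈ (Subtype.val ⁻¹' (C i) : Set K) := interior_subset this
    exact h2
  obtain ⟨U, hU, hqU, hrem⟩ := hR i q ⟨hGC q hqG hqK.1 hqK.2, hqK.1⟩
  have := hrem (U ∩ (G ∩ O)) inter_subset_left (hU.inter (hGo.inter hO)) (hN.mono ?_)
  · exact hqK.2 ⟨_, ⟨hU.inter (hGo.inter hO), inter_subset_right.trans inter_subset_right, this⟩,
      hqU, hqG, hqK.1⟩
  · rintro p ⟨⟨-, hpG, hpO⟩, hpC⟩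
    by_contra hpN
    exact hpC (hGC p hpG hpO hpN)

/-- The product rule for a function with weak derivatives and a `C¹` function. -/
theorem WeakDiv.mul_contDiffOn {φ Φ f : E → ℝ} {e : E} (H : WeakDiv μ (fun q => φ q • e) Φ O)
    (hO' : IsOpen O') (hOO : O' ⊆ O) (hf : ContDiffOn ℝ 1 f O') :
    WeakDiv μ (fun q => (φ q * f q) • e) (fun q => f q * Φ q + φ q * fderiv ℝ f q e) O' := by
  intro X hX
  have := H _ ((hX.mul_left hO' hX.tsupport_subset hf).mono hOO)
  rw [← this]
  refine integral_congr_ae (Eventually.of_forall fun q => ?_)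
  simp only [map_smul, smul_eq_mul]
  rw [hX.fderiv_mul_left hO' hX.tsupport_subset hf]
  ring

/-- The integral of a directional derivative of a compactly supported function vanishes. This is the
only integration by parts from which the other divergence identities are built. -/
theorem weakDiv_const [μ.IsAddHaarMeasure] (e : E) (O : Set E) :
    WeakDiv μ (fun _ => e) (fun _ => 0) O := by
  intro X hX
  have hX' := hX.mono (subset_univ O)
  have h1 : Integrable (fun q => fderiv ℝ X q e) μ :=
    integrable_fderiv_of_tsupport_subset hX' ((continuous_const (y := e)).locallyIntegrable.locallyIntegrableOn _)
  have := integral_mul_fderiv_eq_neg_fderiv_mul_of_integrable (μ := μ) (f := fun _ : E => (1 : ℝ))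
    (g := X) (v := e) (by simp) (by simpa using h1)
    (by simpa using hX.contDiff.continuous.integrable_of_hasCompactSupport hX.hasCompactSupport)
    (fun x _ => by fun_prop) (fun x _ => hX.contDiff.differentiable one_ne_zero x)
  simpa using this

theorem weakDiv_contDiffOn [μ.IsAddHaarMeasure] {f : E → ℝ} (e : E) (hO : IsOpen O)
    (hf : ContDiffOn ℝ 1 f O) :
    WeakDiv μ (fun q => f q • e) (fun q => fderiv ℝ f q e) O := by
  have := WeakDiv.mul_contDiffOn (φ := fun _ => 1) (Φ := fun _ => 0) (O := O) (e := e) (μ := μ)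
    (by simpa using weakDiv_const e O) hO subset_rfl hf
  simpa using this

end WeakDivBasics

/-! ### Sets of codimension two are removable -/

section Hausdorff

open scoped ENNReal

/-- Turns a set of diameter d into an open ball around one of its points. The radius must exceed d
strictly, also when d = 0, and this costs an arbitrarily small ε in the k-th power. -/
theorem exists_radius {d ε δ : ℝ} (k : ℕ) (hd : 0 ≤ d) (hdδ : d < δ) (hε : 0 < ε) :
    ∃ r, d < r ∧ 0 < r ∧ r ≤ δ ∧ r ^ k ≤ d ^ k + ε := by
  have h1 : ∀ᶠ r in 𝓝[>] d, r ^ k < d ^ k + ε := by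
    have : ContinuousAt (fun r : ℝ => r ^ k) d := by fun_prop
    exact (this.eventually (gt_mem_nhds (by linarith : d ^ k < d ^ k + ε))).filter_mono
      nhdsWithin_le_nhds
  have h2 : ∀ᶠ r in 𝓝[>] d, r < δ := (gt_mem_nhds hdδ).filter_mono nhdsWithin_le_nhds
  obtain ⟨r, ⟨hr1, hr2⟩, hr3⟩ := ((h1.and h2).and self_mem_nhdsWithin).exists
  exact ⟨r, hr3, hd.trans_lt hr3, hr2.le, hr1.le⟩

/-- In the bound, 1 is the slack in the infimum defining the Hausdorff measure and 2 is the sum of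
the errors (1/2)^n made in passing from diameters to radii. The bound does not depend on δ, which is
what gives cutoffs of bounded energy with shrinking supports. -/
theorem exists_finite_ball_cover {X : Type*} [MetricSpace X] [Nonempty X] [MeasurableSpace X] [BorelSpace X]
    {K : Set X} (hK : IsCompact K) (k : ℕ) (hfin : μH[(k : ℝ)] K < ⊤) {δ : ℝ} (hδ : 0 < δ) :
    ∃ (s : Finset ℕ) (c : ℕ → X) (r : ℕ → ℝ), (∀ i ∈ s, c i ∈ K ∧ 0 < r i ∧ r i ≤ δ) ∧
      K ⊆ ⋃ i ∈ s, Metric.ball (c i) (r i) ∧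
      ∑ i ∈ s, r i ^ k ≤ (μH[(k : ℝ)] K).toReal + 3 := by
  rcases K.eq_empty_or_nonempty with rfl | ⟨x₀, hx₀⟩
  · exact ⟨∅, fun _ => Classical.arbitrary X, fun _ => 0, by simp, by simp, by simp⟩
  have happ := Measure.hausdorffMeasure_apply (k : ℝ) K
  have hlt : μH[(k : ℝ)] K < μH[(k : ℝ)] K + 1 := ENNReal.lt_add_right hfin.ne one_ne_zero
  have hle : (⨅ (t : ℕ → Set X) (_ : K ⊆ ⋃ n, t n)
      (_ : ∀ n, Metric.ediam (t n) ≤ ENNReal.ofReal (δ / 2)),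
      ∑' n, ⨆ (_ : (t n).Nonempty), Metric.ediam (t n) ^ (k : ℝ)) ≤ μH[(k : ℝ)] K := by
    conv_rhs => rw [happ]
    exact le_iSup₂_of_le (ENNReal.ofReal (δ / 2)) (ENNReal.ofReal_pos.2 (by positivity)) le_rfl
  have hlt' := hle.trans_lt hlt
  simp only [iInf_lt_iff] at hlt'
  obtain ⟨t, htK, htd, hsum⟩ := hlt'
  have hdiam : ∀ n, Metric.diam (t n) < δ := fun n => by
    have h1 : Metric.diam (t n) ≤ δ / 2 := ENNReal.toReal_le_of_le_ofReal (by positivity) (htd n)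
    linarith
  have hrad := fun n => exists_radius (ε := (1 / 2 : ℝ) ^ n) k (Metric.diam_nonneg (s := t n))
    (hdiam n) (by positivity)
  choose r hr1 hr2 hr3 hr4 using hrad
  have hc : ∀ n, ∃ c, c ∈ K ∧ ((t n ∩ K).Nonempty → c ∈ t n) := by
    intro n
    by_cases hn : (t n ∩ K).Nonempty
    · exact ⟨hn.some, hn.some_mem.2, fun _ => hn.some_mem.1⟩
    · exact ⟨x₀, hx₀, fun h => absurd h hn⟩
  choose c hcK hct using hc
  -- Only the sets that meet K are kept. This matters for k = 0, where an empty set would count 1 in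
  -- the sum of diam ^ k but nothing in the Hausdorff sum.
  have hcov : K ⊆ ⋃ i : {n : ℕ // (t n ∩ K).Nonempty}, Metric.ball (c i) (r i) := by
    intro x hx
    obtain ⟨n, hn⟩ := mem_iUnion.1 (htK hx)
    have hne : (t n ∩ K).Nonempty := ⟨x, hn, hx⟩
    refine mem_iUnion.2 ⟨⟨n, hne⟩, ?_⟩
    rw [Metric.mem_ball]
    refine lt_of_le_of_lt (Metric.dist_le_diam_of_mem' ?_ hn (hct n hne)) (hr1 n)
    exact ((htd n).trans_lt ENNReal.ofReal_lt_top).ne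
  obtain ⟨s, hs⟩ := hK.elim_finite_subcover _ (fun i => Metric.isOpen_ball) hcov
  classical
  refine ⟨s.image Subtype.val, c, r, fun i _ => ⟨hcK i, hr2 i, hr3 i⟩, ?_, ?_⟩
  · intro x hx
    obtain ⟨i, hi, hxi⟩ := mem_iUnion₂.1 (hs hx)
    exact mem_iUnion₂.2 ⟨i, Finset.mem_image_of_mem _ hi, hxi⟩
  · have e1 : ∑ i ∈ s.image Subtype.val, r i ^ k ≤
        ∑ i ∈ s.image Subtype.val, Metric.diam (t i) ^ k + 2 := by
      calc ∑ i ∈ s.image Subtype.val, r i ^ k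
          ≤ ∑ i ∈ s.image Subtype.val, (Metric.diam (t i) ^ k + (1 / 2 : ℝ) ^ i) :=
            Finset.sum_le_sum fun i _ => hr4 i
        _ = ∑ i ∈ s.image Subtype.val, Metric.diam (t i) ^ k +
            ∑ i ∈ s.image Subtype.val, (1 / 2 : ℝ) ^ i := Finset.sum_add_distrib
        _ ≤ _ := by
            gcongr
            have := summable_geometric_two.sum_le_tsum (s.image Subtype.val)
              (fun i _ => by positivity)
            rwa [tsum_geometric_two] at this
    have e2 : ENNReal.ofReal (∑ i ∈ s.image Subtype.val, Metric.diam (t i) ^ k) ≤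
        μH[(k : ℝ)] K + 1 := by
      rw [ENNReal.ofReal_sum_of_nonneg (fun i _ => by positivity)]
      refine le_trans ?_ ((ENNReal.sum_le_tsum (s.image Subtype.val)).trans hsum.le)
      refine Finset.sum_le_sum fun i hi => ?_
      obtain ⟨j, -, rfl⟩ := Finset.mem_image.1 hi
      refine le_trans ?_ (le_iSup_of_le (j.2.mono inter_subset_left) le_rfl)
      rw [ENNReal.rpow_natCast, ENNReal.ofReal_pow Metric.diam_nonneg]
      gcongr
      exact ENNReal.ofReal_toReal_le
    have e3 : ∑ i ∈ s.image Subtype.val, Metric.diam (t i) ^ k ≤ (μH[(k : ℝ)] K).toReal + 1 := by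
      have h1 := ENNReal.toReal_mono (ENNReal.add_ne_top.2 ⟨hfin.ne, ENNReal.one_ne_top⟩) e2
      rw [ENNReal.toReal_ofReal (Finset.sum_nonneg fun i _ => by positivity),
        ENNReal.toReal_add hfin.ne (by simp)] at h1
      simpa using h1
    linarith

end Hausdorff

/-! ### Cutoffs bounded in H¹ and removability in codimension two -/

section Removable

variable {E : Type*} [NormedAddCommGroup E] [NormedSpace ℝ E] [MeasurableSpace E] [BorelSpace E]
  [FiniteDimensional ℝ E] {μ : Measure E} [μ.IsAddHaarMeasure]

theorem measure_eq_zero_of_hausdorffMeasure_lt_top {d : ℝ} {S : Set E}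
    (hd : d < Module.finrank ℝ E) (hS : μH[d] S < ⊤) : μ S = 0 := by
  have h1 : μH[(Module.finrank ℝ E : ℝ)] S = 0 :=
    (Measure.hausdorffMeasure_zero_or_top hd S).resolve_right hS.ne
  exact Measure.absolutelyContinuous_isAddHaarMeasure μ μH[(Module.finrank ℝ E : ℝ)] h1

theorem exists_deriv_smoothTransition_bound :
    ∃ C, 0 ≤ C ∧ ∀ s, |deriv Real.smoothTransition s| ≤ C ∧
      (1 < s → deriv Real.smoothTransition s = 0) := by
  have hc : Continuous (deriv Real.smoothTransition) :=
    (Real.smoothTransition.contDiff (n := 1)).continuous_deriv le_rfl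
  obtain ⟨C, hC⟩ := (isCompact_Icc (a := (0 : ℝ)) (b := 1)).exists_bound_of_continuousOn
    hc.continuousOn
  have hC0 : 0 ≤ C := (norm_nonneg _).trans (hC 0 (by simp))
  have h1 : ∀ s : ℝ, 1 < s → deriv Real.smoothTransition s = 0 := by
    intro s hs
    have : Real.smoothTransition =ᶠ[𝓝 s] fun _ => 1 := by
      filter_upwards [lt_mem_nhds hs] with y hy using Real.smoothTransition.one_of_one_le hy.le
    rw [this.deriv_eq, deriv_const]
  have h0 : ∀ s : ℝ, s < 0 → deriv Real.smoothTransition s = 0 := by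
    intro s hs
    have : Real.smoothTransition =ᶠ[𝓝 s] fun _ => 0 := by
      filter_upwards [gt_mem_nhds hs] with y hy using Real.smoothTransition.zero_of_nonpos hy.le
    rw [this.deriv_eq, deriv_const]
  refine ⟨C, hC0, fun s => ⟨?_, h1 s⟩⟩
  rcases lt_or_ge s 0 with hs | hs
  · rwa [h0 s hs, abs_zero]
  rcases lt_or_ge 1 s with hs1 | hs1
  · rwa [h1 s hs1, abs_zero]
  · exact hC s ⟨hs, hs1⟩

/-- A compact set of codimension two has cutoff functions which are bounded in `H¹`. -/
theorem exists_cutoff_of_hausdorffMeasure_lt_top {k : ℕ} (hk : Module.finrank ℝ E = k + 2)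
    {K : Set E} (hK : IsCompact K) (hfin : μH[(k : ℝ)] K < ⊤) :
    ∃ C, ∀ δ : ℝ, 0 < δ → ∃ (η : E → ℝ) (G : Set E), ContDiff ℝ 1 η ∧ IsOpen G ∧ K ⊆ G ∧
      (∀ q ∈ G, η q = 1) ∧ (∀ q, η q ∈ Icc (0 : ℝ) 1) ∧ tsupport η ⊆ Metric.cthickening δ K ∧
      Integrable (fun q => ‖fderiv ℝ η q‖ ^ 2) μ ∧ ∫ q, ‖fderiv ℝ η q‖ ^ 2 ∂μ ≤ C := by
  obtain ⟨CH, hCH0, hCH⟩ := exists_deriv_smoothTransition_bound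
  let f : ContDiffBump (0 : E) := ⟨1, 2, one_pos, by norm_num⟩
  have hf1 : ContDiff ℝ 1 f := f.contDiff
  obtain ⟨Cf, hCf⟩ := (hf1.continuous_fderiv one_ne_zero).bounded_above_of_compact_support
    (f.hasCompactSupport.fderiv (𝕜 := ℝ))
  have hCf0 : 0 ≤ Cf := (norm_nonneg _).trans (hCf 0)
  have hμ1 : μ (Metric.ball 0 1) ≠ ⊤ := measure_ball_lt_top.ne
  set m : ℝ := (μ (Metric.ball (0 : E) 1)).toReal with hm
  set M : ℝ := (μH[(k : ℝ)] K).toReal + 3 with hM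
  refine ⟨4 * CH ^ 2 * (Cf ^ 2 * 2 ^ (k + 2) * m * M), fun δ hδ => ?_⟩
  obtain ⟨s, c, r, hs, hcov, hsum⟩ := exists_finite_ball_cover hK k hfin (half_pos hδ)
  let g : ℕ → E → ℝ := fun i q => f ((r i)⁻¹ • (q - c i))
  have hg : ∀ i, ContDiff ℝ 1 (g i) := fun i => hf1.comp (by fun_prop)
  have hgI : ∀ i q, g i q ∈ Icc (0 : ℝ) 1 := fun i q => ⟨f.nonneg, f.le_one⟩
  have hg1 : ∀ i ∈ s, ∀ q ∈ Metric.ball (c i) (r i), g i q = 1 := by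
    intro i hi q hq
    apply f.one_of_mem_closedBall
    have hr := (hs i hi).2.1
    rw [mem_closedBall_zero_iff, norm_smul, norm_inv, Real.norm_of_nonneg hr.le, ← dist_eq_norm]
    show (r i)⁻¹ * dist q (c i) ≤ 1
    rw [inv_mul_le_iff₀ hr, mul_one]
    exact (Metric.mem_ball.1 hq).le
  have hg0 : ∀ i ∈ s, ∀ q ∉ Metric.ball (c i) (2 * r i), g i q = 0 := by
    intro i hi q hq
    apply f.zero_of_le_dist
    have hr := (hs i hi).2.1
    rw [dist_zero_right, norm_smul, norm_inv, Real.norm_of_nonneg hr.le, ← dist_eq_norm]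
    show 2 ≤ (r i)⁻¹ * dist q (c i)
    rw [le_inv_mul_iff₀ hr, mul_comm]
    simpa using hq
  have hts : ∀ i ∈ s, tsupport (g i) ⊆ Metric.closedBall (c i) (2 * r i) := by
    intro i hi
    refine closure_minimal ?_ Metric.isClosed_closedBall
    intro q hq
    by_contra h
    exact hq (hg0 i hi q fun h' => h (Metric.ball_subset_closedBall h'))
  have hgd : ∀ i ∈ s, ∀ q, ‖fderiv ℝ (g i) q‖ ≤ Cf * (r i)⁻¹ := by
    intro i hi q
    have hr := (hs i hi).2.1
    have h1 : HasFDerivAt (fun q : E => (r i)⁻¹ • (q - c i))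
        ((r i)⁻¹ • ContinuousLinearMap.id ℝ E) q :=
      ((hasFDerivAt_id q).sub_const (c i)).const_smul ((r i)⁻¹)
    have h2 := ((hf1.differentiable one_ne_zero) ((r i)⁻¹ • (q - c i))).hasFDerivAt.comp q h1
    have h3 : fderiv ℝ (g i) q = (fderiv ℝ f ((r i)⁻¹ • (q - c i))).comp
      ((r i)⁻¹ • ContinuousLinearMap.id ℝ E) := h2.fderiv
    rw [h3]
    refine (ContinuousLinearMap.opNorm_comp_le _ _).trans ?_
    have h4 : ‖(r i)⁻¹ • ContinuousLinearMap.id ℝ E‖ ≤ (r i)⁻¹ := by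
      rw [norm_smul, norm_inv, Real.norm_of_nonneg hr.le]
      exact mul_le_of_le_one_right (by positivity) ContinuousLinearMap.norm_id_le
    exact mul_le_mul (hCf _) h4 (norm_nonneg _) hCf0
  let ρ : E → ℝ := fun q => ∑ i ∈ s, g i q ^ 2
  have hρ : ContDiff ℝ 1 ρ := ContDiff.sum fun i _ => (hg i).pow 2
  have hρ0 : ∀ q, 0 ≤ ρ q := fun q => Finset.sum_nonneg fun i _ => sq_nonneg _
  let η : E → ℝ := fun q => Real.smoothTransition (ρ q)
  have hη : ContDiff ℝ 1 η := Real.smoothTransition.contDiff.comp hρ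
  -- Where the transition function has nonzero derivative, ∑ g_i² ≤ 1. Cauchy–Schwarz applied to ∑
  -- g_i ‖dg_i‖ then gives a bound whose constant does not involve the number of overlapping balls;
  -- this is why ρ is a sum of squares.
  have hdη : ∀ q, ‖fderiv ℝ η q‖ ^ 2 ≤ 4 * CH ^ 2 * ∑ i ∈ s, ‖fderiv ℝ (g i) q‖ ^ 2 := by
    intro q
    have d1 : HasFDerivAt ρ (∑ i ∈ s, (2 * g i q) • fderiv ℝ (g i) q) q := by
      refine HasFDerivAt.fun_sum fun i _ => ?_
      have := ((hg i).differentiable one_ne_zero q).hasFDerivAt.pow 2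
      simpa using this
    have d2 : HasFDerivAt η (deriv Real.smoothTransition (ρ q) •
        ∑ i ∈ s, (2 * g i q) • fderiv ℝ (g i) q) q :=
      (((Real.smoothTransition.contDiff (n := 1)).differentiable one_ne_zero
        (ρ q)).hasDerivAt).comp_hasFDerivAt q d1
    rw [d2.fderiv]
    rcases lt_or_ge 1 (ρ q) with hq | hq
    · rw [(hCH _).2 hq, zero_smul, norm_zero]
      have : 0 ≤ ∑ i ∈ s, ‖fderiv ℝ (g i) q‖ ^ 2 := Finset.sum_nonneg fun i _ => sq_nonneg _
      rw [zero_pow two_ne_zero]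
      positivity
    have n1 : ‖∑ i ∈ s, (2 * g i q) • fderiv ℝ (g i) q‖ ≤
        2 * ∑ i ∈ s, g i q * ‖fderiv ℝ (g i) q‖ := by
      refine (norm_sum_le _ _).trans (le_of_eq ?_)
      rw [Finset.mul_sum]
      refine Finset.sum_congr rfl fun i _ => ?_
      rw [norm_smul, Real.norm_of_nonneg (by have := (hgI i q).1; positivity)]
      ring
    have n2 : (∑ i ∈ s, g i q * ‖fderiv ℝ (g i) q‖) ^ 2 ≤ ∑ i ∈ s, ‖fderiv ℝ (g i) q‖ ^ 2 := by
      refine (Finset.sum_mul_sq_le_sq_mul_sq s (fun i => g i q) _).trans ?_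
      exact mul_le_of_le_one_left (Finset.sum_nonneg fun i _ => sq_nonneg _) hq
    have n3 : 0 ≤ ∑ i ∈ s, g i q * ‖fderiv ℝ (g i) q‖ :=
      Finset.sum_nonneg fun i _ => mul_nonneg (hgI i q).1 (norm_nonneg _)
    calc ‖deriv Real.smoothTransition (ρ q) • ∑ i ∈ s, (2 * g i q) • fderiv ℝ (g i) q‖ ^ 2
        ≤ (CH * (2 * ∑ i ∈ s, g i q * ‖fderiv ℝ (g i) q‖)) ^ 2 := by
          gcongr
          rw [norm_smul]
          exact mul_le_mul (hCH _).1 n1 (norm_nonneg _) hCH0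
      _ = 4 * CH ^ 2 * (∑ i ∈ s, g i q * ‖fderiv ℝ (g i) q‖) ^ 2 := by ring
      _ ≤ _ := by gcongr
  -- The gradient has size 1/r on a ball of volume of order r^(k+2), so a single bump has energy of
  -- order r^k, which is what the covering sum controls.
  have hint : ∀ i ∈ s, Integrable (fun q => ‖fderiv ℝ (g i) q‖ ^ 2) μ ∧
      ∫ q, ‖fderiv ℝ (g i) q‖ ^ 2 ∂μ ≤ Cf ^ 2 * 2 ^ (k + 2) * m * r i ^ k := by
    intro i hi
    have hr := (hs i hi).2.1
    have hcs : HasCompactSupport (g i) :=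
      (isCompact_closedBall (c i) (2 * r i)).of_isClosed_subset (isClosed_tsupport _) (hts i hi)
    have hz : ∀ q ∉ Metric.closedBall (c i) (2 * r i), ‖fderiv ℝ (g i) q‖ ^ 2 = 0 := by
      intro q hq
      have : fderiv ℝ (g i) q = 0 :=
        image_eq_zero_of_notMem_tsupport fun h => hq (hts i hi (tsupport_fderiv_subset ℝ h))
      rw [this, norm_zero]; norm_num
    have hI : Integrable (fun q => ‖fderiv ℝ (g i) q‖ ^ 2) μ := by
      refine Continuous.integrable_of_hasCompactSupport ?_ ?_
      · exact ((hg i).continuous_fderiv one_ne_zero).norm.pow 2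
      · exact HasCompactSupport.intro (isCompact_closedBall (c i) (2 * r i)) hz
    refine ⟨hI, ?_⟩
    rw [← setIntegral_eq_integral_of_forall_compl_eq_zero hz]
    have hb : ∀ q ∈ Metric.closedBall (c i) (2 * r i),
        ‖fderiv ℝ (g i) q‖ ^ 2 ≤ (Cf * (r i)⁻¹) ^ 2 := fun q _ => by
      gcongr; exact hgd i hi q
    have hfinb : μ (Metric.closedBall (c i) (2 * r i)) ≠ ⊤ := measure_closedBall_lt_top.ne
    calc ∫ q in Metric.closedBall (c i) (2 * r i), ‖fderiv ℝ (g i) q‖ ^ 2 ∂μ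
        ≤ ∫ q in Metric.closedBall (c i) (2 * r i), (Cf * (r i)⁻¹) ^ 2 ∂μ :=
          setIntegral_mono_on hI.integrableOn (integrableOn_const hfinb)
            Metric.isClosed_closedBall.measurableSet hb
      _ = (2 * r i) ^ (k + 2) * m * (Cf * (r i)⁻¹) ^ 2 := by
          rw [setIntegral_const, smul_eq_mul, Measure.real, Measure.addHaar_closedBall μ _ (by positivity), hk,
            ENNReal.toReal_mul, ENNReal.toReal_ofReal (by positivity)]
      _ = Cf ^ 2 * 2 ^ (k + 2) * m * r i ^ k := by
          field_simp
          ring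
  have hsumI : Integrable (fun q => 4 * CH ^ 2 * ∑ i ∈ s, ‖fderiv ℝ (g i) q‖ ^ 2) μ :=
    (integrable_finsetSum _ fun i hi => (hint i hi).1).const_mul _
  have hηI : Integrable (fun q => ‖fderiv ℝ η q‖ ^ 2) μ := by
    refine hsumI.mono' ((hη.continuous_fderiv one_ne_zero).norm.pow 2).aestronglyMeasurable ?_
    refine Eventually.of_forall fun q => ?_
    rw [Real.norm_of_nonneg (by positivity)]
    exact hdη q
  refine ⟨η, ⋃ i ∈ s, Metric.ball (c i) (r i), hη, isOpen_biUnion fun i _ => Metric.isOpen_ball,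
    hcov, ?_, fun q => ⟨Real.smoothTransition.nonneg _, Real.smoothTransition.le_one _⟩, ?_, hηI, ?_⟩
  · intro q hq
    obtain ⟨i, hi, hqi⟩ := mem_iUnion₂.1 hq
    apply Real.smoothTransition.one_of_one_le
    have h1 := Finset.single_le_sum (f := fun i => g i q ^ 2) (fun j _ => sq_nonneg _) hi
    simp only [hg1 i hi q hqi] at h1
    simpa using h1
  · refine closure_minimal ?_ Metric.isClosed_cthickening
    intro q hq
    by_contra hcon
    apply hq
    have : ρ q = 0 := by
      refine Finset.sum_eq_zero fun i hi => ?_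
      rw [hg0 i hi q, zero_pow two_ne_zero]
      intro hqi
      apply hcon
      refine Metric.mem_cthickening_of_dist_le q (c i) δ K (hs i hi).1 ?_
      have := (hs i hi).2.2
      have := Metric.mem_ball.1 hqi
      linarith
    show Real.smoothTransition (ρ q) = 0
    rw [this]; exact Real.smoothTransition.zero
  · calc ∫ q, ‖fderiv ℝ η q‖ ^ 2 ∂μ
        ≤ ∫ q, 4 * CH ^ 2 * ∑ i ∈ s, ‖fderiv ℝ (g i) q‖ ^ 2 ∂μ := integral_mono hηI hsumI hdη
      _ = 4 * CH ^ 2 * ∑ i ∈ s, ∫ q, ‖fderiv ℝ (g i) q‖ ^ 2 ∂μ := by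
          rw [integral_const_mul, integral_finsetSum _ fun i hi => (hint i hi).1]
      _ ≤ 4 * CH ^ 2 * ∑ i ∈ s, Cf ^ 2 * 2 ^ (k + 2) * m * r i ^ k := by
          gcongr with i hi; exact (hint i hi).2
      _ ≤ 4 * CH ^ 2 * (Cf ^ 2 * 2 ^ (k + 2) * m * M) := by
          rw [← Finset.mul_sum]
          have hm0 : 0 ≤ m := ENNReal.toReal_nonneg
          gcongr

/-- A relatively closed set of codimension two is removable for `div V = h` if `V` is locally
square integrable. -/
theorem WeakDiv.of_diff_hausdorff {k : ℕ} (hk : Module.finrank ℝ E = k + 2) {V : E → E}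
    {h : E → ℝ} {U C : Set E} (hC : IsClosed C) (hfin : μH[(k : ℝ)] (C ∩ U) < ⊤)
    (hV : LocallyIntegrableOn V U μ) (hV2 : LocallyIntegrableOn (fun q => ‖V q‖ ^ 2) U μ)
    (hh : LocallyIntegrableOn h U μ) (H : WeakDiv μ V h (U \ C)) : WeakDiv μ V h U := by
  intro φ hφ
  set T := tsupport φ with hT
  have hTc : IsCompact T := hφ.hasCompactSupport
  set K := C ∩ T with hKdef
  have hK : IsCompact K := hTc.inter_left hC
  have hKfin : μH[(k : ℝ)] K < ⊤ :=
    (measure_mono (inter_subset_inter_right _ hφ.tsupport_subset)).trans_lt hfin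
  have hK0 : μ K = 0 := measure_eq_zero_of_hausdorffMeasure_lt_top
    (d := (k : ℝ)) (by rw [hk]; push_cast; linarith) hKfin
  obtain ⟨Cb, hCb⟩ := exists_cutoff_of_hausdorffMeasure_lt_top (μ := μ) hk hK hKfin
  obtain ⟨Cφ, hCφ⟩ := hφ.contDiff.continuous.bounded_above_of_compact_support
    hφ.hasCompactSupport
  obtain ⟨Cd, hCd⟩ := (hφ.contDiff.continuous_fderiv one_ne_zero).bounded_above_of_compact_support
    (hφ.hasCompactSupport.fderiv (𝕜 := ℝ))
  have hCφ0 : 0 ≤ Cφ := (norm_nonneg _).trans (hCφ 0)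
  have hCd0 : 0 ≤ Cd := (norm_nonneg _).trans (hCd 0)
  have iV : IntegrableOn V T μ := hV.integrableOn_compact_subset hφ.tsupport_subset hTc
  have iV2 : IntegrableOn (fun q => ‖V q‖ ^ 2) T μ :=
    hV2.integrableOn_compact_subset hφ.tsupport_subset hTc
  have ih : IntegrableOn h T μ := hh.integrableOn_compact_subset hφ.tsupport_subset hTc
  set I := ∫ q, (fderiv ℝ φ q (V q) + φ q * h q) ∂μ with hI
  have hCb0 : 0 ≤ Cb := by
    obtain ⟨η, G, -, -, -, -, -, -, -, hle⟩ := hCb 1 one_pos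
    exact (integral_nonneg fun q => by positivity).trans hle
  -- an estimate with a small parameter
  have key : ∀ ε : ℝ, 0 < ε → ‖I‖ ≤ ε * Cb := by
    intro ε hε
    -- A bounds all terms free of dη. Its last summand comes from Young's inequality for φ · dη(V),
    -- whose other half ε ‖dη‖² has integral at most ε Cb. Hence boundedness of the cutoff energies
    -- suffices; they need not tend to zero.
    let A : E → ℝ := T.indicator fun q => Cd * ‖V q‖ + Cφ * ‖h q‖ + Cφ ^ 2 / ε * ‖V q‖ ^ 2
    have hA : Integrable A μ := by
      refine IntegrableOn.integrable_indicator ?_ hTc.measurableSet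
      exact ((iV.norm.const_mul _).add (ih.norm.const_mul _)).add (iV2.const_mul _)
    have hA0 : ∀ q, 0 ≤ A q := fun q => by
      refine indicator_nonneg (fun q _ => ?_) q
      positivity
    let Nn : ℕ → Set E := fun n => Metric.cthickening (1 / ((n : ℝ) + 1)) K
    have hNm : ∀ n, MeasurableSet (Nn n) := fun n => Metric.isClosed_cthickening.measurableSet
    have hNa : Antitone Nn := fun a b hab =>
      Metric.cthickening_mono (Nat.one_div_le_one_div hab) K
    have hNi : ⋂ n, Nn n = K := by
      rw [← hK.isClosed.closure_eq]
      refine Subset.antisymm ?_ ?_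
      · intro q hq
        rw [Metric.closure_eq_iInter_cthickening]
        refine mem_iInter₂.2 fun δ hδ => ?_
        obtain ⟨n, hn⟩ := exists_nat_one_div_lt hδ
        exact Metric.cthickening_mono hn.le K (mem_iInter.1 hq n)
      · exact subset_iInter fun n => Metric.closure_subset_cthickening _ _
    -- The supports of the cutoffs shrink to K, which is a null set, so the contribution of A
    -- disappears for fixed ε. Only afterwards does ε tend to 0.
    have hlim := tendsto_setIntegral_of_antitone (f := A) (μ := μ) hNm hNa ⟨0, hA.integrableOn⟩
    rw [hNi, setIntegral_measure_zero A hK0] at hlim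
    have hbd : ∀ n, ‖I‖ ≤ ∫ q in Nn n, A q ∂μ + ε * Cb := by
      intro n
      obtain ⟨η, G, h1, h2, h3, h4, h5, h6, h7, h8⟩ := hCb (1 / ((n : ℝ) + 1)) (by positivity)
      have ht : IsTestFun (fun q => η q * φ q) U :=
        hφ.mul_left isOpen_univ (subset_univ _) h1.contDiffOn
      have hs : tsupport (fun q => (1 - η q) * φ q) ⊆ U \ C := by
        intro q hq
        have hqT : q ∈ T := tsupport_mul_subset_right hq
        refine ⟨hφ.tsupport_subset hqT, fun hqC => ?_⟩
        refine notMem_tsupport_iff_eventuallyEq.2 ?_ hq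
        filter_upwards [h2.mem_nhds (h3 ⟨hqC, hqT⟩)] with p hp
        simp [h4 p hp]
      rw [hI, WeakDiv.integral_eq_of_one_sub hV hh hφ ht H hs]
      have hpt : ∀ q, ‖fderiv ℝ (fun q => η q * φ q) q (V q) + η q * φ q * h q‖ ≤
          (Nn n).indicator A q + ε * ‖fderiv ℝ η q‖ ^ 2 := by
        intro q
        by_cases hq : q ∈ T ∩ Nn n
        · rw [indicator_of_mem hq.2]
          simp only [A, indicator_of_mem hq.1]
          rw [hφ.fderiv_mul_left isOpen_univ (subset_univ _) h1.contDiffOn]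
          have a1 : ‖η q‖ ≤ 1 := by rw [Real.norm_of_nonneg (h5 q).1]; exact (h5 q).2
          have a2 : ‖η q * fderiv ℝ φ q (V q)‖ ≤ Cd * ‖V q‖ := by
            rw [norm_mul]
            calc ‖η q‖ * ‖fderiv ℝ φ q (V q)‖ ≤ 1 * (Cd * ‖V q‖) := by
                  gcongr
                  exact ((fderiv ℝ φ q).le_opNorm _).trans (by gcongr; exact hCd q)
              _ = _ := one_mul _
          have a3 : ‖η q * φ q * h q‖ ≤ Cφ * ‖h q‖ := by
            rw [norm_mul, norm_mul]
            calc ‖η q‖ * ‖φ q‖ * ‖h q‖ ≤ 1 * Cφ * ‖h q‖ := by gcongr; exact hCφ q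
              _ = _ := by ring
          have a4 : ‖φ q * fderiv ℝ η q (V q)‖ ≤ Cφ ^ 2 / ε * ‖V q‖ ^ 2 +
              ε * ‖fderiv ℝ η q‖ ^ 2 := by
            rw [norm_mul]
            calc ‖φ q‖ * ‖fderiv ℝ η q (V q)‖ ≤ Cφ * (‖fderiv ℝ η q‖ * ‖V q‖) := by
                  gcongr
                  · exact hCφ q
                  · exact (fderiv ℝ η q).le_opNorm _
              _ ≤ _ := by
                  have hx : Cφ ^ 2 / ε * ‖V q‖ ^ 2 + ε * ‖fderiv ℝ η q‖ ^ 2 -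
                      Cφ * (‖fderiv ℝ η q‖ * ‖V q‖) =
                      ((Cφ * ‖V q‖ - ε * ‖fderiv ℝ η q‖) ^ 2 +
                        ε * Cφ * (‖fderiv ℝ η q‖ * ‖V q‖)) / ε := by
                    field_simp
                    ring
                  have : 0 ≤ ((Cφ * ‖V q‖ - ε * ‖fderiv ℝ η q‖) ^ 2 +
                        ε * Cφ * (‖fderiv ℝ η q‖ * ‖V q‖)) / ε := by positivity
                  linarith
          calc _ ≤ ‖η q * fderiv ℝ φ q (V q)‖ + ‖φ q * fderiv ℝ η q (V q)‖ +
                ‖η q * φ q * h q‖ := norm_add₃_le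
            _ ≤ _ := by linarith
        · have hz : q ∉ tsupport (fun q => η q * φ q) := fun hq' =>
            hq ⟨tsupport_mul_subset_right hq', h6 (tsupport_mul_subset_left hq')⟩
          have e1 : fderiv ℝ (fun q => η q * φ q) q = 0 :=
            image_eq_zero_of_notMem_tsupport fun h => hz (tsupport_fderiv_subset ℝ h)
          have e2 : η q * φ q = 0 :=
            image_eq_zero_of_notMem_tsupport (f := fun q => η q * φ q) hz
          rw [e1, e2]
          simp only [FunLike.coe_zero, Pi.zero_apply, zero_mul, add_zero, norm_zero]
          have := indicator_nonneg (s := Nn n) (fun q _ => hA0 q) q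
          positivity
      calc _ ≤ ∫ q, ((Nn n).indicator A q + ε * ‖fderiv ℝ η q‖ ^ 2) ∂μ :=
            norm_integral_le_of_norm_le ((hA.indicator (hNm n)).add (h7.const_mul ε))
              (Eventually.of_forall hpt)
        _ = ∫ q in Nn n, A q ∂μ + ε * ∫ q, ‖fderiv ℝ η q‖ ^ 2 ∂μ := by
            rw [integral_add (hA.indicator (hNm n)) (h7.const_mul ε), integral_indicator (hNm n),
              integral_const_mul]
        _ ≤ _ := by gcongr
    have := ge_of_tendsto' (hlim.add_const (ε * Cb)) hbd
    simpa using this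
  have hz : ‖I‖ ≤ 0 := by
    have hl : Tendsto (fun ε : ℝ => ε * Cb) (𝓝[>] 0) (𝓝 0) := by
      have : Tendsto (fun ε : ℝ => ε * Cb) (𝓝 0) (𝓝 (0 * Cb)) :=
        (continuous_id.mul continuous_const).tendsto 0
      rw [zero_mul] at this
      exact this.mono_left nhdsWithin_le_nhds
    exact ge_of_tendsto hl (by filter_upwards [self_mem_nhdsWithin] with ε hε using key ε hε)
  exact norm_le_zero_iff.1 hz

theorem LocallyRemovable.of_hausdorff {k : ℕ} (hk : Module.finrank ℝ E = k + 2) {V : E → E}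
    {h : E → ℝ} {O C : Set E} (hO : IsOpen O) (hC : IsClosed C)
    (hfin : ∀ q ∈ C ∩ O, ∃ U ∈ 𝓝 q, μH[(k : ℝ)] (C ∩ U) < ⊤)
    (hV : LocallyIntegrableOn V O μ) (hV2 : LocallyIntegrableOn (fun q => ‖V q‖ ^ 2) O μ)
    (hh : LocallyIntegrableOn h O μ) : LocallyRemovable μ V h O C := by
  intro q hq
  obtain ⟨U, hU, hUfin⟩ := hfin q hq
  obtain ⟨U₁, hU₁, hU₁o, hqU₁⟩ := mem_nhds_iff.1 hU
  refine ⟨U₁ ∩ O, hU₁o.inter hO, ⟨hqU₁, hq.2⟩, fun U' hU' hU'o HW => ?_⟩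
  have hs : U' ⊆ O := hU'.trans inter_subset_right
  exact WeakDiv.of_diff_hausdorff hk hC ((measure_mono (inter_subset_inter_right _
    (hU'.trans (inter_subset_left.trans hU₁)))).trans_lt hUfin)
    (hV.mono_set hs) (hV2.mono_set hs) (hh.mono_set hs) HW

end Removable

/-! ### Hypersurfaces across which the normal component is continuous are removable -/

section Graph

theorem quasiMeasurePreserving_affine (a : ℝ) {m : ℝ} (hm : m ≠ 0) :
    Measure.QuasiMeasurePreserving (fun s : ℝ => a + m * s) volume volume := by
  have h1 : Measure.QuasiMeasurePreserving (fun s : ℝ => m * s) volume volume := by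
    refine ⟨measurable_const_mul m, ?_⟩
    rw [Real.map_volume_mul_left hm]
    exact Measure.smul_absolutelyContinuous
  exact (measurePreserving_add_left volume a).quasiMeasurePreserving.comp h1

theorem integral_affine (a : ℝ) {m : ℝ} (hm : 0 < m) (F : ℝ → ℝ) :
    ∫ s, m⁻¹ * F (m⁻¹ * (s - a)) = ∫ s, F s := by
  rw [integral_sub_right_eq_self (fun s => m⁻¹ * F (m⁻¹ * s)) a, integral_const_mul,
    Measure.integral_comp_mul_left, inv_inv, abs_of_pos hm, smul_eq_mul, ← mul_assoc,
    inv_mul_cancel₀ hm.ne', one_mul]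

variable {W : Type*} [NormedAddCommGroup W] [NormedSpace ℝ W] [MeasurableSpace W] [BorelSpace W]
  [FiniteDimensional ℝ W] {ν : Measure W} [ν.IsAddHaarMeasure]

theorem ae_notMem_graph {U : Set (W × ℝ)} (hU : IsOpen U) {W₀ : Set W} {τ : W → ℝ}
    (hτ : ContinuousOn τ W₀) (hUW : ∀ q ∈ U, q.1 ∈ W₀) :
    ∀ᵐ q ∂ν.prod (volume : Measure ℝ), q ∈ U → q.2 ≠ τ q.1 := by
  have hc : ContinuousOn (fun q : W × ℝ => q.2 - τ q.1) U :=
    continuousOn_snd.sub (hτ.comp continuousOn_fst hUW)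
  have ho : IsOpen (U ∩ (fun q : W × ℝ => q.2 - τ q.1) ⁻¹' {0}ᶜ) :=
    hc.isOpen_inter_preimage hU isOpen_compl_singleton
  have hm : MeasurableSet (U \ (U ∩ (fun q : W × ℝ => q.2 - τ q.1) ⁻¹' {0}ᶜ)) :=
    hU.measurableSet.diff ho.measurableSet
  have hz : ν.prod (volume : Measure ℝ) (U \ (U ∩ (fun q : W × ℝ => q.2 - τ q.1) ⁻¹' {0}ᶜ)) = 0 := by
    rw [Measure.measure_prod_null hm]
    refine Eventually.of_forall fun y => ?_
    refine measure_mono_null (t := {τ y}) ?_ (measure_singleton _)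
    intro s hs
    simp only [mem_preimage, Set.mem_sdiff, mem_inter_iff, mem_compl_iff, mem_singleton_iff, not_and,
      not_not] at hs
    have := hs.2 hs.1
    rw [mem_singleton_iff]
    linarith
  refine measure_mono_null ?_ hz
  intro q hq
  simp only [mem_compl_iff, mem_ofPred_eq, Classical.not_imp, not_not] at hq
  refine ⟨hq.1, fun h => h.2 ?_⟩
  simp [hq.2]

/-- Cut off near the graph with η_n = χ((n+1)(t - τ(y))). The dangerous term is dη_n(V), which sees
only the component V.2 - dτ(V.1). After rescaling in the normal direction it becomes ∫ χ'(s) c(y, τ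
y + s/(n+1)) ds, where c is φ times this component. If c has a limit L at the graph, this tends to L
∫ χ' = 0. -/
theorem WeakDiv.of_diff_graph {V : W × ℝ → W × ℝ} {h : W × ℝ → ℝ} {U R : Set (W × ℝ)}
    (hU : IsOpen U) {W₀ : Set W} (hW₀ : IsOpen W₀) {τ : W → ℝ} (hτ : ContDiffOn ℝ 1 τ W₀)
    (hUW : ∀ q ∈ U, q.1 ∈ W₀) {M : ℝ}
    (hb : ∀ᵐ q ∂ν.prod (volume : Measure ℝ), q ∈ U → |(V q).2 - fderiv ℝ τ q.1 (V q).1| ≤ M)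
    (hR : ∀ᵐ q ∂ν.prod (volume : Measure ℝ), q ∈ U → q ∈ R)
    (hlim : ∀ᵐ y ∂ν, y ∈ W₀ → (y, τ y) ∈ U →
      ∃ l, Tendsto (fun q => (V q).2 - fderiv ℝ τ y (V q).1) (𝓝[R] (y, τ y)) (𝓝 l))
    (hV : LocallyIntegrableOn V U (ν.prod volume)) (hh : LocallyIntegrableOn h U (ν.prod volume))
    (H : WeakDiv (ν.prod volume) V h (U \ {q | q.2 = τ q.1})) :
    WeakDiv (ν.prod volume) V h U := by
  intro φ hφ
  set μ : Measure (W × ℝ) := ν.prod volume with hμ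
  set T := tsupport φ with hT
  have hTc : IsCompact T := hφ.hasCompactSupport
  have hTU : T ⊆ U := hφ.tsupport_subset
  obtain ⟨Cφ, hCφ⟩ := hφ.contDiff.continuous.bounded_above_of_compact_support
    hφ.hasCompactSupport
  have hCφ0 : 0 ≤ Cφ := (norm_nonneg _).trans (hCφ 0)
  let χ : ContDiffBump (0 : ℝ) := ⟨1, 2, one_pos, by norm_num⟩
  have hχ : ContDiff ℝ 1 χ := χ.contDiff
  have hχ' : Continuous (deriv χ) := hχ.continuous_deriv le_rfl
  have hχi : Integrable (deriv χ) :=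
    hχ'.integrable_of_hasCompactSupport χ.hasCompactSupport.deriv
  -- This cancellation between the two sides of the graph is why a common limit of the normal
  -- component is enough, without the limit being zero.
  have hχ0 : ∫ s, deriv χ s = 0 := by
    have := weakDiv_const (μ := (volume : Measure ℝ)) (1 : ℝ) univ χ
      ⟨hχ, χ.hasCompactSupport, subset_univ _⟩
    simpa using this
  have hn : ∀ n : ℕ, (0 : ℝ) < n + 1 := fun n => by positivity
  have hτc : ContinuousOn τ W₀ := hτ.continuousOn
  let η : ℕ → W × ℝ → ℝ := fun n q => χ ((n + 1) * (q.2 - τ q.1))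
  have hτ' : ContDiffOn ℝ 1 (fun q : W × ℝ => τ q.1) U := hτ.comp contDiffOn_fst hUW
  have hη : ∀ n, ContDiffOn ℝ 1 (η n) U := fun n =>
    hχ.comp_contDiffOn (contDiffOn_const.mul (contDiffOn_snd.sub hτ'))
  have hdη : ∀ n, ∀ q ∈ U, ∀ v : W × ℝ, fderiv ℝ (η n) q v =
      (n + 1) * deriv χ ((n + 1) * (q.2 - τ q.1)) * (v.2 - fderiv ℝ τ q.1 v.1) := by
    intro n q hq v
    have d1 : HasFDerivAt τ (fderiv ℝ τ q.1) q.1 :=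
      ((hτ.contDiffAt (hW₀.mem_nhds (hUW q hq))).differentiableAt one_ne_zero).hasFDerivAt
    have d2 : HasFDerivAt (fun q : W × ℝ => (n + 1) * (q.2 - τ q.1))
        (((n : ℝ) + 1) • (ContinuousLinearMap.snd ℝ W ℝ -
          (fderiv ℝ τ q.1).comp (ContinuousLinearMap.fst ℝ W ℝ))) q :=
      (hasFDerivAt_snd.sub (d1.comp q hasFDerivAt_fst)).const_mul _
    have d3 := ((hχ.differentiable one_ne_zero
      ((n + 1) * (q.2 - τ q.1))).hasDerivAt).comp_hasFDerivAt q d2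
    have d4 : fderiv ℝ (η n) q = _ := d3.fderiv
    rw [d4]
    simp
    ring
  have ht : ∀ n, IsTestFun (fun q => η n q * φ q) U := fun n => hφ.mul_left hU hTU (hη n)
  have hs : ∀ n, tsupport (fun q => (1 - η n q) * φ q) ⊆ U \ {q | q.2 = τ q.1} := by
    intro n q hq
    have hqT : q ∈ T := tsupport_mul_subset_right hq
    refine ⟨hTU hqT, fun hqS => ?_⟩
    refine notMem_tsupport_iff_eventuallyEq.2 ?_ hq
    have hc : ContinuousAt (fun q : W × ℝ => ((n : ℝ) + 1) * (q.2 - τ q.1)) q :=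
      continuousAt_const.mul (continuousAt_snd.sub
        ((hτ'.continuousOn).continuousAt (hU.mem_nhds (hTU hqT))))
    have hq0 : ((n : ℝ) + 1) * (q.2 - τ q.1) = 0 := by
      have : q.2 = τ q.1 := hqS
      rw [this]; ring
    have := hc.eventually (Metric.closedBall_mem_nhds _ one_pos)
    simp only [hq0] at this
    filter_upwards [this] with p hp
    have : η n p = 1 := χ.one_of_mem_closedBall hp
    simp [this]
  set I := ∫ q, (fderiv ℝ φ q (V q) + φ q * h q) ∂μ with hI
  have i1 : Integrable (fun q => fderiv ℝ φ q (V q) + φ q * h q) μ :=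
    (integrable_fderiv_of_tsupport_subset hφ hV).add (integrable_mul_of_tsupport_subset hφ hh)
  have i2 : ∀ n, Integrable (fun q => fderiv ℝ (fun q => η n q * φ q) q (V q) +
      η n q * φ q * h q) μ := fun n =>
    (integrable_fderiv_of_tsupport_subset (ht n) hV).add
      (integrable_mul_of_tsupport_subset (ht n) hh)
  have hηT : ∀ n, ContinuousOn (η n) T := fun n => (hη n).continuousOn.mono hTU
  have i3 : ∀ n, Integrable (fun q => η n q * (fderiv ℝ φ q (V q) + φ q * h q)) μ := by
    intro n
    have := (i1.integrableOn (s := T)).continuousOn_mul (hηT n) hTc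
    refine (integrableOn_iff_integrable_of_support_subset ?_).1 this
    intro q hq
    by_contra hqT
    apply hq
    have := notMem_tsupport_iff_eventuallyEq.1 hqT
    simp [this.fderiv_eq, this.self_of_nhds]
  let c : W × ℝ → ℝ := fun q => φ q * ((V q).2 - fderiv ℝ τ q.1 (V q).1)
  let g : ℕ → W × ℝ → ℝ := fun n q => (n + 1) * deriv χ ((n + 1) * (q.2 - τ q.1)) * c q
  have hsplit : ∀ n q, fderiv ℝ (fun q => η n q * φ q) q (V q) + η n q * φ q * h q =
      η n q * (fderiv ℝ φ q (V q) + φ q * h q) + g n q := by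
    intro n q
    rw [hφ.fderiv_mul_left hU hTU (hη n)]
    by_cases hq : q ∈ U
    · rw [hdη n q hq]
      simp only [g, c]
      ring
    · have : φ q = 0 := image_eq_zero_of_notMem_tsupport fun h => hq (hTU h)
      simp [g, c, this]
  have i4 : ∀ n, Integrable (g n) μ := by
    intro n
    have := (i2 n).sub (i3 n)
    refine this.congr (Eventually.of_forall fun q => ?_)
    simp only [Pi.sub_apply]
    rw [hsplit n q]
    ring
  have hIn : ∀ n, I = ∫ q, η n q * (fderiv ℝ φ q (V q) + φ q * h q) ∂μ + ∫ q, g n q ∂μ := by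
    intro n
    rw [hI, WeakDiv.integral_eq_of_one_sub hV hh hφ (ht n) H (hs n), ← integral_add (i3 n) (i4 n)]
    exact integral_congr_ae (Eventually.of_forall fun q => hsplit n q)
  -- the first integral tends to zero
  have hT1 : Tendsto (fun n => ∫ q, η n q * (fderiv ℝ φ q (V q) + φ q * h q) ∂μ) atTop (𝓝 0) := by
    have := tendsto_integral_of_dominated_convergence (μ := μ) (f := fun _ => (0 : ℝ))
      (F := fun n q => η n q * (fderiv ℝ φ q (V q) + φ q * h q))
      (fun q => ‖fderiv ℝ φ q (V q) + φ q * h q‖) (fun n => (i3 n).aestronglyMeasurable) i1.norm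
      (fun n => Eventually.of_forall fun q => ?_) ?_
    · simpa using this
    · rw [norm_mul]
      refine mul_le_of_le_one_left (norm_nonneg _) ?_
      rw [Real.norm_of_nonneg χ.nonneg]
      exact χ.le_one
    · filter_upwards [ae_notMem_graph (ν := ν) hU hτc hUW] with q hq
      by_cases hqU : q ∈ U
      · have hne : 0 < |q.2 - τ q.1| := abs_pos.2 (sub_ne_zero.2 (hq hqU))
        obtain ⟨N, hN⟩ := exists_nat_gt (2 / |q.2 - τ q.1|)
        refine tendsto_const_nhds.congr' ?_
        filter_upwards [eventually_ge_atTop N] with n hnN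
        have : η n q = 0 := by
          refine χ.zero_of_le_dist ?_
          show (2 : ℝ) ≤ dist _ _
          rw [dist_zero_right, norm_mul, Real.norm_of_nonneg (hn n).le]
          rw [div_lt_iff₀ hne] at hN
          have hNn : (N : ℝ) ≤ n := by exact_mod_cast hnN
          calc (2 : ℝ) ≤ N * |q.2 - τ q.1| := hN.le
            _ ≤ (n + 1) * |q.2 - τ q.1| := by gcongr; linarith
        simp [this]
      · have : q ∉ tsupport φ := fun h => hqU (hTU h)
        have := notMem_tsupport_iff_eventuallyEq.1 this
        simp [this.fderiv_eq, this.self_of_nhds]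
  -- the second integral
  have hcT : ∀ q ∉ T, c q = 0 := fun q hq => by
    simp only [c]
    rw [image_eq_zero_of_notMem_tsupport hq, zero_mul]
  have hM' : ∀ᵐ q ∂μ, |c q| ≤ Cφ * |M| := by
    filter_upwards [hb] with q hq
    by_cases hqT : q ∈ T
    · simp only [c]
      rw [abs_mul]
      exact mul_le_mul (hCφ q) ((hq (hTU hqT)).trans (le_abs_self M)) (abs_nonneg _) hCφ0
    · rw [hcT q hqT, abs_zero]; positivity
  have hcm : AEStronglyMeasurable c μ := by
    have e : c = T.indicator c := by
      refine (indicator_eq_self.2 fun q hq => ?_).symm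
      by_contra hqT
      exact hq (hcT q hqT)
    rw [e, aestronglyMeasurable_indicator_iff hTc.measurableSet]
    have iV : AEStronglyMeasurable V (μ.restrict T) :=
      (hV.integrableOn_compact_subset hTU hTc).aestronglyMeasurable
    have m1 : AEStronglyMeasurable (fun q : W × ℝ => fderiv ℝ τ q.1) (μ.restrict T) := by
      refine ContinuousOn.aestronglyMeasurable ?_ hTc.measurableSet
      exact (hτ.continuousOn_fderiv_of_isOpen hW₀ le_rfl).comp continuousOn_fst
        fun q hq => hUW q (hTU hq)
    have m2 : AEStronglyMeasurable (fun q => fderiv ℝ τ q.1 (V q).1) (μ.restrict T) :=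
      (ContinuousLinearMap.apply ℝ ℝ : W →L[ℝ] (W →L[ℝ] ℝ) →L[ℝ] ℝ).flip
        |>.aestronglyMeasurable_comp₂ m1
          (continuous_fst.comp_aestronglyMeasurable iV)
    exact hφ.contDiff.continuous.aestronglyMeasurable.mul
      ((continuous_snd.comp_aestronglyMeasurable iV).sub m2)
  -- Integral of g n along the normal line over y, in the rescaled variable s; the substitution
  -- absorbs the factor n + 1.
  let κ : ℕ → W → ℝ := fun n y => ∫ s, deriv χ s * c (y, τ y + ((n : ℝ) + 1)⁻¹ * s)
  have hκ : ∀ n y, ∫ s, g n (y, s) = κ n y := by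
    intro n y
    have := integral_affine (τ y) (inv_pos.2 (hn n))
      (fun s => deriv χ s * c (y, τ y + ((n : ℝ) + 1)⁻¹ * s))
    rw [inv_inv] at this
    simp only [κ]
    rw [← this]
    refine integral_congr_ae (Eventually.of_forall fun s => ?_)
    simp only [g]
    have e : τ y + ((n : ℝ) + 1)⁻¹ * (((n : ℝ) + 1) * (s - τ y)) = s := by
      rw [inv_mul_cancel_left₀ (hn n).ne']; ring
    rw [e]
    ring
  have hgκ : ∀ n, ∫ q, g n q ∂μ = ∫ y, κ n y ∂ν := by
    intro n
    rw [hμ, integral_prod _ (i4 n)]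
    exact integral_congr_ae (Eventually.of_forall fun y => hκ n y)
  set D := ∫ s, |deriv χ s| * (Cφ * |M|) with hD
  have hgood : ∀ᵐ y ∂ν, (∀ n, |κ n y| ≤ (Prod.fst '' T).indicator (fun _ => D) y) ∧
      Tendsto (fun n => κ n y) atTop (𝓝 0) := by
    have a1 := Measure.ae_ae_of_ae_prod hM'
    have a2 := Measure.ae_ae_of_ae_prod hR
    have a3 := hcm.prodMk_left
    filter_upwards [a1, a2, a3, hlim] with y h1 h2 h3 h4
    have h1' : ∀ n : ℕ, ∀ᵐ s : ℝ, |c (y, τ y + ((n : ℝ) + 1)⁻¹ * s)| ≤ Cφ * |M| := fun n =>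
      (quasiMeasurePreserving_affine (τ y) (inv_ne_zero (hn n).ne')).ae h1
    -- R has full measure in U, so for almost every y the rescaled points lie in R, for almost every
    -- s and all n at once, whenever they lie in U. The limit at the graph is only assumed along R.
    have h2' : ∀ n : ℕ, ∀ᵐ s : ℝ, (y, τ y + ((n : ℝ) + 1)⁻¹ * s) ∈ U →
        (y, τ y + ((n : ℝ) + 1)⁻¹ * s) ∈ R := fun n =>
      (quasiMeasurePreserving_affine (τ y) (inv_ne_zero (hn n).ne')).ae h2
    have hDi : Integrable (fun s => |deriv χ s| * (Cφ * |M|)) := hχi.abs.mul_const _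
    constructor
    · intro n
      by_cases hy : y ∈ Prod.fst '' T
      · rw [indicator_of_mem hy]
        rw [← Real.norm_eq_abs]
        refine norm_integral_le_of_norm_le hDi ?_
        filter_upwards [h1' n] with s hs
        rw [norm_mul]
        exact mul_le_mul_of_nonneg_left hs (norm_nonneg _)
      · rw [indicator_of_notMem hy]
        have : ∀ s, c (y, s) = 0 := fun s => hcT _ fun hq => hy ⟨_, hq, rfl⟩
        simp [κ, this]
    · have hL : ∃ L, ∀ᵐ s : ℝ, Tendsto (fun n : ℕ => c (y, τ y + ((n : ℝ) + 1)⁻¹ * s)) atTop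
          (𝓝 L) := by
        have hq : ∀ s : ℝ, Tendsto (fun n : ℕ => (y, τ y + ((n : ℝ) + 1)⁻¹ * s)) atTop
            (𝓝 (y, τ y)) := by
          intro s
          have : Tendsto (fun n : ℕ => τ y + ((n : ℝ) + 1)⁻¹ * s) atTop (𝓝 (τ y + 0 * s)) := by
            have := tendsto_one_div_add_atTop_nhds_zero_nat (𝕜 := ℝ)
            simp only [one_div] at this
            exact (this.mul_const s).const_add _
          rw [zero_mul, add_zero] at this
          exact tendsto_const_nhds.prodMk_nhds this
        by_cases hyU : (y, τ y) ∈ U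
        · obtain ⟨l, hl⟩ := h4 (hUW _ hyU) hyU
          refine ⟨φ (y, τ y) * l, ?_⟩
          filter_upwards [ae_all_iff.2 h2'] with s hs
          have ev : ∀ᶠ n : ℕ in atTop, (y, τ y + ((n : ℝ) + 1)⁻¹ * s) ∈ R := by
            filter_upwards [(hq s).eventually (hU.mem_nhds hyU)] with n hn'
            exact hs n hn'
          have := hl.comp (tendsto_nhdsWithin_iff.2 ⟨hq s, ev⟩)
          exact ((hφ.contDiff.continuous.tendsto _).comp (hq s)).mul this
        · refine ⟨0, Eventually.of_forall fun s => ?_⟩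
          have : Tᶜ ∈ 𝓝 (y, τ y) := (isClosed_tsupport φ).isOpen_compl.mem_nhds
            fun h => hyU (hTU h)
          refine tendsto_const_nhds.congr' ?_
          filter_upwards [(hq s).eventually this] with n hn'
          exact (hcT _ hn').symm
      obtain ⟨L, hL⟩ := hL
      have := tendsto_integral_of_dominated_convergence (μ := (volume : Measure ℝ))
        (F := fun (n : ℕ) s => deriv χ s * c (y, τ y + ((n : ℝ) + 1)⁻¹ * s))
        (f := fun s => deriv χ s * L) (fun s => |deriv χ s| * (Cφ * |M|)) (fun n => ?_) hDi
        (fun n => ?_) ?_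
      · rwa [integral_mul_const, hχ0, zero_mul] at this
      · exact hχ'.aestronglyMeasurable.mul (h3.comp_quasiMeasurePreserving
          (quasiMeasurePreserving_affine (τ y) (inv_ne_zero (hn n).ne')))
      · filter_upwards [h1' n] with s hs
        rw [norm_mul]
        exact mul_le_mul_of_nonneg_left hs (norm_nonneg _)
      · filter_upwards [hL] with s hs using hs.const_mul _
  have hT2 : Tendsto (fun n => ∫ q, g n q ∂μ) atTop (𝓝 0) := by
    simp_rw [hgκ]
    have hKm : IsCompact (Prod.fst '' T) := hTc.image continuous_fst
    have := tendsto_integral_of_dominated_convergence (μ := ν) (F := κ) (f := fun _ => (0 : ℝ))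
      ((Prod.fst '' T).indicator fun _ => D) (fun n => ?_)
      (IntegrableOn.integrable_indicator (integrableOn_const hKm.measure_lt_top.ne)
        hKm.measurableSet) (fun n => ?_) ?_
    · simpa using this
    · have := (i4 n).integral_prod_left.aestronglyMeasurable
      simp_rw [hκ] at this
      exact this
    · filter_upwards [hgood] with y hy using hy.1 n
    · filter_upwards [hgood] with y hy using hy.2
  have hfin := hT1.add hT2
  rw [add_zero] at hfin
  exact tendsto_nhds_unique (tendsto_const_nhds.congr hIn) hfin

end Graph

/-! ### Weak divergence under linear changes of variables -/

section Transport

variable {E E' : Type*} [NormedAddCommGroup E] [NormedSpace ℝ E] [MeasurableSpace E]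
  [BorelSpace E] [NormedAddCommGroup E'] [NormedSpace ℝ E'] [MeasurableSpace E'] [BorelSpace E']

theorem IsTestFun.comp_equiv (L : E ≃L[ℝ] E') {φ : E' → ℝ} {O : Set E'} (hφ : IsTestFun φ O) :
    IsTestFun (fun q => φ (L q)) (L ⁻¹' O) := by
  refine ⟨hφ.contDiff.comp L.contDiff, hφ.hasCompactSupport.comp_homeomorph L.toHomeomorph, ?_⟩
  have : tsupport (fun q => φ (L q)) = L ⁻¹' tsupport φ :=
    tsupport_comp_eq_preimage φ L.toHomeomorph
  rw [this]
  exact preimage_mono hφ.tsupport_subset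

/-- By the chain rule d(φ ∘ L)(V) = dφ(L V), and the measure is pushed forward together with the
field, so no Jacobian appears. -/
theorem weakDiv_map_iff (L : E ≃L[ℝ] E') {μ : Measure E} {V : E → E} {h : E → ℝ} {O : Set E} :
    WeakDiv (μ.map L) (fun p => L (V (L.symm p))) (fun p => h (L.symm p)) (L.symm ⁻¹' O) ↔
      WeakDiv μ V h O := by
  have key : ∀ φ : E' → ℝ, ContDiff ℝ 1 φ →
      ∫ p, (fderiv ℝ φ p (L (V (L.symm p))) + φ p * h (L.symm p)) ∂(μ.map L) =
        ∫ q, (fderiv ℝ (fun q => φ (L q)) q (V q) + φ (L q) * h q) ∂μ := by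
    intro φ hφ
    have := L.toHomeomorph.measurableEmbedding.integral_map (μ := μ)
      (fun p => fderiv ℝ φ p (L (V (L.symm p))) + φ p * h (L.symm p))
    refine this.trans (integral_congr_ae (Eventually.of_forall fun q => ?_))
    have hd : HasFDerivAt (fun q => φ (L q)) ((fderiv ℝ φ (L q)).comp (L : E →L[ℝ] E')) q :=
      ((hφ.differentiable one_ne_zero (L q)).hasFDerivAt).comp q L.hasFDerivAt
    simp [hd.fderiv]
  constructor
  · intro H φ hφ
    have h1 := hφ.comp_equiv L.symm
    have h2 := H _ h1
    rw [key _ h1.contDiff] at h2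
    simpa using h2
  · intro H φ hφ
    rw [key φ hφ.contDiff]
    refine H _ ((hφ.comp_equiv L).mono ?_)
    intro q hq
    simpa using hq

theorem weakDiv_smul_measure_iff {μ : Measure E} {V : E → E} {h : E → ℝ} {O : Set E} {κ : ℝ≥0}
    (hκ : κ ≠ 0) : WeakDiv (κ • μ) V h O ↔ WeakDiv μ V h O := by
  refine forall₂_congr fun φ _ => ?_
  rw [integral_smul_nnreal_measure]
  simp [hκ]

end Transport

/-! ### Implicit functions in a product with the real line -/

section Implicit

variable {W : Type*} [NormedAddCommGroup W] [NormedSpace ℝ W] [FiniteDimensional ℝ W]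

/-- The zero set of a `C¹` function is locally a graph. -/
theorem exists_graph_of_fderiv_ne_zero {ψ : W × ℝ → ℝ} {q₀ : W × ℝ} (hψ : ContDiffAt ℝ 1 ψ q₀)
    (h0 : ψ q₀ = 0) (hd : fderiv ℝ ψ q₀ (0, 1) ≠ 0) :
    ∃ (U : Set (W × ℝ)) (W₀ : Set W) (τ : W → ℝ), IsOpen U ∧ q₀ ∈ U ∧ IsOpen W₀ ∧
      ContDiffOn ℝ 1 τ W₀ ∧ ∀ q ∈ U, q.1 ∈ W₀ ∧ (ψ q = 0 ↔ q.2 = τ q.1) := by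
  have := FiniteDimensional.complete ℝ W
  have hinv : (fderiv ℝ ψ q₀ ∘SL ContinuousLinearMap.inr ℝ W ℝ).IsInvertible := by
    refine ⟨ContinuousLinearEquiv.unitsEquivAut ℝ (Units.mk0 _ hd), ?_⟩
    ext
    simp
  let τ := hψ.implicitFunction one_ne_zero hinv
  have hτ : ContDiffAt ℝ 1 τ q₀.1 := hψ.contDiffAt_implicitFunction one_ne_zero hinv
  have hev := hψ.eventually_apply_eq_iff_implicitFunction one_ne_zero hinv
  obtain ⟨W₀, hW₀s, hW₀o, hW₀⟩ := eventually_nhds_iff.1 (hτ.eventually (by simp))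
  obtain ⟨U, hUs, hUo, hU⟩ := eventually_nhds_iff.1 hev
  refine ⟨U ∩ Prod.fst ⁻¹' W₀, W₀, τ, hUo.inter (hW₀o.preimage continuous_fst), ⟨hU, hW₀⟩, hW₀o,
    fun y hy => (hW₀s y hy).contDiffWithinAt, fun q hq => ⟨hq.2, ?_⟩⟩
  rw [← h0, hUs q hq.1]
  exact eq_comm

theorem isOpen_inter_norm_fderiv_lt {τ : W → ℝ} {W₀ : Set W} (hW₀ : IsOpen W₀)
    (hτ : ContDiffOn ℝ 1 τ W₀) (B : ℝ) :
    IsOpen (W₀ ∩ (fun y => ‖fderiv ℝ τ y‖) ⁻¹' Iio B) :=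
  (hτ.continuousOn_fderiv_of_isOpen hW₀ le_rfl).norm.isOpen_inter_preimage hW₀ isOpen_Iio

theorem abs_snd_sub_apply_fst_le (f : W →L[ℝ] ℝ) {B : ℝ} (hB : ‖f‖ ≤ B) (v : W × ℝ) :
    |v.2 - f v.1| ≤ ‖v‖ * (1 + B) := by
  have h1 : ‖f v.1‖ ≤ B * ‖v‖ := (f.le_opNorm _).trans
    (mul_le_mul hB (norm_fst_le v) (norm_nonneg _) ((norm_nonneg _).trans hB))
  have h2 : ‖v.2‖ ≤ ‖v‖ := norm_snd_le v
  have h3 := norm_sub_le v.2 (f v.1)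
  rw [← Real.norm_eq_abs]
  linarith

end Implicit

/-! ### Hypersurfaces in coordinates adapted to the conormal -/

section Hypersurface

variable {E : Type*} [NormedAddCommGroup E] [NormedSpace ℝ E]

/-- The splitting of a space along the kernel of a functional. -/
noncomputable def kerProdEquiv (ν : E →L[ℝ] ℝ) (e : E) (he : ν e = 1) :
    E ≃L[ℝ] (LinearMap.ker (ν : E →ₗ[ℝ] ℝ)) × ℝ :=
  ContinuousLinearEquiv.equivOfInverse
    (((ContinuousLinearMap.id ℝ E - ν.smulRight e).codRestrict (LinearMap.ker (ν : E →ₗ[ℝ] ℝ))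
      (fun q => by simp [he])).prod ν)
    ((LinearMap.ker (ν : E →ₗ[ℝ] ℝ)).subtypeL.coprod
      (ContinuousLinearMap.toSpanSingleton ℝ e))
    (fun q => by simp)
    (fun q => by
      have h1 : ν (q.1 : E) = 0 := q.1.2
      ext <;> simp [h1, he])

theorem kerProdEquiv_symm_apply (ν : E →L[ℝ] ℝ) (e : E) (he : ν e = 1)
    (p : (LinearMap.ker (ν : E →ₗ[ℝ] ℝ)) × ℝ) :
    (kerProdEquiv ν e he).symm p = (p.1 : E) + p.2 • e := by
  simp [kerProdEquiv]

variable [FiniteDimensional ℝ E]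

theorem exists_kerProdEquiv {ν : E →L[ℝ] ℝ} (hν : ν ≠ 0) : ∃ e, ν e = 1 := by
  obtain ⟨v, hv⟩ := DFunLike.ne_iff.1 hν
  refine ⟨(ν v)⁻¹ • v, ?_⟩
  rw [map_smul, smul_eq_mul]
  exact inv_mul_cancel₀ hv

/-- The zero set of a `C¹` function without critical points is locally a graph over the kernel of
the differential. -/
theorem exists_kerProdEquiv_graph {ψ : E → ℝ} {q₀ : E} (hψ : ContDiffAt ℝ 1 ψ q₀) (h0 : ψ q₀ = 0)
    {e : E} (he : fderiv ℝ ψ q₀ e = 1) :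
    ∃ (U : Set E) (W₀ : Set (LinearMap.ker (fderiv ℝ ψ q₀ : E →ₗ[ℝ] ℝ)))
      (τ : LinearMap.ker (fderiv ℝ ψ q₀ : E →ₗ[ℝ] ℝ) → ℝ), IsOpen U ∧ q₀ ∈ U ∧ IsOpen W₀ ∧
      ContDiffOn ℝ 1 τ W₀ ∧ ∀ q ∈ U, (kerProdEquiv _ e he q).1 ∈ W₀ ∧
        (ψ q = 0 ↔ (kerProdEquiv _ e he q).2 = τ (kerProdEquiv _ e he q).1) := by
  set L := kerProdEquiv _ e he
  have hψ' : ContDiffAt ℝ 1 (fun p => ψ (L.symm p)) (L q₀) := by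
    refine ContDiffAt.comp _ ?_ L.symm.contDiff.contDiffAt
    rwa [L.symm_apply_apply]
  have hd : fderiv ℝ (fun p => ψ (L.symm p)) (L q₀) (0, 1) ≠ 0 := by
    have h1 : HasFDerivAt ψ (fderiv ℝ ψ q₀) (L.symm (L q₀)) := by
      rw [L.symm_apply_apply]
      exact (hψ.differentiableAt one_ne_zero).hasFDerivAt
    have h2 := h1.comp (L q₀) (L.symm.hasFDerivAt (x := L q₀))
    have h3 : fderiv ℝ (fun p => ψ (L.symm p)) (L q₀) = _ := h2.fderiv
    rw [h3]
    simp [L, kerProdEquiv_symm_apply, he]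
  obtain ⟨U, W₀, τ, hU, hq, hW, hτ, H⟩ := exists_graph_of_fderiv_ne_zero hψ' (by simpa using h0) hd
  refine ⟨L ⁻¹' U, W₀, τ, hU.preimage L.continuous, hq, hW, hτ, fun q hq => ?_⟩
  have := H (L q) hq
  simpa using this

variable [MeasurableSpace E] [BorelSpace E] {μ : Measure E} [μ.IsAddHaarMeasure]

theorem exists_map_eq_smul_prod {W : Type*} [NormedAddCommGroup W] [NormedSpace ℝ W]
    [FiniteDimensional ℝ W] [MeasurableSpace W] [BorelSpace W] (L : E ≃L[ℝ] W × ℝ)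
    (ν : Measure W) [ν.IsAddHaarMeasure] :
    ∃ κ : ℝ≥0, κ ≠ 0 ∧ μ.map L = κ • ν.prod (volume : Measure ℝ) := by
  have : (μ.map L).IsAddHaarMeasure := L.isAddHaarMeasure_map μ
  refine ⟨_, (Measure.addHaarScalarFactor_pos_of_isAddHaarMeasure (μ.map L)
    (ν.prod volume)).ne', Measure.isAddLeftInvariant_eq_smul _ _⟩

theorem locallyIntegrableOn_comp_symm {W F : Type*} [NormedAddCommGroup W] [NormedSpace ℝ W]
    [FiniteDimensional ℝ W] [MeasurableSpace W] [BorelSpace W] [NormedAddCommGroup F]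
    (L : E ≃L[ℝ] W × ℝ) {ν : Measure W} [ν.IsAddHaarMeasure] {κ : ℝ≥0} (hκ : κ ≠ 0)
    (hmap : μ.map L = κ • ν.prod (volume : Measure ℝ)) {U : Set E} (hU : IsOpen U) {f : E → F}
    (hf : LocallyIntegrableOn f U μ) :
    LocallyIntegrableOn (fun p => f (L.symm p)) (L.symm ⁻¹' U) (ν.prod (volume : Measure ℝ)) := by
  rw [locallyIntegrableOn_iff (hU.preimage L.symm.continuous).isLocallyClosed]
  intro K hKU hK
  have hK' : IsCompact (L.symm '' K) := hK.image L.symm.continuous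
  have h1 : IntegrableOn f (L.symm '' K) μ :=
    hf.integrableOn_compact_subset (image_subset_iff.2 hKU) hK'
  have h2 : IntegrableOn (fun p => f (L.symm p)) K (μ.map L) := by
    refine (L.toHomeomorph.measurableEmbedding.integrableOn_map_iff (μ := μ) (s := K)
      (f := fun p => f (L.symm p))).2 ?_
    have e : (fun p => f (L.symm p)) ∘ L.toHomeomorph = f := by ext q; simp
    have e' : L.toHomeomorph ⁻¹' K = L.symm '' K := by
      ext q; exact ⟨fun h => ⟨L q, h, by simp⟩, by rintro ⟨p, hp, rfl⟩; simpa using hp⟩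
    rw [e, e']
    exact h1
  rw [hmap, IntegrableOn, Measure.restrict_smul] at h2
  exact (integrable_smul_measure (c := (κ : ENNReal)) (by simpa using hκ) (by simp)).1 h2

theorem locallyIntegrableOn_equiv_comp_symm {W : Type*} [NormedAddCommGroup W] [NormedSpace ℝ W]
    [FiniteDimensional ℝ W] [MeasurableSpace W] [BorelSpace W]
    (L : E ≃L[ℝ] W × ℝ) {ν : Measure W} [ν.IsAddHaarMeasure] {κ : ℝ≥0} (hκ : κ ≠ 0)
    (hmap : μ.map L = κ • ν.prod (volume : Measure ℝ)) {U : Set E} (hU : IsOpen U) {V : E → E}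
    (hV : LocallyIntegrableOn V U μ) :
    LocallyIntegrableOn (fun p => L (V (L.symm p))) (L.symm ⁻¹' U)
      (ν.prod (volume : Measure ℝ)) := by
  have h1 := locallyIntegrableOn_comp_symm L hκ hmap hU hV
  rw [locallyIntegrableOn_iff (hU.preimage L.symm.continuous).isLocallyClosed] at h1 ⊢
  exact fun K hKU hK => (L : E →L[ℝ] W × ℝ).integrable_comp (h1 K hKU hK)

/-- In adapted linear coordinates the zero set is a graph, hence null by Fubini. This is used for
the fronts and again for the zero set of u - v. -/
theorem ae_notMem_hypersurface {ψ : E → ℝ} {q₀ : E} (hψ : ContDiffAt ℝ 1 ψ q₀) (h0 : ψ q₀ = 0)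
    (hd : fderiv ℝ ψ q₀ ≠ 0) : ∃ U, IsOpen U ∧ q₀ ∈ U ∧ ∀ᵐ q ∂μ, q ∈ U → ψ q ≠ 0 := by
  obtain ⟨e, he⟩ := exists_kerProdEquiv hd
  obtain ⟨U, W₀, τ, hU, hq, hW, hτ, H⟩ := exists_kerProdEquiv_graph hψ h0 he
  refine ⟨U, hU, hq, ?_⟩
  set L := kerProdEquiv _ e he
  obtain ⟨κ, hκ, hmap⟩ := exists_map_eq_smul_prod (μ := μ) L Measure.addHaar
  have h1 := ae_notMem_graph (ν := Measure.addHaar) (hU.preimage L.symm.continuous)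
    hτ.continuousOn (fun q hq => by simpa using (H _ hq).1)
  have h2 : ∀ᵐ p ∂(μ.map L), p ∈ L.symm ⁻¹' U → p.2 ≠ τ p.1 := by
    rw [hmap]
    exact (Measure.smul_absolutelyContinuous).ae_le h1
  have h3 := ae_of_ae_map L.continuous.measurable.aemeasurable h2
  filter_upwards [h3] with q hq hqU
  rw [Ne, (H q hqU).2]
  exact hq (by simpa using hqU)

/-- A part `C` of a `C¹` hypersurface is removable for `div V = h` if `V` is bounded near `C` and
at almost all points of the hypersurface the normal component of `V` has a limit, the same from
both sides. -/
theorem LocallyRemovable.of_hypersurface {k : ℕ} (hk : Module.finrank ℝ E = k + 2) {V : E → E}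
    {h : E → ℝ} {O C R Z : Set E} (hO : IsOpen O) (hV : LocallyIntegrableOn V O μ)
    (hh : LocallyIntegrableOn h O μ) (hR : ∀ᵐ p ∂μ, p ∈ O → p ∈ R)
    (hZ : μH[(k : ℝ) + 1] Z = 0)
    (hC : ∀ q ∈ C ∩ O, ∃ (U : Set E) (ψ : E → ℝ), IsOpen U ∧ q ∈ U ∧ ContDiffAt ℝ 1 ψ q ∧
      ψ q = 0 ∧ fderiv ℝ ψ q ≠ 0 ∧ (∀ p ∈ C ∩ U, ψ p = 0) ∧
      (∃ M, ∀ᵐ p ∂μ, p ∈ U → ‖V p‖ ≤ M) ∧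
      ∀ p ∈ U, ψ p = 0 → p ∉ Z → ∃ (ψ' : E → ℝ) (ν : E →L[ℝ] ℝ), ν ≠ 0 ∧ HasFDerivAt ψ' ν p ∧
        (∀ᶠ p' in 𝓝 p, ψ p' = 0 → ψ' p' = 0) ∧
        ∃ l, Tendsto (fun p' => ν (V p')) (𝓝[R] p) (𝓝 l)) :
    LocallyRemovable μ V h O C := by
  intro q₀ hq₀
  obtain ⟨U, ψ, hU, hqU, hψ, h0, hd, hCU, ⟨M, hM⟩, hlim⟩ := hC q₀ hq₀
  obtain ⟨e, he⟩ := exists_kerProdEquiv hd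
  obtain ⟨U₁, W₀, τ, hU₁, hqU₁, hW₀, hτ, H⟩ := exists_kerProdEquiv_graph hψ h0 he
  set L := kerProdEquiv _ e he with hL
  obtain ⟨κ, hκ, hmap⟩ := exists_map_eq_smul_prod (μ := μ) L Measure.addHaar
  -- The domain of τ is shrunk to where its slope is below B, so that a bound for V gives one for
  -- the component V.2 - dτ(V.1).
  set B := ‖fderiv ℝ τ (L q₀).1‖ + 1 with hB
  have hW₁ : IsOpen (W₀ ∩ (fun y => ‖fderiv ℝ τ y‖) ⁻¹' Iio B) :=
    isOpen_inter_norm_fderiv_lt hW₀ hτ B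
  set W₁ := W₀ ∩ (fun y => ‖fderiv ℝ τ y‖) ⁻¹' Iio B with hW₁def
  have hτ₁ : ContDiffOn ℝ 1 τ W₁ := hτ.mono inter_subset_left
  refine ⟨O ∩ U ∩ U₁ ∩ (fun q => (L q).1) ⁻¹' W₁,
    ((hO.inter hU).inter hU₁).inter (hW₁.preimage (continuous_fst.comp L.continuous)),
    ⟨⟨⟨hq₀.2, hqU⟩, hqU₁⟩, (H q₀ hqU₁).1, by simp [hB]⟩, fun U' hU' hU'o HW => ?_⟩
  have hU'O : U' ⊆ O := fun q hq => (hU' hq).1.1.1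
  have hU'U : U' ⊆ U := fun q hq => (hU' hq).1.1.2
  have hU'U₁ : U' ⊆ U₁ := fun q hq => (hU' hq).1.2
  have hU'W : ∀ p ∈ L.symm ⁻¹' U', p.1 ∈ W₁ := fun p hp => by simpa using (hU' hp).2
  have hdim : Module.finrank ℝ (LinearMap.ker (fderiv ℝ ψ q₀ : E →ₗ[ℝ] ℝ)) = k + 1 := by
    have := L.toLinearEquiv.finrank_eq
    rw [hk, Module.finrank_prod, Module.finrank_self] at this
    omega
  rw [← weakDiv_map_iff L, hmap, weakDiv_smul_measure_iff hκ]
  have hac : ∀ {P : E → Prop}, (∀ᵐ q ∂μ, P q) →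
      ∀ᵐ p ∂(Measure.addHaar : Measure (LinearMap.ker (fderiv ℝ ψ q₀ : E →ₗ[ℝ] ℝ))).prod
        (volume : Measure ℝ), P (L.symm p) := by
    intro P hP
    have h1 : ∀ᵐ p ∂(μ.map L), P (L.symm p) := by
      have : ∀ᵐ p ∂(μ.map L.toHomeomorph), P (L.symm p) := by
        rw [L.toHomeomorph.measurableEmbedding.ae_map_iff]
        simpa using hP
      exact this
    rw [hmap] at h1
    exact (Measure.ae_smul_measure_iff (c := κ) hκ).1 h1
  have hVl : LocallyIntegrableOn (fun p => L (V (L.symm p))) (L.symm ⁻¹' U')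
        ((Measure.addHaar : Measure (LinearMap.ker (fderiv ℝ ψ q₀ : E →ₗ[ℝ] ℝ))).prod
        (volume : Measure ℝ)) := by
    exact locallyIntegrableOn_equiv_comp_symm L hκ hmap hU'o (hV.mono_set hU'O)
  refine WeakDiv.of_diff_graph (R := L.symm ⁻¹' R) (W₀ := W₁) (τ := τ)
    (M := ‖L.toContinuousLinearMap‖ * |M| * (1 + B))
    (hU'o.preimage L.symm.continuous) hW₁ hτ₁ hU'W ?_ ?_ ?_ hVl
    (locallyIntegrableOn_comp_symm L hκ hmap hU'o (hh.mono_set hU'O)) ?_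
  · filter_upwards [hac hM] with p hp hpU
    have h1 : ‖L (V (L.symm p))‖ ≤ ‖L.toContinuousLinearMap‖ * |M| :=
      (L.toContinuousLinearMap.le_opNorm _).trans
        (by gcongr; exact (hp (hU'U hpU)).trans (le_abs_self M))
    have h2 : ‖fderiv ℝ τ p.1‖ ≤ B := (hU'W p hpU).2.le
    refine (abs_snd_sub_apply_fst_le (fderiv ℝ τ p.1) h2 (L (V (L.symm p)))).trans ?_
    have hB0 : 0 ≤ B := (ContinuousLinearMap.opNorm_nonneg _).trans h2
    gcongr
  · filter_upwards [hac hR] with p hp hpU using hp (hU'O hpU)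
  · have hπ : μH[(k : ℝ) + 1] ((fun q => (L q).1) '' Z) = 0 := by
      have hl : LipschitzWith ‖(ContinuousLinearMap.fst ℝ _ ℝ).comp L.toContinuousLinearMap‖₊
        ((ContinuousLinearMap.fst ℝ _ ℝ).comp L.toContinuousLinearMap) := ContinuousLinearMap.lipschitz _
      have := (hl.lipschitzOnWith (s := Z)).hausdorffMeasure_image_le
        (d := (k : ℝ) + 1) (by positivity)
      rw [hZ, mul_zero] at this
      exact le_antisymm this (zero_le)
    have hnull : (Measure.addHaar : Measure (LinearMap.ker (fderiv ℝ ψ q₀ : E →ₗ[ℝ] ℝ)))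
        ((fun q => (L q).1) '' Z) = 0 := by
      refine Measure.absolutelyContinuous_isAddHaarMeasure _
        μH[(Module.finrank ℝ (LinearMap.ker (fderiv ℝ ψ q₀ : E →ₗ[ℝ] ℝ)) : ℝ)] ?_
      rw [hdim]
      push_cast
      exact hπ
    filter_upwards [measure_eq_zero_iff_ae_notMem.1 hnull] with y hy hyW hyU
    set p := L.symm (y, τ y) with hp
    have hpL : L p = (y, τ y) := L.apply_symm_apply _
    have hpZ : p ∉ Z := fun h => hy ⟨p, h, by simp [hpL]⟩
    have hpψ : ψ p = 0 := (H p (hU'U₁ hyU)).2.2 (by rw [hpL])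
    obtain ⟨ψ', ν, hν, hψ', hev, l, hl⟩ := hlim p (hU'U hyU) hpψ hpZ
    -- the tangent directions are in the kernel of the conormal
    have dτ : HasFDerivAt τ (fderiv ℝ τ y) y :=
      ((hτ₁.contDiffAt (hW₁.mem_nhds hyW)).differentiableAt one_ne_zero).hasFDerivAt
    have dγ : HasFDerivAt (fun y => L.symm (y, τ y)) ((L.symm : _ →L[ℝ] E).comp
        ((ContinuousLinearMap.id ℝ _).prod (fderiv ℝ τ y))) y :=
      L.symm.hasFDerivAt.comp y ((hasFDerivAt_id y).prodMk dτ)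
    have dc := HasFDerivAt.comp y (f := fun y => L.symm (y, τ y)) (by exact hψ') dγ
    have hγc : ContinuousAt (fun y => L.symm (y, τ y)) y := dγ.continuousAt
    have hzero : (ψ' ∘ fun y => L.symm (y, τ y)) =ᶠ[𝓝 y] fun _ => 0 := by
      filter_upwards [hγc.eventually hev, hγc.eventually (hU'o.mem_nhds hyU)] with y' h1 h2
      refine h1 ((H _ (hU'U₁ h2)).2.2 ?_)
      rw [L.apply_symm_apply]
    have htan : ∀ w, ν (L.symm (w, fderiv ℝ τ y w)) = 0 := by
      have := dc.unique ((hasFDerivAt_const (0 : ℝ) y).congr_of_eventuallyEq hzero)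
      intro w
      simpa using congrArg (fun f => f w) this
    -- A functional that kills the tangent space of the graph is a multiple of the graph conormal dt
    -- - dτ, and the multiple is nonzero because ν is. So a limit of ν(V), for whatever local
    -- equation ψ' of the surface, yields a limit of the graph component.
    have hdec : ∀ v, ν (L.symm v) = (v.2 - fderiv ℝ τ y v.1) * ν (L.symm (0, 1)) := by
      intro v
      have e1 : v = (v.1, fderiv ℝ τ y v.1) + (v.2 - fderiv ℝ τ y v.1) • (0, 1) := by
        ext <;> simp
      conv_lhs => rw [e1, map_add, map_add, htan, zero_add, map_smul, map_smul, smul_eq_mul]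
    have hN : ν (L.symm (0, 1)) ≠ 0 := by
      intro hN
      apply hν
      ext v
      have := hdec (L v)
      rw [hN, mul_zero, L.symm_apply_apply] at this
      simpa using this
    refine ⟨l / ν (L.symm (0, 1)), ?_⟩
    have hl' := (hl.comp (f := fun q => L.symm q) (x := 𝓝[L.symm ⁻¹' R] (y, τ y)) ?_).div_const
      (ν (L.symm (0, 1)))
    · refine hl'.congr fun q => ?_
      have := hdec (L (V (L.symm q)))
      rw [L.symm_apply_apply] at this
      simp only [Function.comp]
      rw [this, mul_div_cancel_right₀ _ hN]
    · exact tendsto_nhdsWithin_iff.2 ⟨(L.symm.continuous.tendsto _).mono_left nhdsWithin_le_nhds,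
        self_mem_nhdsWithin⟩
  · rw [← weakDiv_smul_measure_iff hκ, ← hmap]
    have := (weakDiv_map_iff L).2 HW
    refine this.mono ?_
    rintro p ⟨hpU, hpS⟩
    refine ⟨hpU, fun hpC => hpS ?_⟩
    have h1 := hCU _ ⟨hpC, hU'U hpU⟩
    have h2 := (H _ (hU'U₁ hpU)).2.1 h1
    simpa using h2

end Hypersurface

/-! ### Derivatives of functions on space-time -/

section Derivatives

variable {N : ℕ} {c : ℝ} {u : Spacetime N → ℝ}

theorem hasFDerivAt_comp_space {q : Spacetime N} (hu : DifferentiableAt ℝ u q) :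
    HasFDerivAt (fun y => u (y, q.2))
      ((fderiv ℝ u q).comp (ContinuousLinearMap.inl ℝ (Space N) ℝ)) q.1 :=
  HasFDerivAt.comp (f := fun y => (y, q.2)) q.1 hu.hasFDerivAt (hasFDerivAt_prodMk_left q.1 q.2)

theorem hasDerivAt_comp_time {q : Spacetime N} (hu : DifferentiableAt ℝ u q) :
    HasDerivAt (fun s => u (q.1, s)) (fderiv ℝ u q (0, 1)) q.2 := by
  have := HasFDerivAt.comp (f := fun s => (q.1, s)) q.2 hu.hasFDerivAt
    (hasFDerivAt_prodMk_right q.1 q.2)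
  have h := this.hasDerivAt
  rw [ContinuousLinearMap.comp_apply, ContinuousLinearMap.inr_apply] at h
  exact h

theorem inner_spaceGrad {q : Spacetime N} (hu : DifferentiableAt ℝ u q) (v : Space N) :
    ⟪spaceGrad u q, v⟫_ℝ = fderiv ℝ u q (v, 0) := by
  rw [spaceGrad, inner_gradient_left, (hasFDerivAt_comp_space hu).fderiv]
  simp

theorem timeDeriv_eq {q : Spacetime N} (hu : DifferentiableAt ℝ u q) :
    timeDeriv u q = fderiv ℝ u q (0, 1) := (hasDerivAt_comp_time hu).deriv

theorem fderiv_apply_eq {q : Spacetime N} (hu : DifferentiableAt ℝ u q) (v : Spacetime N) :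
    fderiv ℝ u q v = ⟪spaceGrad u q, v.1⟫_ℝ + timeDeriv u q * v.2 := by
  rw [inner_spaceGrad hu, timeDeriv_eq hu]
  have : v = (v.1, 0) + v.2 • ((0, 1) : Spacetime N) := by ext <;> simp
  conv_lhs => rw [this, map_add, map_smul, smul_eq_mul, mul_comm]

theorem continuousOn_timeDeriv {R : Set (Spacetime N)} (hR : IsOpen R) (hu : ContDiffOn ℝ 1 u R) :
    ContinuousOn (timeDeriv u) R := by
  have h1 : ContinuousOn (fun q => fderiv ℝ u q (0, 1)) R :=
    (hu.continuousOn_fderiv_of_isOpen hR le_rfl).clm_apply continuousOn_const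
  exact h1.congr fun q hq =>
    timeDeriv_eq ((hu.contDiffAt (hR.mem_nhds hq)).differentiableAt one_ne_zero)

theorem continuousOn_spaceGrad {R : Set (Spacetime N)} (hR : IsOpen R) (hu : ContDiffOn ℝ 1 u R) :
    ContinuousOn (spaceGrad u) R := by
  have h1 : ContinuousOn (fun q => (InnerProductSpace.toDual ℝ (Space N)).symm
      ((fderiv ℝ u q).comp (ContinuousLinearMap.inl ℝ (Space N) ℝ))) R :=
    (InnerProductSpace.toDual ℝ (Space N)).symm.continuous.comp_continuousOn
      ((hu.continuousOn_fderiv_of_isOpen hR le_rfl).clm_comp continuousOn_const)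
  refine h1.congr fun q hq => ?_
  rw [spaceGrad, gradient, (hasFDerivAt_comp_space
    ((hu.contDiffAt (hR.mem_nhds hq)).differentiableAt one_ne_zero)).fderiv]

/-- The wave operator as the divergence of the flux. -/
theorem waveOp_eq_sum {R : Set (Spacetime N)} (hR : IsOpen R) (hu : ContDiffOn ℝ 2 u R)
    {q : Spacetime N} (hq : q ∈ R) :
    waveOp c u q = ∑ i, fderiv ℝ (fun p => fderiv ℝ u p (EuclideanSpace.basisFun (Fin N) ℝ i, 0)) q
        (EuclideanSpace.basisFun (Fin N) ℝ i, 0)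
      - (1 / c ^ 2) * fderiv ℝ (fun p => fderiv ℝ u p (0, 1)) q (0, 1) := by
  have hd : ∀ p ∈ R, DifferentiableAt ℝ u p := fun p hp =>
    (hu.contDiffAt (hR.mem_nhds hp)).differentiableAt two_ne_zero
  have hd2 : DifferentiableAt ℝ (fderiv ℝ u) q :=
    ((hu.contDiffAt (hR.mem_nhds hq)).fderiv_right (m := 1) (by norm_num)).differentiableAt
      one_ne_zero
  have hdv : ∀ v : Spacetime N, DifferentiableAt ℝ (fun p => fderiv ℝ u p v) q := fun v =>
    hd2.clm_apply (differentiableAt_const v)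
  rw [waveOp]
  congr 1
  · rw [InnerProductSpace.laplacian_eq_iteratedFDeriv_orthonormalBasis _
      (EuclideanSpace.basisFun (Fin N) ℝ)]
    refine Finset.sum_congr rfl fun i _ => ?_
    rw [iteratedFDeriv_two_apply]
    set e := EuclideanSpace.basisFun (Fin N) ℝ i
    have hc : Tendsto (fun y => (y, q.2)) (𝓝 q.1) (𝓝 q) :=
      (Continuous.prodMk_left q.2).tendsto' q.1 q rfl
    have hev : (fun y => fderiv ℝ (fun y => u (y, q.2)) y) =ᶠ[𝓝 q.1]
        fun y => (fderiv ℝ u (y, q.2)).comp (ContinuousLinearMap.inl ℝ (Space N) ℝ) := by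
      filter_upwards [hc.eventually (hR.mem_nhds hq)] with y hy
      exact (hasFDerivAt_comp_space (q := (y, q.2)) (hd _ hy)).fderiv
    have h1 : DifferentiableAt ℝ (fun y => fderiv ℝ (fun y => u (y, q.2)) y) q.1 := by
      refine DifferentiableAt.congr_of_eventuallyEq ?_ hev
      have : DifferentiableAt ℝ (fun y => fderiv ℝ u (y, q.2)) q.1 :=
        DifferentiableAt.comp (f := fun y => (y, q.2)) q.1 hd2 (by fun_prop)
      exact this.clm_comp (differentiableAt_const _)
    have h2 : fderiv ℝ (fun y => fderiv ℝ (fun y => u (y, q.2)) y e) q.1 e =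
        fderiv ℝ (fun y => fderiv ℝ (fun y => u (y, q.2)) y) q.1 e e := by
      rw [fderiv_clm_apply h1 (differentiableAt_const e)]
      simp
    show fderiv ℝ (fun y => fderiv ℝ (fun y => u (y, q.2)) y) q.1 e e = _
    rw [← h2]
    have hev2 : (fun y => fderiv ℝ (fun y => u (y, q.2)) y e) =ᶠ[𝓝 q.1]
        fun y => fderiv ℝ u (y, q.2) (e, 0) := by
      filter_upwards [hev] with y hy
      rw [hy]; simp
    rw [hev2.fderiv_eq]
    have h3 := hasFDerivAt_comp_space (u := fun p => fderiv ℝ u p (e, 0)) (q := q) (hdv _)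
    rw [h3.fderiv]
    simp
  · congr 1
    rw [iteratedDeriv_succ, iteratedDeriv_one]
    have hc : Tendsto (fun s => (q.1, s)) (𝓝 q.2) (𝓝 q) :=
      (Continuous.prodMk_right q.1).tendsto' q.2 q rfl
    have hev : deriv (fun s => u (q.1, s)) =ᶠ[𝓝 q.2] fun s => fderiv ℝ u (q.1, s) (0, 1) := by
      filter_upwards [hc.eventually (hR.mem_nhds hq)] with s hs
      exact (hasDerivAt_comp_time (q := (q.1, s)) (hd _ hs)).deriv
    rw [hev.deriv_eq]
    exact (hasDerivAt_comp_time (u := fun p => fderiv ℝ u p (0, 1)) (q := q) (hdv _)).deriv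

end Derivatives

/-! ### Weak gradients -/

section WeakGrad

variable {N : ℕ}

/-- `(P, r)` is the weak space-time gradient of `φ` in `O`. -/
def HasWeakGrad (φ : Spacetime N → ℝ) (P : Spacetime N → Space N) (r : Spacetime N → ℝ)
    (O : Set (Spacetime N)) : Prop :=
  ∀ e : Spacetime N, WeakDiv volume (fun q => φ q • e) (fun q => ⟪P q, e.1⟫_ℝ + r q * e.2) O

/-- The flux `(∇u, - u_t / c²)`, whose divergence is the wave operator. -/
noncomputable def waveFlux (c : ℝ) (u : Spacetime N → ℝ) (q : Spacetime N) : Spacetime N :=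
  (spaceGrad u q, -(timeDeriv u q / c ^ 2))

theorem WeakDiv.sum {E : Type*} [NormedAddCommGroup E] [NormedSpace ℝ E] [MeasurableSpace E]
    [BorelSpace E] [FiniteDimensional ℝ E] {μ : Measure E} {ι : Type*} (s : Finset ι)
    {V : ι → E → E} {h : ι → E → ℝ} {O : Set E} (H : ∀ i ∈ s, WeakDiv μ (V i) (h i) O)
    (hV : ∀ i ∈ s, LocallyIntegrableOn (V i) O μ) (hh : ∀ i ∈ s, LocallyIntegrableOn (h i) O μ) :
    WeakDiv μ (fun q => ∑ i ∈ s, V i q) (fun q => ∑ i ∈ s, h i q) O := by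
  intro φ hφ
  have e : ∀ q, fderiv ℝ φ q (∑ i ∈ s, V i q) + φ q * ∑ i ∈ s, h i q =
      ∑ i ∈ s, (fderiv ℝ φ q (V i q) + φ q * h i q) := by
    intro q
    rw [map_sum, Finset.mul_sum, Finset.sum_add_distrib]
  simp_rw [e]
  rw [integral_finsetSum]
  · exact Finset.sum_eq_zero fun i hi => H i hi φ hφ
  · exact fun i hi => (integrable_fderiv_of_tsupport_subset hφ (hV i hi)).add
      (integrable_mul_of_tsupport_subset hφ (hh i hi))

/-- The product rule for a function with a weak gradient and the flux of a classical solution. -/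
theorem HasWeakGrad.weakDiv_waveFlux {φ : Spacetime N → ℝ} {P : Spacetime N → Space N}
    {r : Spacetime N → ℝ} {O R : Set (Spacetime N)} (H : HasWeakGrad φ P r O)
    (hφ : ContinuousOn φ O) (hP : LocallyIntegrableOn P O) (hr : LocallyIntegrableOn r O)
    (hR : IsOpen R) (hRO : R ⊆ O) {c : ℝ} {u G : Spacetime N → ℝ} (hu : ContDiffOn ℝ 2 u R)
    (hG : ∀ q ∈ R, waveOp c u q = G q) :
    WeakDiv volume (fun q => φ q • waveFlux c u q)
      (fun q => (⟪P q, spaceGrad u q⟫_ℝ - r q * timeDeriv u q / c ^ 2) + φ q * G q) R := by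
  have hd : ∀ p ∈ R, DifferentiableAt ℝ u p := fun p hp =>
    (hu.contDiffAt (hR.mem_nhds hp)).differentiableAt two_ne_zero
  have hfd : ContDiffOn ℝ 1 (fderiv ℝ u) R := hu.fderiv_of_isOpen hR (by norm_num)
  let b := EuclideanSpace.basisFun (Fin N) ℝ
  -- `none` stands for the time direction and `some i` for the i-th space direction; with the
  -- components f i below, the flux is ∑ f i • e i on R.
  let e : Option (Fin N) → Spacetime N := fun i => i.elim (0, 1) fun i => (b i, 0)
  let f : Option (Fin N) → Spacetime N → ℝ := fun i =>
    i.elim (fun q => -(1 / c ^ 2) * fderiv ℝ u q (0, 1)) fun i q => fderiv ℝ u q (b i, 0)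
  have hf : ∀ i, ContDiffOn ℝ 1 (f i) R := by
    rintro (_ | i)
    · exact contDiffOn_const.mul (hfd.clm_apply contDiffOn_const)
    · exact hfd.clm_apply contDiffOn_const
  have hφR := hφ.mono hRO
  have hmul : ∀ i, WeakDiv volume (fun q => (φ q * f i q) • e i)
      (fun q => f i q * (⟪P q, (e i).1⟫_ℝ + r q * (e i).2) + φ q * fderiv ℝ (f i) q (e i)) R :=
    fun i => WeakDiv.mul_contDiffOn (H (e i)) hR hRO (hf i)
  have hPi : ∀ i, LocallyIntegrableOn (fun q => ⟪P q, (e i).1⟫_ℝ + r q * (e i).2) R := by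
    intro i
    rw [locallyIntegrableOn_iff hR.isLocallyClosed]
    intro K hK hKc
    exact ((hP.integrableOn_compact_subset (hK.trans hRO) hKc).inner_const _).add
      ((hr.integrableOn_compact_subset (hK.trans hRO) hKc).mul_const _)
  have hsum := WeakDiv.sum (μ := volume) Finset.univ (fun i _ => hmul i)
    (fun i _ => ContinuousOn.locallyIntegrableOn
      ((hφR.mul (hf i).continuousOn).smul continuousOn_const) hR.measurableSet)
    (fun i _ => ((hPi i).continuousOn_mul (hf i).continuousOn hR.isLocallyClosed).add
      (ContinuousOn.locallyIntegrableOn (hφR.mul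
        (((hf i).continuousOn_fderiv_of_isOpen hR le_rfl).clm_apply continuousOn_const))
        hR.measurableSet))
  have hgrad : ∀ q ∈ R, ∑ i, fderiv ℝ u q (b i, 0) • b i = spaceGrad u q := by
    intro q hq
    conv_rhs => rw [← b.sum_repr' (spaceGrad u q)]
    refine Finset.sum_congr rfl fun i _ => ?_
    rw [real_inner_comm, inner_spaceGrad (hd q hq)]
  refine hsum.congr_ae (Eventually.of_forall fun q hq => ?_) (Eventually.of_forall fun q hq => ?_)
  · rw [Fintype.sum_option]
    simp only [e, f, Option.elim]
    ext1
    · simp only [Prod.fst_add, Prod.smul_fst, smul_zero, zero_add, Prod.fst_sum, waveFlux]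
      rw [← hgrad q hq, Finset.smul_sum]
      exact Finset.sum_congr rfl fun i _ => by rw [smul_smul]
    · simp only [Prod.snd_add, Prod.smul_snd, Prod.snd_sum, waveFlux, smul_eq_mul,
        mul_zero, Finset.sum_const_zero, timeDeriv_eq (hd q hq)]
      ring
  · rw [Fintype.sum_option, ← hG q hq, waveOp_eq_sum hR hu hq]
    simp only [e, f, Option.elim]
    rw [Finset.sum_add_distrib, ← Finset.mul_sum, ← hgrad q hq, inner_sum,
      timeDeriv_eq (hd q hq)]
    have h1 : fderiv ℝ (fun q => -(1 / c ^ 2) * fderiv ℝ u q (0, 1)) q (0, 1) =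
        -(1 / c ^ 2) * fderiv ℝ (fun q => fderiv ℝ u q (0, 1)) q (0, 1) := by
      rw [fderiv_const_mul]
      · simp
      · exact ((hfd.contDiffAt (hR.mem_nhds hq)).differentiableAt one_ne_zero).clm_apply
          (differentiableAt_const _)
    rw [h1]
    simp only [inner_smul_right, inner_zero_right, mul_zero, add_zero, zero_add, mul_one]
    simp only [b]
    ring

end WeakGrad

/-! ### Wave fronts and exceptional sets -/

section Fronts

variable {N : ℕ} {c : ℝ} {F W : Set (Spacetime N)} {ψ : Spacetime N → ℝ}

instance isAddHaarMeasure_spacetime : (volume : Measure (Spacetime N)).IsAddHaarMeasure :=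
  inferInstanceAs ((volume : Measure (Space N)).prod (volume : Measure ℝ)).IsAddHaarMeasure

theorem finrank_spacetime (hN : 0 < N) : Module.finrank ℝ (Spacetime N) = (N - 1) + 2 := by
  rw [Module.finrank_prod, finrank_euclideanSpace_fin, Module.finrank_self]
  omega

theorem natCast_pred (hN : 0 < N) : ((N - 1 : ℕ) : ℝ) = (N : ℝ) - 1 := by
  rw [Nat.cast_sub hN, Nat.cast_one]

theorem IsFrontChart.contDiffAt (h : IsFrontChart c F W ψ) {q : Spacetime N} (hq : q ∈ W) :
    ContDiffAt ℝ 1 ψ q :=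
  h.contDiffOn.contDiffAt (h.isOpen.mem_nhds hq)

theorem IsFrontChart.eq_zero (h : IsFrontChart c F W ψ) {q : Spacetime N} (hq : q ∈ F ∩ W) :
    ψ q = 0 := by
  rw [h.inter_eq] at hq
  exact hq.2

theorem IsFrontChart.mem (h : IsFrontChart c F W ψ) {q : Spacetime N} (hq : q ∈ W)
    (h0 : ψ q = 0) : q ∈ F := by
  have : q ∈ F ∩ W := by rw [h.inter_eq]; exact ⟨hq, h0⟩
  exact this.1

theorem IsFrontChart.fderiv_ne_zero (h : IsFrontChart c F W ψ) {q : Spacetime N}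
    (hq : q ∈ F ∩ W) : fderiv ℝ ψ q ≠ 0 := by
  intro h0
  apply h.grad_ne_zero q hq
  refine ext_inner_right ℝ fun v => ?_
  rw [inner_spaceGrad ((h.contDiffAt hq.2).differentiableAt one_ne_zero), h0]
  simp

theorem IsWaveFront.volume_eq_zero (h : IsWaveFront c F) : volume F = 0 := by
  refine measure_null_of_locally_null _ fun q hq => ?_
  obtain ⟨W, ψ, hqW, hψ⟩ := h q hq
  obtain ⟨U, hU, hqU, hae⟩ := ae_notMem_hypersurface (μ := volume) (hψ.contDiffAt hqW)
    (hψ.eq_zero ⟨hq, hqW⟩) (hψ.fderiv_ne_zero ⟨hq, hqW⟩)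
  refine ⟨F ∩ (U ∩ W), inter_mem_nhdsWithin _ ((hU.inter hψ.isOpen).mem_nhds ⟨hqU, hqW⟩), ?_⟩
  refine measure_mono_null ?_ hae
  rintro p ⟨hpF, hpU, hpW⟩ hp
  exact hp hpU (hψ.eq_zero ⟨hpF, hpW⟩)

/-- A front is only cut out by local equations and may accumulate elsewhere, so it need not be
closed. Baire's theorem needs closed pieces, which local closedness provides. -/
theorem IsWaveFront.isLocallyClosed (h : IsWaveFront c F) : IsLocallyClosed F := by
  choose! W ψ hW hψ using h
  let O := ⋃ q ∈ F, W q
  have hO : IsOpen O := isOpen_biUnion fun q hq => (hψ q hq).isOpen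
  have hFO : F ⊆ O := fun q hq => mem_biUnion hq (hW q hq)
  refine ⟨O, closure F, hO, isClosed_closure, ?_⟩
  refine Subset.antisymm (fun q hq => ⟨hFO hq, subset_closure hq⟩) ?_
  rintro p ⟨hpO, hpF⟩
  obtain ⟨q, hq, hpW⟩ := mem_iUnion₂.1 hpO
  refine (hψ q hq).mem hpW ?_
  have hc : ContinuousAt (ψ q) p := ((hψ q hq).contDiffAt hpW).continuousAt
  have hcl : p ∈ closure (F ∩ W q) := by
    rw [mem_closure_iff_nhdsWithin_neBot] at hpF ⊢
    rwa [nhdsWithin_inter_of_mem' (mem_nhdsWithin_of_mem_nhds ((hψ q hq).isOpen.mem_nhds hpW))]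
  have : Tendsto (ψ q) (𝓝[F ∩ W q] p) (𝓝 (ψ q p)) := hc.mono_left nhdsWithin_le_nhds
  have hne : (𝓝[F ∩ W q] p).NeBot := mem_closure_iff_nhdsWithin_neBot.1 hcl
  refine tendsto_nhds_unique this (tendsto_const_nhds.congr' ?_)
  filter_upwards [self_mem_nhdsWithin] with x hx
  exact ((hψ q hq).eq_zero hx).symm

theorem IsWaveFront.exists_iUnion_isClosed (h : IsWaveFront c F) :
    ∃ C : ℕ → Set (Spacetime N), (∀ j, IsClosed (C j)) ∧ F = ⋃ j, C j := by
  obtain ⟨O, A, hO, hA, rfl⟩ := h.isLocallyClosed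
  obtain ⟨C, hC, -, hCO, -⟩ := hO.exists_iUnion_isClosed
  refine ⟨fun j => C j ∩ A, fun j => (hC j).inter hA, ?_⟩
  rw [← iUnion_inter, hCO]

/-- Used to split a front into countably many closed pieces, on each of which the essential bound
for the field holds with fixed constant and radius. Closedness holds because a point of the open
ball around q lies in the balls around nearby centres, and a countable intersection of almost sure
events is almost sure. -/
theorem isClosed_setOf_ae_ball {E : Type*} [NormedAddCommGroup E] [MeasurableSpace E]
    (μ : Measure E) (P : E → Prop) (r : ℝ) :
    IsClosed {q : E | ∀ᵐ p ∂μ, p ∈ Metric.ball q r → P p} := by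
  refine IsSeqClosed.isClosed fun x q hx hq => ?_
  have : ∀ᵐ p ∂μ, ∀ n, p ∈ Metric.ball (x n) r → P p := ae_all_iff.2 hx
  filter_upwards [this] with p hp hpq
  have : ∀ᶠ n in atTop, dist p (x n) < r :=
    (tendsto_const_nhds.dist hq).eventually (gt_mem_nhds hpq)
  obtain ⟨n, hn⟩ := this.exists
  exact hp n hn

end Fronts

/-! ### Classical solutions -/

section Solutions

variable {N : ℕ} {c : ℝ} {Ω : Set (Space N)} {G u : Spacetime N → ℝ}
  {F Z : ℕ → Set (Spacetime N)}

theorem isOpen_openCylinder (hΩ : IsOpen Ω) : IsOpen (openCylinder Ω) := hΩ.prod isOpen_Ioi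

theorem regularRegion_subset : regularRegion Ω F Z ⊆ openCylinder Ω := sdiff_subset

theorem openCylinder_subset_closedCylinder : openCylinder Ω ⊆ closedCylinder Ω :=
  prod_mono subset_closure Ioi_subset_Ici_self

namespace IsClassicalSolution

theorem volume_exceptional (hN : 0 < N) (hu : IsClassicalSolution c Ω G u F Z) (k : ℕ) :
    volume (Z k) = 0 := by
  refine measure_eq_zero_of_hausdorffMeasure_lt_top ?_ (hu.measure_exceptional k)
  rw [finrank_spacetime hN, ← natCast_pred hN]
  push_cast
  linarith

theorem hausdorffMeasure_exceptional (hN : 0 < N) (hu : IsClassicalSolution c Ω G u F Z) :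
    μH[((N - 1 : ℕ) : ℝ) + 1] (⋃ k, Z k) = 0 := by
  rw [measure_iUnion_null_iff]
  intro k
  refine (Measure.hausdorffMeasure_zero_or_top (d₁ := (N : ℝ) - 1) ?_ (Z k)).resolve_right
    (hu.measure_exceptional k).ne
  rw [natCast_pred hN]
  linarith

theorem ae_mem_regular (hN : 0 < N) (hu : IsClassicalSolution c Ω G u F Z) :
    ∀ᵐ q, q ∈ openCylinder Ω → q ∈ regularRegion Ω F Z := by
  have h1 : volume ((⋃ k, F k) ∪ ⋃ k, Z k) = 0 := by
    rw [measure_union_null_iff, measure_iUnion_null_iff, measure_iUnion_null_iff]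
    exact ⟨fun k => (hu.front k).volume_eq_zero, fun k => hu.volume_exceptional hN k⟩
  filter_upwards [measure_eq_zero_iff_ae_notMem.1 h1] with q hq hqD using ⟨hqD, hq⟩

theorem removable_exceptional (hN : 0 < N) (hu : IsClassicalSolution c Ω G u F Z)
    {V : Spacetime N → Spacetime N} {h : Spacetime N → ℝ} {O : Set (Spacetime N)} (hO : IsOpen O)
    (hV : LocallyIntegrableOn V O) (hV2 : LocallyIntegrableOn (fun q => ‖V q‖ ^ 2) O)
    (hh : LocallyIntegrableOn h O) (k : ℕ) : LocallyRemovable volume V h O (Z k) := by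
  refine LocallyRemovable.of_hausdorff (finrank_spacetime hN) hO (hu.isClosed_exceptional k)
    (fun q _ => ⟨univ, univ_mem, ?_⟩) hV hV2 hh
  rw [inter_univ, natCast_pred hN]
  exact hu.measure_exceptional k

theorem differentiableAt (hu : IsClassicalSolution c Ω G u F Z) {q : Spacetime N}
    (hq : q ∈ regularRegion Ω F Z) : DifferentiableAt ℝ u q :=
  (hu.contDiffOn.contDiffAt (hu.isOpen_regular.mem_nhds hq)).differentiableAt two_ne_zero

theorem continuousOn_openCylinder (hu : IsClassicalSolution c Ω G u F Z) :
    ContinuousOn u (openCylinder Ω) := hu.continuousOn.mono openCylinder_subset_closedCylinder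

/-- The derivatives are controlled only on the regular region, but this has full measure in the
cylinder. -/
theorem aestronglyMeasurable {X : Type*} [TopologicalSpace X] [TopologicalSpace.PseudoMetrizableSpace X]
    [SecondCountableTopology X] (hN : 0 < N) (hu : IsClassicalSolution c Ω G u F Z)
    {f : Spacetime N → X} (hf : ContinuousOn f (regularRegion Ω F Z)) {S : Set (Spacetime N)}
    (hS : S ⊆ openCylinder Ω) :
    AEStronglyMeasurable f (volume.restrict S) := by
  have h1 : AEStronglyMeasurable f (volume.restrict (regularRegion Ω F Z)) :=
    hf.aestronglyMeasurable hu.isOpen_regular.measurableSet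
  refine h1.mono_measure ?_
  refine Measure.restrict_mono_ae ?_
  filter_upwards [hu.ae_mem_regular hN] with q hq hqS using hq (hS hqS)

theorem aestronglyMeasurable_timeDeriv (hN : 0 < N) (hu : IsClassicalSolution c Ω G u F Z)
    {S : Set (Spacetime N)} (hS : S ⊆ openCylinder Ω) :
    AEStronglyMeasurable (timeDeriv u) (volume.restrict S) :=
  hu.aestronglyMeasurable hN (continuousOn_timeDeriv hu.isOpen_regular
    (hu.contDiffOn.of_le one_le_two)) hS

theorem aestronglyMeasurable_spaceGrad (hN : 0 < N) (hu : IsClassicalSolution c Ω G u F Z)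
    {S : Set (Spacetime N)} (hS : S ⊆ openCylinder Ω) :
    AEStronglyMeasurable (spaceGrad u) (volume.restrict S) :=
  hu.aestronglyMeasurable hN (continuousOn_spaceGrad hu.isOpen_regular
    (hu.contDiffOn.of_le one_le_two)) hS

theorem prod_Ioo_subset (T : ℝ) : Ω ×ˢ Ioo (0 : ℝ) T ⊆ openCylinder Ω :=
  prod_mono subset_rfl Ioo_subset_Ioi_self

theorem memLp_timeDeriv (hN : 0 < N) (hc : 0 < c)
    (hu : IsClassicalSolution c Ω G u F Z) (T : ℝ) :
    MemLp (timeDeriv u) 2 (volume.restrict (Ω ×ˢ Ioo (0 : ℝ) T)) := by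
  have h1 := hu.aestronglyMeasurable_timeDeriv hN (prod_Ioo_subset T)
  rw [memLp_two_iff_integrable_sq h1]
  refine ((hu.finiteEnergy T).const_mul (2 * c ^ 2)).mono' (h1.pow 2)
    (Eventually.of_forall fun q => ?_)
  rw [Real.norm_of_nonneg (sq_nonneg _), energyDensity]
  have : 2 * c ^ 2 * (1 / 2 * ((timeDeriv u q / c) ^ 2 + ‖spaceGrad u q‖ ^ 2)) =
    timeDeriv u q ^ 2 + c ^ 2 * ‖spaceGrad u q‖ ^ 2 := by field_simp
  rw [this]
  nlinarith [sq_nonneg (c * ‖spaceGrad u q‖)]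

theorem memLp_spaceGrad (hN : 0 < N)
    (hu : IsClassicalSolution c Ω G u F Z) (T : ℝ) :
    MemLp (spaceGrad u) 2 (volume.restrict (Ω ×ˢ Ioo (0 : ℝ) T)) := by
  have h1 := hu.aestronglyMeasurable_spaceGrad hN (prod_Ioo_subset T)
  rw [memLp_two_iff_integrable_sq_norm h1]
  refine ((hu.finiteEnergy T).const_mul 2).mono' (h1.norm.pow 2)
    (Eventually.of_forall fun q => ?_)
  rw [Real.norm_of_nonneg (sq_nonneg _), energyDensity]
  nlinarith [sq_nonneg (timeDeriv u q / c)]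

end IsClassicalSolution

theorem volume_prod_Ioo_lt_top (hΩ : Bornology.IsBounded Ω) (T : ℝ) :
    volume (Ω ×ˢ Ioo (0 : ℝ) T) < ⊤ := (hΩ.prod (Metric.isBounded_Ioo 0 T)).measure_lt_top

theorem exists_subset_prod_Ioo {K : Set (Spacetime N)} (hK : IsCompact K)
    (hKD : K ⊆ openCylinder Ω) : ∃ T : ℝ, 0 < T ∧ K ⊆ Ω ×ˢ Ioo (0 : ℝ) T := by
  obtain ⟨T, hT⟩ := (hK.image continuous_snd).bddAbove
  refine ⟨|T| + 1, by positivity, fun q hq => ⟨(hKD hq).1, (hKD hq).2, ?_⟩⟩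
  have := hT (mem_image_of_mem _ hq)
  have h2 := le_abs_self T
  show q.2 < _
  linarith

theorem locallyIntegrableOn_openCylinder {X : Type*} [NormedAddCommGroup X] (hΩ : IsOpen Ω)
    {f : Spacetime N → X} (hf : ∀ T : ℝ, IntegrableOn f (Ω ×ˢ Ioo (0 : ℝ) T)) :
    LocallyIntegrableOn f (openCylinder Ω) := by
  rw [locallyIntegrableOn_iff (isOpen_openCylinder hΩ).isLocallyClosed]
  intro K hK hKc
  obtain ⟨T, -, hT⟩ := exists_subset_prod_Ioo hKc hK
  exact (hf T).mono_set hT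

end Solutions

/-! ### Tail integrals in time -/

section Tail

variable {N : ℕ} {X : Type*} [NormedAddCommGroup X] [NormedSpace ℝ X]

/-- The exchange of the two times in `(x, t, s)`. -/
def swapTimes (N : ℕ) (q : Spacetime N × ℝ) : Spacetime N × ℝ := ((q.1.1, q.2), q.1.2)

theorem measurePreserving_swapTimes :
    MeasurePreserving (swapTimes N) ((volume : Measure (Spacetime N)).prod (volume : Measure ℝ))
      ((volume : Measure (Spacetime N)).prod (volume : Measure ℝ)) := by
  have h1 : MeasurePreserving (MeasurableEquiv.prodAssoc : (Space N × ℝ) × ℝ ≃ᵐ Space N × ℝ × ℝ)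
      (((volume : Measure (Space N)).prod (volume : Measure ℝ)).prod (volume : Measure ℝ))
      ((volume : Measure (Space N)).prod ((volume : Measure ℝ).prod (volume : Measure ℝ))) :=
    measurePreserving_prodAssoc _ _ _
  have h2 : MeasurePreserving (Prod.map id Prod.swap : Space N × ℝ × ℝ → Space N × ℝ × ℝ)
      ((volume : Measure (Space N)).prod ((volume : Measure ℝ).prod (volume : Measure ℝ)))
      ((volume : Measure (Space N)).prod ((volume : Measure ℝ).prod (volume : Measure ℝ))) :=
    (MeasurePreserving.id _).prod Measure.measurePreserving_swap
  exact (h1.symm _).comp (h2.comp h1)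

/-- The tail integral `∫ s in (t, ∞), f (x, s)`. -/
noncomputable def tail (f : Spacetime N → X) (q : Spacetime N) : X := ∫ s in Ioi q.2, f (q.1, s)

theorem tail_eq_integral_indicator (f : Spacetime N → X) (q : Spacetime N) :
    tail f q = ∫ s, (Ioi q.2).indicator (fun s => f (q.1, s)) s :=
  (integral_indicator measurableSet_Ioi).symm

theorem ae_integrable_slice {f : Spacetime N → X} (hf : Integrable f) :
    ∀ᵐ q : Spacetime N, Integrable (fun s => f (q.1, s)) := by
  have h1 : ∀ᵐ x : Space N, Integrable (fun s => f (x, s)) := Integrable.prod_right_ae hf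
  exact Measure.quasiMeasurePreserving_fst.ae h1

/-- `(x, t, s) ↦ ((x, t), (x, s))` has measurable components. -/
theorem integrable_comp_swapTimes {f : Spacetime N × ℝ → X}
    (hf : Integrable f (volume.prod volume)) :
    Integrable (fun q => f (swapTimes N q)) (volume.prod volume) :=
  measurePreserving_swapTimes.integrable_comp_of_integrable hf

theorem aestronglyMeasurable_comp_swapTimes {f : Spacetime N → X}
    (hf : AEStronglyMeasurable f volume) :
    AEStronglyMeasurable (fun q : Spacetime N × ℝ => f (q.1.1, q.2)) (volume.prod volume) :=
  (hf.comp_fst (ν := (volume : Measure ℝ))).comp_measurePreserving measurePreserving_swapTimes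

theorem measurableSet_lt_times : MeasurableSet {q : Spacetime N × ℝ | q.1.2 < q.2} :=
  measurableSet_lt (by fun_prop) (by fun_prop)

theorem tail_mul_eq_integral (f : Spacetime N → ℝ) (Y : ℝ) (q : Spacetime N) :
    Y * tail f q = ∫ s, {p : Spacetime N × ℝ | p.1.2 < p.2}.indicator
      (fun p => Y * f (p.1.1, p.2)) (q, s) := by
  rw [tail_eq_integral_indicator, ← integral_const_mul]
  refine integral_congr_ae (Eventually.of_forall fun s => ?_)
  by_cases h : q.2 < s <;> simp [indicator, h]

/-- Fubini's theorem for a tail integral tested against a bounded function with bounded support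
in time. -/
theorem integrable_and_integral_mul_tail {f Y : Spacetime N → ℝ} (hf : Integrable f)
    (hY : AEStronglyMeasurable Y volume) {C a b : ℝ} (hC : ∀ q, |Y q| ≤ C)
    (hs : ∀ q, q.2 ∉ Icc a b → Y q = 0) :
    Integrable (fun q => Y q * tail f q) ∧
      Integrable (fun q : Spacetime N => f q * ∫ t in Iio q.2, Y (q.1, t)) ∧
      ∫ q, Y q * tail f q = ∫ q : Spacetime N, f q * ∫ t in Iio q.2, Y (q.1, t) := by
  have hC0 : 0 ≤ C := (abs_nonneg _).trans (hC 0)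
  let g : Spacetime N × ℝ → ℝ := {p : Spacetime N × ℝ | p.1.2 < p.2}.indicator
    fun p => Y p.1 * f (p.1.1, p.2)
  have hm : AEStronglyMeasurable g (volume.prod volume) :=
    ((hY.comp_fst).mul (aestronglyMeasurable_comp_swapTimes hf.aestronglyMeasurable)).indicator
      measurableSet_lt_times
  have hb : Integrable (fun p : Spacetime N × ℝ => |f (p.1.1, p.2)| *
      (Icc a b).indicator (fun _ => C) p.1.2) (volume.prod volume) := by
    have h1 : Integrable (fun p : Spacetime N × ℝ => |f p.1| * (Icc a b).indicator (fun _ => C) p.2)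
        (volume.prod volume) :=
      hf.abs.mul_prod ((integrableOn_const (by simp)).integrable_indicator measurableSet_Icc)
    exact integrable_comp_swapTimes h1
  have hg : Integrable g (volume.prod volume) := by
    refine hb.mono' hm (Eventually.of_forall fun p => ?_)
    have hn : 0 ≤ (Icc a b).indicator (fun _ => C) p.1.2 := indicator_nonneg (fun _ _ => hC0) _
    by_cases hp : p.1.2 < p.2
    · have e : g p = Y p.1 * f (p.1.1, p.2) :=
        indicator_of_mem (s := {p : Spacetime N × ℝ | p.1.2 < p.2}) hp _
      rw [e, Real.norm_eq_abs, abs_mul, mul_comm]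
      by_cases hpt : p.1.2 ∈ Icc a b
      · rw [indicator_of_mem hpt]
        gcongr
        exact hC _
      · rw [hs _ hpt, abs_zero, mul_zero]
        positivity
    · have e : g p = 0 :=
        indicator_of_notMem (s := {p : Spacetime N × ℝ | p.1.2 < p.2}) hp _
      rw [e, norm_zero]
      positivity
  have e1 : ∀ q, Y q * tail f q = ∫ s, g (q, s) := fun q => tail_mul_eq_integral f (Y q) q
  have e2 : ∀ q : Spacetime N, f q * ∫ t in Iio q.2, Y (q.1, t) =
      ∫ t, g (swapTimes N (q, t)) := by
    intro q
    rw [← integral_indicator measurableSet_Iio, ← integral_const_mul]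
    refine integral_congr_ae (Eventually.of_forall fun t => ?_)
    by_cases h : t < q.2 <;> simp [indicator, h, g, swapTimes, mul_comm]
  refine ⟨?_, ?_, ?_⟩
  · simp_rw [e1]
    exact hg.integral_prod_left
  · simp_rw [e2]
    exact (integrable_comp_swapTimes hg).integral_prod_left
  · simp_rw [e1, e2]
    rw [← integral_prod _ hg, ← integral_prod _ (integrable_comp_swapTimes hg)]
    have hmp := measurePreserving_swapTimes (N := N)
    conv_lhs => rw [← hmp.map_eq]
    rw [integral_map hmp.measurable.aemeasurable]
    rw [hmp.map_eq]
    exact hm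

theorem inner_tail {f : Spacetime N → Space N} {q : Spacetime N} (e : Space N)
    (hf : Integrable (fun s => f (q.1, s))) :
    ⟪tail f q, e⟫_ℝ = tail (fun p => ⟪f p, e⟫_ℝ) q := by
  rw [tail, tail, real_inner_comm, ← integral_inner hf.integrableOn]
  exact integral_congr_ae (Eventually.of_forall fun s => real_inner_comm _ _)

/-- The product of a square integrable function with a square integrable tail is integrable. -/
theorem integrable_and_integral_inner_tail {f g : Spacetime N → Space N} (hf : Integrable f)
    (hf2 : Integrable (fun q => ‖f q‖ ^ 2)) (hgm : AEStronglyMeasurable g volume)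
    (hg2 : Integrable (fun q => ‖g q‖ ^ 2)) {a b : ℝ} (hfs : ∀ q, q.2 ∉ Icc a b → f q = 0)
    (hgs : ∀ q, q.2 ∉ Icc a b → g q = 0) :
    Integrable ({p : Spacetime N × ℝ | p.1.2 < p.2}.indicator
      fun p => ⟪f (p.1.1, p.2), g p.1⟫_ℝ) (volume.prod volume) ∧
    Integrable (fun p : Spacetime N × ℝ => ⟪f (p.1.1, p.2), g p.1⟫_ℝ) (volume.prod volume) ∧
    Integrable (fun q => ⟪tail f q, g q⟫_ℝ) ∧
    ∫ q, ⟪tail f q, g q⟫_ℝ = ∫ p : Spacetime N × ℝ, {p : Spacetime N × ℝ | p.1.2 < p.2}.indicator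
      (fun p => ⟪f (p.1.1, p.2), g p.1⟫_ℝ) p ∂(volume.prod volume) := by
  let k : Spacetime N × ℝ → ℝ := fun p => ⟪f (p.1.1, p.2), g p.1⟫_ℝ
  have hm : AEStronglyMeasurable k (volume.prod volume) :=
    (aestronglyMeasurable_comp_swapTimes hf.aestronglyMeasurable).inner hgm.comp_fst
  let i : ℝ → ℝ := (Icc a b).indicator fun _ => 1
  have hi : Integrable i := (integrableOn_const (by simp)).integrable_indicator measurableSet_Icc
  have hi0 : ∀ t, 0 ≤ i t := fun t => indicator_nonneg (fun _ _ => zero_le_one) t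
  -- The inner product of values at times s and t is at most the sum of the squared norms. Each
  -- square depends on one time only, and the bounded time support makes it integrable in the other.
  have hb : Integrable (fun p : Spacetime N × ℝ => ‖f (p.1.1, p.2)‖ ^ 2 * i p.1.2 +
      ‖g p.1‖ ^ 2 * i p.2) (volume.prod volume) := by
    have h1 : Integrable (fun p : Spacetime N × ℝ => ‖f p.1‖ ^ 2 * i p.2)
        (volume.prod volume) := hf2.mul_prod hi
    exact (integrable_comp_swapTimes h1).add (hg2.mul_prod hi)
  have hk : Integrable k (volume.prod volume) := by
    refine hb.mono' hm (Eventually.of_forall fun p => ?_)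
    have hn1 := hi0 p.1.2
    have hn2 := hi0 p.2
    by_cases h1 : p.1.2 ∈ Icc a b
    · by_cases h2 : p.2 ∈ Icc a b
      · have e1 : i p.1.2 = 1 := indicator_of_mem h1 _
        have e2 : i p.2 = 1 := indicator_of_mem h2 _
        rw [e1, e2, mul_one, mul_one]
        refine (norm_inner_le_norm _ _).trans ?_
        nlinarith [sq_nonneg (‖f (p.1.1, p.2)‖ - ‖g p.1‖), sq_nonneg (‖f (p.1.1, p.2)‖),
          sq_nonneg ‖g p.1‖]
      · have : k p = 0 := by simp only [k]; rw [hfs _ h2, inner_zero_left]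
        rw [this, norm_zero]; positivity
    · have : k p = 0 := by simp only [k]; rw [hgs _ h1, inner_zero_right]
      rw [this, norm_zero]; positivity
  have hki := hk.indicator (measurableSet_lt_times (N := N))
  have e : ∀ᵐ q : Spacetime N, ∫ s, {p : Spacetime N × ℝ | p.1.2 < p.2}.indicator k (q, s) =
      ⟪tail f q, g q⟫_ℝ := by
    filter_upwards [ae_integrable_slice hf] with q hq
    rw [inner_tail _ hq, tail_eq_integral_indicator]
    refine integral_congr_ae (Eventually.of_forall fun s => ?_)
    by_cases h : q.2 < s <;> simp [indicator, h, k]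
  refine ⟨hki, hk, hki.integral_prod_left.congr e, ?_⟩
  rw [integral_prod _ hki]
  exact (integral_congr_ae e).symm

end Tail

/-! ### The weak gradient of the difference of two solutions -/

section Difference

variable {N : ℕ} {c : ℝ} {Ω : Set (Space N)} {G u v : Spacetime N → ℝ}
  {F Z F' Z' : ℕ → Set (Spacetime N)}

/-- A continuous field is locally bounded and all its components have limits, so no jump condition
is needed. -/
theorem IsWaveFront.locallyRemovable_of_continuousOn {Γ C O : Set (Spacetime N)}
    {V : Spacetime N → Spacetime N} {h : Spacetime N → ℝ} (hΓ : IsWaveFront c Γ) (hN : 0 < N)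
    (hCΓ : C ⊆ Γ) (hO : IsOpen O) (hV : ContinuousOn V O) (hh : LocallyIntegrableOn h O) :
    LocallyRemovable volume V h O C := by
  refine LocallyRemovable.of_hypersurface (R := univ) (Z := ∅) (finrank_spacetime hN) hO
    (hV.locallyIntegrableOn hO.measurableSet) hh (by simp) measure_empty ?_
  rintro q ⟨hqC, hqO⟩
  obtain ⟨W, ψ, hqW, hψ⟩ := hΓ q (hCΓ hqC)
  have hU : IsOpen (O ∩ (fun p => ‖V p‖) ⁻¹' Iio (‖V q‖ + 1)) :=
    hV.norm.isOpen_inter_preimage hO isOpen_Iio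
  refine ⟨W ∩ (O ∩ (fun p => ‖V p‖) ⁻¹' Iio (‖V q‖ + 1)), ψ, hψ.isOpen.inter hU,
    ⟨hqW, hqO, by simp⟩, hψ.contDiffAt hqW, hψ.eq_zero ⟨hCΓ hqC, hqW⟩,
    hψ.fderiv_ne_zero ⟨hCΓ hqC, hqW⟩, fun p hp => hψ.eq_zero ⟨hCΓ hp.1, hp.2.1⟩,
    ⟨‖V q‖ + 1, Eventually.of_forall fun p hp => le_of_lt hp.2.2⟩, fun p hp h0 _ => ?_⟩
  refine ⟨ψ, fderiv ℝ ψ p, hψ.fderiv_ne_zero ⟨hψ.mem hp.1 h0, hp.1⟩,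
    ((hψ.contDiffAt hp.1).differentiableAt one_ne_zero).hasFDerivAt,
    Eventually.of_forall fun _ => id, fderiv ℝ ψ p (V p), ?_⟩
  rw [nhdsWithin_univ]
  exact (fderiv ℝ ψ p).continuous.continuousAt.tendsto.comp
    (hV.continuousAt (hO.mem_nhds hp.2.1))

theorem LocallyIntegrableOn.inner_const_add_mul_const {O : Set (Spacetime N)} (hO : IsOpen O)
    {P : Spacetime N → Space N} {r : Spacetime N → ℝ} (hP : LocallyIntegrableOn P O)
    (hr : LocallyIntegrableOn r O) (e : Spacetime N) :
    LocallyIntegrableOn (fun q => ⟪P q, e.1⟫_ℝ + r q * e.2) O := by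
  rw [locallyIntegrableOn_iff hO.isLocallyClosed] at *
  exact fun K hK hKc => ((hP K hK hKc).inner_const _).add ((hr K hK hKc).mul_const _)

namespace IsClassicalSolution

theorem integrableOn_timeDeriv (hN : 0 < N) (hc : 0 < c) (hΩ : Bornology.IsBounded Ω)
    (hu : IsClassicalSolution c Ω G u F Z) (T : ℝ) :
    IntegrableOn (timeDeriv u) (Ω ×ˢ Ioo (0 : ℝ) T) :=
  have : IsFiniteMeasure ((volume : Measure (Spacetime N)).restrict (Ω ×ˢ Ioo (0 : ℝ) T)) :=
    isFiniteMeasure_restrict.2 (volume_prod_Ioo_lt_top hΩ T).ne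
  (hu.memLp_timeDeriv hN hc T).integrable one_le_two

theorem integrableOn_spaceGrad (hN : 0 < N) (hΩ : Bornology.IsBounded Ω)
    (hu : IsClassicalSolution c Ω G u F Z) (T : ℝ) :
    IntegrableOn (spaceGrad u) (Ω ×ˢ Ioo (0 : ℝ) T) :=
  have : IsFiniteMeasure ((volume : Measure (Spacetime N)).restrict (Ω ×ˢ Ioo (0 : ℝ) T)) :=
    isFiniteMeasure_restrict.2 (volume_prod_Ioo_lt_top hΩ T).ne
  (hu.memLp_spaceGrad hN T).integrable one_le_two

theorem locallyIntegrableOn_timeDeriv (hN : 0 < N) (hc : 0 < c) (hΩ : IsLyapunovDomain Ω)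
    (hu : IsClassicalSolution c Ω G u F Z) :
    LocallyIntegrableOn (timeDeriv u) (openCylinder Ω) :=
  locallyIntegrableOn_openCylinder hΩ.isOpen (hu.integrableOn_timeDeriv hN hc hΩ.isBounded)

theorem locallyIntegrableOn_spaceGrad (hN : 0 < N) (hΩ : IsLyapunovDomain Ω)
    (hu : IsClassicalSolution c Ω G u F Z) :
    LocallyIntegrableOn (spaceGrad u) (openCylinder Ω) :=
  locallyIntegrableOn_openCylinder hΩ.isOpen (hu.integrableOn_spaceGrad hN hΩ.isBounded)

/-- The chain rule for the difference of two classical solutions. -/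
theorem hasWeakGrad_comp_sub (hN : 0 < N) (hc : 0 < c) (hΩ : IsLyapunovDomain Ω)
    (hu : IsClassicalSolution c Ω G u F Z) (hv : IsClassicalSolution c Ω G v F' Z')
    {H : ℝ → ℝ} (hH : ContDiff ℝ 1 H) :
    HasWeakGrad (fun q => H (u q - v q))
      (fun q => deriv H (u q - v q) • (spaceGrad u q - spaceGrad v q))
      (fun q => deriv H (u q - v q) * (timeDeriv u q - timeDeriv v q)) (openCylinder Ω) := by
  intro e
  have hO := isOpen_openCylinder hΩ.isOpen
  have hw := hu.continuousOn_openCylinder.sub hv.continuousOn_openCylinder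
  have hHw : ContinuousOn (fun q => H (u q - v q)) (openCylinder Ω) :=
    hH.continuous.comp_continuousOn hw
  have hH'w : ContinuousOn (fun q => deriv H (u q - v q)) (openCylinder Ω) :=
    (hH.continuous_deriv le_rfl).comp_continuousOn hw
  have hV : ContinuousOn (fun q => H (u q - v q) • e) (openCylinder Ω) :=
    hHw.smul continuousOn_const
  have hh : LocallyIntegrableOn (fun q =>
      ⟪deriv H (u q - v q) • (spaceGrad u q - spaceGrad v q), e.1⟫_ℝ +
      deriv H (u q - v q) * (timeDeriv u q - timeDeriv v q) * e.2) (openCylinder Ω) := by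
    have h1 := (hu.locallyIntegrableOn_spaceGrad hN hΩ).sub (hv.locallyIntegrableOn_spaceGrad hN hΩ)
    have h2 := (hu.locallyIntegrableOn_timeDeriv hN hc hΩ).sub
      (hv.locallyIntegrableOn_timeDeriv hN hc hΩ)
    refine LocallyIntegrableOn.inner_const_add_mul_const hO ?_ ?_ e
    · exact h1.continuousOn_smul hO.isLocallyClosed hH'w
    · exact h2.continuousOn_mul hH'w hO.isLocallyClosed
  have hVL := hV.locallyIntegrableOn (μ := volume) hO.measurableSet
  have hVL2 : LocallyIntegrableOn (fun q => ‖H (u q - v q) • e‖ ^ 2) (openCylinder Ω) :=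
    (hV.norm.pow 2).locallyIntegrableOn hO.measurableSet
  choose C hC hFC using fun k => (hu.front k).exists_iUnion_isClosed
  choose C' hC' hFC' using fun k => (hv.front k).exists_iUnion_isClosed
  -- The indices run over the exceptional sets of u and v and the closed pieces of their fronts.
  -- Since H(u - v) is continuous, every front is removable for it, even though the derivatives
  -- jump.
  refine WeakDiv.of_locallyRemovable (ι := (ℕ ⊕ ℕ) ⊕ (ℕ × ℕ ⊕ ℕ × ℕ)) hO hVL hh
    (Sum.elim (Sum.elim Z Z') (Sum.elim (fun p => C p.1 p.2) (fun p => C' p.1 p.2))) ?_ ?_ ?_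
  · rintro ((k | k) | (k | k))
    exacts [hu.isClosed_exceptional k, hv.isClosed_exceptional k, hC _ _, hC' _ _]
  · rintro ((k | k) | (k | k))
    · exact hu.removable_exceptional hN hO hVL hVL2 hh k
    · exact hv.removable_exceptional hN hO hVL hVL2 hh k
    · exact (hu.front k.1).locallyRemovable_of_continuousOn hN
        (by rw [hFC k.1]; exact subset_iUnion _ k.2) hO hV hh
    · exact (hv.front k.1).locallyRemovable_of_continuousOn hN
        (by rw [hFC' k.1]; exact subset_iUnion _ k.2) hO hV hh
  · rintro q ⟨hqO, hq⟩
    simp only [iUnion_sumElim, iUnion_prod', mem_union, not_or] at hq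
    have hqu : q ∈ regularRegion Ω F Z := ⟨hqO, by
      rintro (h | h)
      · obtain ⟨k, hk⟩ := mem_iUnion.1 h
        rw [hFC k] at hk
        obtain ⟨j, hj⟩ := mem_iUnion.1 hk
        exact hq.2.1 (mem_iUnion₂.2 ⟨k, j, hj⟩)
      · exact hq.1.1 h⟩
    have hqv : q ∈ regularRegion Ω F' Z' := ⟨hqO, by
      rintro (h | h)
      · obtain ⟨k, hk⟩ := mem_iUnion.1 h
        rw [hFC' k] at hk
        obtain ⟨j, hj⟩ := mem_iUnion.1 hk
        exact hq.2.2 (mem_iUnion₂.2 ⟨k, j, hj⟩)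
      · exact hq.1.2 h⟩
    have hR := hu.isOpen_regular.inter hv.isOpen_regular
    refine ⟨regularRegion Ω F Z ∩ regularRegion Ω F' Z', hR, ⟨hqu, hqv⟩, ?_⟩
    have hcd : ContDiffOn ℝ 1 (fun q => H (u q - v q))
        (regularRegion Ω F Z ∩ regularRegion Ω F' Z') :=
      hH.comp_contDiffOn (((hu.contDiffOn.of_le one_le_two).mono inter_subset_left).sub
        ((hv.contDiffOn.of_le one_le_two).mono inter_subset_right))
    refine (weakDiv_contDiffOn e hR hcd).congr_ae (Eventually.of_forall fun _ _ => rfl)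
      (Eventually.of_forall fun p hp => ?_)
    have hdu := hu.differentiableAt hp.1
    have hdv := hv.differentiableAt hp.2
    have h1 : HasFDerivAt (fun q => H (u q - v q))
        (deriv H (u p - v p) • (fderiv ℝ u p - fderiv ℝ v p)) p :=
      ((hH.differentiable one_ne_zero).differentiableAt.hasDerivAt (x := u p - v p)).comp_hasFDerivAt p
        (hdu.hasFDerivAt.sub hdv.hasFDerivAt)
    rw [h1.fderiv]
    simp only [FunLike.coe_smul, Pi.smul_apply, FunLike.coe_sub, Pi.sub_apply, smul_eq_mul,
      fderiv_apply_eq hdu, fderiv_apply_eq hdv, inner_smul_left, inner_sub_left]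
    simp
    ring

end IsClassicalSolution

end Difference

/-! ### Primitives in time -/

section TimePrimitive

variable {N : ℕ} {X : Spacetime N → ℝ}

/-- The primitive `∫ t in (-∞, s), X (x, t)`. -/
noncomputable def timePrimitive (X : Spacetime N → ℝ) (q : Spacetime N) : ℝ :=
  ∫ t in Iio q.2, X (q.1, t)

theorem exists_Icc_of_hasCompactSupport (hc : HasCompactSupport X) :
    ∃ k : Set ℝ, IsCompact k ∧ ∀ q : Spacetime N, q.2 ∉ k → q ∉ tsupport X :=
  ⟨Prod.snd '' tsupport X, hc.isCompact.image continuous_snd,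
    fun _ hq hqs => hq (mem_image_of_mem _ hqs)⟩

/-- Writing the primitive as a convolution with the Heaviside function makes differentiation of
convolutions with a parameter applicable. -/
theorem integral_Iio_eq_convolution {Y : Type*} [NormedAddCommGroup Y] [NormedSpace ℝ Y]
    (g : ℝ → Y) (s : ℝ) : ∫ t in Iio s, g t =
      ∫ σ, (Ioi (0 : ℝ)).indicator (fun _ => (1 : ℝ)) σ • g (s - σ) := by
  rw [← integral_indicator measurableSet_Iio, ← integral_sub_left_eq_self _ _ s]
  refine integral_congr_ae (Eventually.of_forall fun σ => ?_)
  by_cases h : 0 < σ <;> simp [indicator, h]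

theorem locallyIntegrable_indicator_Ioi :
    LocallyIntegrable ((Ioi (0 : ℝ)).indicator fun _ => (1 : ℝ)) :=
  (locallyIntegrable_const 1).indicator measurableSet_Ioi

theorem timePrimitive_eq_convolution : timePrimitive X = fun q : Spacetime N =>
    convolution ((Ioi (0 : ℝ)).indicator fun _ => (1 : ℝ)) (fun s => X (q.1, s))
      (ContinuousLinearMap.lsmul ℝ ℝ) volume q.2 :=
  funext fun _ => integral_Iio_eq_convolution _ _

theorem contDiff_timePrimitive (hX : ContDiff ℝ 1 X) (hc : HasCompactSupport X) :
    ContDiff ℝ 1 (timePrimitive X) := by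
  obtain ⟨k, hk, hkX⟩ := exists_Icc_of_hasCompactSupport hc
  rw [timePrimitive_eq_convolution]
  have := contDiffOn_convolution_right_with_param (μ := volume) (n := 1)
    (ContinuousLinearMap.lsmul ℝ ℝ : ℝ →L[ℝ] ℝ →L[ℝ] ℝ)
    (g := fun (x : Space N) s => X (x, s)) (s := univ) isOpen_univ hk
    (fun x s _ hs => image_eq_zero_of_notMem_tsupport (hkX (x, s) hs))
    locallyIntegrable_indicator_Ioi (hX.contDiffOn)
  rwa [univ_prod_univ, contDiffOn_univ] at this

theorem fderiv_timePrimitive (hX : ContDiff ℝ 1 X) (hc : HasCompactSupport X) (q : Spacetime N) :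
    fderiv ℝ (timePrimitive X) q = ∫ t in Iio q.2, fderiv ℝ X (q.1, t) := by
  obtain ⟨k, hk, hkX⟩ := exists_Icc_of_hasCompactSupport hc
  rw [timePrimitive_eq_convolution]
  have := hasFDerivAt_convolution_right_with_param (μ := volume)
    (ContinuousLinearMap.lsmul ℝ ℝ : ℝ →L[ℝ] ℝ →L[ℝ] ℝ)
    (g := fun (x : Space N) s => X (x, s)) (s := univ) isOpen_univ hk
    (fun x s _ hs => image_eq_zero_of_notMem_tsupport (hkX (x, s) hs))
    locallyIntegrable_indicator_Ioi hX.contDiffOn q (mem_univ _)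
  rw [this.fderiv, integral_Iio_eq_convolution, convolution]
  refine integral_congr_ae (Eventually.of_forall fun σ => ?_)
  refine ContinuousLinearMap.ext fun v => ?_
  by_cases h : 0 < σ <;> simp [ContinuousLinearMap.precompR_apply, indicator, h]
  rfl

theorem fderiv_timePrimitive_apply (hX : ContDiff ℝ 1 X) (hc : HasCompactSupport X)
    (q v : Spacetime N) :
    fderiv ℝ (timePrimitive X) q v = ∫ t in Iio q.2, fderiv ℝ X (q.1, t) v := by
  rw [fderiv_timePrimitive hX hc, ContinuousLinearMap.integral_apply]
  have h1 : Continuous fun t => fderiv ℝ X (q.1, t) :=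
    (hX.continuous_fderiv one_ne_zero).comp (Continuous.prodMk_right q.1)
  obtain ⟨k, hk, hkX⟩ := exists_Icc_of_hasCompactSupport hc
  refine (h1.integrable_of_hasCompactSupport
    (HasCompactSupport.intro hk fun t ht => ?_)).integrableOn
  exact image_eq_zero_of_notMem_tsupport fun h => hkX (q.1, t) ht (tsupport_fderiv_subset ℝ h)

theorem integral_Iio_fderiv (hX : ContDiff ℝ 1 X) (hc : HasCompactSupport X) (q : Spacetime N) :
    ∫ t in Iio q.2, fderiv ℝ X (q.1, t) (0, 1) = X q := by
  obtain ⟨k, hk, hkX⟩ := exists_Icc_of_hasCompactSupport hc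
  have h1 : ContDiff ℝ 1 (fun t => X (q.1, t)) := hX.comp (by fun_prop)
  have h2 : HasCompactSupport (fun t => X (q.1, t)) := HasCompactSupport.intro hk fun t ht =>
    image_eq_zero_of_notMem_tsupport (hkX (q.1, t) ht)
  have := HasCompactSupport.integral_Iic_deriv_eq h1 h2 q.2
  rw [← integral_Iic_eq_integral_Iio]
  rw [← this]
  refine integral_congr_ae (Eventually.of_forall fun t => ?_)
  exact ((hasDerivAt_comp_time (q := (q.1, t)) (hX.differentiable one_ne_zero _)).deriv).symm

end TimePrimitive

/-! ### Weak gradients of tail integrals, by duality with time primitives -/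

section TailGrad

variable {N : ℕ} {Ω : Set (Space N)}

theorem exists_tsupport_bounds {X : Spacetime N → ℝ} (hc : HasCompactSupport X)
    (hX : tsupport X ⊆ openCylinder Ω) : ∃ t₀, 0 < t₀ ∧ ∀ q ∈ tsupport X, t₀ ≤ q.2 := by
  rcases (tsupport X).eq_empty_or_nonempty with h | h
  · exact ⟨1, one_pos, by simp [h]⟩
  · obtain ⟨p, hp, hmin⟩ := hc.isCompact.exists_isMinOn h continuous_snd.continuousOn
    exact ⟨p.2, (hX hp).2, fun q hq => hmin hq⟩

/-- Up to a cutoff in time, the time primitive of a test function is a test function. -/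
theorem isTestFun_mul_timePrimitive {X : Spacetime N → ℝ} (hX : IsTestFun X (openCylinder Ω))
    {θ : ℝ → ℝ} (hθ : ContDiff ℝ 1 θ) {T : ℝ} (hT : ∀ s, T < s → θ s = 0) :
    IsTestFun (fun q => θ q.2 * timePrimitive X q) (openCylinder Ω) := by
  obtain ⟨t₀, ht₀, ht⟩ := exists_tsupport_bounds hX.hasCompactSupport hX.tsupport_subset
  let K : Set (Spacetime N) := (Prod.fst '' tsupport X) ×ˢ Icc t₀ T
  have hK : IsCompact K := (hX.hasCompactSupport.isCompact.image continuous_fst).prod isCompact_Icc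
  have h0 : ∀ q ∉ K, θ q.2 * timePrimitive X q = 0 := by
    intro q hq
    by_cases h1 : T < q.2
    · rw [hT _ h1, zero_mul]
    · have : timePrimitive X q = 0 := by
        refine setIntegral_eq_zero_of_forall_eq_zero fun t htq => ?_
        refine image_eq_zero_of_notMem_tsupport fun h => hq ⟨⟨(q.1, t), h, rfl⟩, ?_, ?_⟩
        · exact (ht _ h).trans (le_of_lt htq)
        · exact not_lt.1 h1
      rw [this, mul_zero]
  have hsub : tsupport (fun q => θ q.2 * timePrimitive X q) ⊆ K :=
    closure_minimal (fun q hq => by_contra fun h => hq (h0 q h)) hK.isClosed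
  refine ⟨(hθ.comp contDiff_snd).mul (contDiff_timePrimitive hX.contDiff hX.hasCompactSupport),
    HasCompactSupport.intro hK h0, hsub.trans ?_⟩
  rintro ⟨x, t⟩ ⟨⟨p, hp, rfl⟩, ht1, -⟩
  exact ⟨(hX.tsupport_subset hp).1, ht₀.trans_le ht1⟩

theorem exists_time_cutoff (T : ℝ) : ∃ θ : ℕ → ℝ → ℝ, (∀ n, ContDiff ℝ 1 (θ n)) ∧
    (∀ n s, θ n s ∈ Icc (0 : ℝ) 1) ∧ (∀ n s, T ≤ s → θ n s = 0) ∧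
    ∀ s, s < T → Tendsto (fun n => θ n s) atTop (𝓝 1) := by
  refine ⟨fun n s => Real.smoothTransition (n * (T - s)),
    fun n => Real.smoothTransition.contDiff.comp (by fun_prop),
    fun n s => ⟨Real.smoothTransition.nonneg _, Real.smoothTransition.le_one _⟩,
    fun n s hs => Real.smoothTransition.zero_of_nonpos
      (mul_nonpos_of_nonneg_of_nonpos n.cast_nonneg (by linarith)), fun s hs => ?_⟩
  refine tendsto_const_nhds.congr' ?_
  have : Tendsto (fun n : ℕ => (n : ℝ) * (T - s)) atTop atTop :=
    tendsto_natCast_atTop_atTop.atTop_mul_const (by linarith)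
  filter_upwards [this.eventually_ge_atTop 1] with n hn
  exact (Real.smoothTransition.one_of_one_le hn).symm

/-- Testing a spatial weak derivative with a time primitive, up to a final time. -/
theorem HasWeakGrad.setIntegral_timePrimitive {f : Spacetime N → ℝ} {P : Spacetime N → Space N}
    {r : Spacetime N → ℝ} (H : HasWeakGrad f P r (openCylinder Ω)) (hΩo : IsOpen Ω)
    (hΩ : Bornology.IsBounded Ω) {T : ℝ} (hf : IntegrableOn f (Ω ×ˢ Ioo (0 : ℝ) T))
    (hP : IntegrableOn P (Ω ×ˢ Ioo (0 : ℝ) T)) {X : Spacetime N → ℝ}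
    (hX : IsTestFun X (openCylinder Ω)) (a : Space N) :
    ∫ q in Ω ×ˢ Ioo (0 : ℝ) T, (fderiv ℝ (timePrimitive X) q (a, 0) * f q +
      timePrimitive X q * ⟪P q, a⟫_ℝ) = 0 := by
  have hQ : MeasurableSet (Ω ×ˢ Ioo (0 : ℝ) T) := hΩo.measurableSet.prod measurableSet_Ioo
  -- The time primitive of a test function need not vanish for late times, so it is cut off by θ n,
  -- which is zero from T on. The test direction is purely spatial and never differentiates θ n, so
  -- one may let θ n tend to 1 on (0, T).
  obtain ⟨θ, hθ, hθ01, hθT, hθ1⟩ := exists_time_cutoff T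
  have hpr := contDiff_timePrimitive hX.contDiff hX.hasCompactSupport
  have hprc : Continuous (timePrimitive X) := hpr.continuous
  have hprd : Continuous fun q => fderiv ℝ (timePrimitive X) q (a, 0) :=
    (hpr.continuous_fderiv one_ne_zero).clm_apply continuous_const
  have hcpt : IsCompact (closure Ω ×ˢ Icc (0 : ℝ) T) := hΩ.isCompact_closure.prod isCompact_Icc
  obtain ⟨C₁, hC₁⟩ := hcpt.exists_bound_of_continuousOn hprc.continuousOn
  obtain ⟨C₂, hC₂⟩ := hcpt.exists_bound_of_continuousOn hprd.continuousOn
  have hsub : Ω ×ˢ Ioo (0 : ℝ) T ⊆ closure Ω ×ˢ Icc (0 : ℝ) T :=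
    prod_mono subset_closure Ioo_subset_Icc_self
  let g : Spacetime N → ℝ := fun q => fderiv ℝ (timePrimitive X) q (a, 0) * f q +
      timePrimitive X q * ⟪P q, a⟫_ℝ
  have hg : IntegrableOn g (Ω ×ˢ Ioo (0 : ℝ) T) := by
    refine Integrable.add ?_ ?_
    · refine Integrable.bdd_mul (c := C₂) hf hprd.aestronglyMeasurable ?_
      filter_upwards [ae_restrict_mem hQ] with q hq using hC₂ q (hsub hq)
    · refine Integrable.bdd_mul (c := C₁) (hP.inner_const a) hprc.aestronglyMeasurable ?_
      filter_upwards [ae_restrict_mem hQ] with q hq using hC₁ q (hsub hq)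
  have hz : ∀ n, ∫ q in Ω ×ˢ Ioo (0 : ℝ) T, θ n q.2 * g q = 0 := by
    intro n
    have ht := isTestFun_mul_timePrimitive hX (hθ n) (fun s hs => hθT n s hs.le)
    refine Eq.trans ?_ (H (a, 0) _ ht)
    rw [← integral_indicator hQ]
    refine integral_congr_ae (Eventually.of_forall fun q => ?_)
    have hd : fderiv ℝ (fun q : Spacetime N => θ n q.2 * timePrimitive X q) q (a, 0) =
        θ n q.2 * fderiv ℝ (timePrimitive X) q (a, 0) := by
      have h1 : HasFDerivAt (fun q : Spacetime N => θ n q.2) _ q :=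
        ((hθ n).differentiable one_ne_zero q.2).hasDerivAt.comp_hasFDerivAt q
          (hasFDerivAt_snd (𝕜 := ℝ) (E := Space N) (F := ℝ) (p := q))
      rw [(h1.fun_mul (hpr.differentiable one_ne_zero q).hasFDerivAt).fderiv]
      simp
    by_cases hq : q ∈ Ω ×ˢ Ioo (0 : ℝ) T
    · simp only [indicator_of_mem hq, map_smul, smul_eq_mul, hd, g]
      ring
    · simp only [indicator_of_notMem hq, map_smul, smul_eq_mul, hd]
      by_cases hq2 : q ∈ openCylinder Ω
      · have : T ≤ q.2 := by
          by_contra h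
          exact hq ⟨hq2.1, hq2.2, not_le.1 h⟩
        simp [hθT n _ this]
      · have h1 : q ∉ tsupport (fun q : Spacetime N => θ n q.2 * timePrimitive X q) :=
          fun h => hq2 (ht.tsupport_subset h)
        have h2 := notMem_tsupport_iff_eventuallyEq.1 h1
        have h3 : θ n q.2 * timePrimitive X q = 0 := h2.self_of_nhds
        rw [h3, ← hd, h2.fderiv_eq]
        simp
  have hlim : Tendsto (fun n => ∫ q in Ω ×ˢ Ioo (0 : ℝ) T, θ n q.2 * g q) atTop
      (𝓝 (∫ q in Ω ×ˢ Ioo (0 : ℝ) T, g q)) := by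
    refine tendsto_integral_of_dominated_convergence (fun q => ‖g q‖) (fun n => ?_) hg.norm
      (fun n => Eventually.of_forall fun q => ?_) ?_
    · exact ((hθ n).continuous.comp continuous_snd).aestronglyMeasurable.mul
        hg.aestronglyMeasurable
    · rw [norm_mul]
      refine mul_le_of_le_one_left (norm_nonneg _) ?_
      rw [Real.norm_of_nonneg (hθ01 n _).1]
      exact (hθ01 n _).2
    · filter_upwards [ae_restrict_mem hQ] with q hq
      simpa using (hθ1 q.2 hq.2.2).mul_const (g q)
  simp_rw [hz] at hlim
  exact tendsto_nhds_unique hlim tendsto_const_nhds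

/-- By Fubini a tail paired with Y becomes the function paired with the time primitive of Y. For Y =
∂_t X the primitive is X itself, so the terms with b cancel: that is the statement ∂_t (tail k) =
-k. What remains involves only spatial derivatives. -/
theorem IsTestFun.integral_tail {X : Spacetime N → ℝ} (hX : IsTestFun X (openCylinder Ω))
    {k : Spacetime N → ℝ} {K : Spacetime N → Space N} (hk : Integrable k) (hK : Integrable K)
    (a : Space N) (b : ℝ) :
    ∫ q, (fderiv ℝ X q (tail k q • (a, b)) + X q * (⟪tail K q, a⟫_ℝ + -k q * b)) =
      ∫ q, (fderiv ℝ (timePrimitive X) q (a, 0) * k q + timePrimitive X q * ⟪K q, a⟫_ℝ) := by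
  have hXc := hX.contDiff.continuous
  have hYc : ∀ e, Continuous fun q => fderiv ℝ X q e := fun e =>
    (hX.contDiff.continuous_fderiv one_ne_zero).clm_apply continuous_const
  have hYs : ∀ e, HasCompactSupport fun q => fderiv ℝ X q e := fun e =>
    hX.hasCompactSupport.fderiv_apply (𝕜 := ℝ) e
  obtain ⟨C, hC⟩ := hX.hasCompactSupport.exists_bound_of_continuous hXc
  obtain ⟨C₁, hC₁⟩ := (hYs (a, 0)).exists_bound_of_continuous (hYc _)
  obtain ⟨C₂, hC₂⟩ := (hYs (0, 1)).exists_bound_of_continuous (hYc _)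
  obtain ⟨A, hA, hAX⟩ := exists_Icc_of_hasCompactSupport hX.hasCompactSupport
  obtain ⟨m, M, hAI⟩ : ∃ m M, A ⊆ Icc m M :=
    ⟨sInf A, sSup A, fun t ht => ⟨csInf_le hA.bddBelow ht, le_csSup hA.bddAbove ht⟩⟩
  have hX0 : ∀ q : Spacetime N, q.2 ∉ Icc m M → q ∉ tsupport X := fun q hq =>
    hAX q fun h => hq (hAI h)
  have hY0 : ∀ e, ∀ q : Spacetime N, q.2 ∉ Icc m M → fderiv ℝ X q e = 0 := fun e q hq =>
    image_eq_zero_of_notMem_tsupport (f := fun q => fderiv ℝ X q e) fun h =>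
      hX0 q hq (tsupport_fderiv_apply_subset ℝ _ h)
  obtain ⟨i1, j1, e1⟩ := integrable_and_integral_mul_tail hk (hYc _).aestronglyMeasurable hC₁
    (hY0 (a, 0))
  obtain ⟨i2, j2, e2⟩ := integrable_and_integral_mul_tail hk (hYc _).aestronglyMeasurable hC₂
    (hY0 (0, 1))
  obtain ⟨i3, j3, e3⟩ := integrable_and_integral_mul_tail (hK.inner_const a)
    hXc.aestronglyMeasurable hC (fun q hq => image_eq_zero_of_notMem_tsupport (hX0 q hq))
  have hae : ∀ᵐ q : Spacetime N, fderiv ℝ X q (tail k q • (a, b)) +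
      X q * (⟪tail K q, a⟫_ℝ + -k q * b) =
      fderiv ℝ X q (a, 0) * tail k q + X q * tail (fun p => ⟪K p, a⟫_ℝ) q +
        b * (fderiv ℝ X q (0, 1) * tail k q - k q * X q) := by
    filter_upwards [ae_integrable_slice hK] with q hq
    have : ((a, b) : Spacetime N) = (a, 0) + b • (0, 1) := by ext <;> simp
    rw [inner_tail _ hq, map_smul, this, map_add, map_smul, smul_eq_mul, smul_eq_mul]
    ring
  have eX : ∀ q : Spacetime N, k q * ∫ t in Iio q.2, fderiv ℝ X (q.1, t) (0, 1) = k q * X q :=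
    fun q => by rw [integral_Iio_fderiv hX.contDiff hX.hasCompactSupport]
  simp_rw [eX] at j2 e2
  have i13 : Integrable fun q => fderiv ℝ X q (a, 0) * tail k q +
      X q * tail (fun p => ⟪K p, a⟫_ℝ) q := i1.add i3
  have i22 : Integrable fun q => b * (fderiv ℝ X q (0, 1) * tail k q - k q * X q) :=
    (i2.sub j2).const_mul b
  rw [integral_congr_ae hae, integral_add i13 i22,
    integral_add i1 i3, integral_const_mul, integral_sub i2 j2, e1, e2, e3, sub_self, mul_zero,
    add_zero, ← integral_add j1 j3]
  refine integral_congr_ae (Eventually.of_forall fun q => ?_)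
  simp only [fderiv_timePrimitive_apply hX.contDiff hX.hasCompactSupport, timePrimitive]
  ring

/-- The weak gradient of a tail integral. -/
theorem HasWeakGrad.tail_indicator {f : Spacetime N → ℝ} {P : Spacetime N → Space N}
    {r : Spacetime N → ℝ} (H : HasWeakGrad f P r (openCylinder Ω)) (hΩo : IsOpen Ω)
    (hΩ : Bornology.IsBounded Ω) {T : ℝ} (hf : IntegrableOn f (Ω ×ˢ Ioo (0 : ℝ) T))
    (hP : IntegrableOn P (Ω ×ˢ Ioo (0 : ℝ) T)) :
    HasWeakGrad (tail ((Ω ×ˢ Ioo (0 : ℝ) T).indicator f))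
      (tail ((Ω ×ˢ Ioo (0 : ℝ) T).indicator P))
      (fun q => -(Ω ×ˢ Ioo (0 : ℝ) T).indicator f q) (openCylinder Ω) := by
  have hQ : MeasurableSet (Ω ×ˢ Ioo (0 : ℝ) T) := hΩo.measurableSet.prod measurableSet_Ioo
  rintro ⟨a, b⟩ X hX
  refine (hX.integral_tail (hf.integrable_indicator hQ) (hP.integrable_indicator hQ) a b).trans ?_
  refine Eq.trans ?_ (H.setIntegral_timePrimitive hΩo hΩ hf hP hX a)
  rw [← integral_indicator hQ]
  refine integral_congr_ae (Eventually.of_forall fun q => ?_)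
  by_cases hq : q ∈ Ω ×ˢ Ioo (0 : ℝ) T <;> simp [hq]

end TailGrad

/-! ### Regularity of tail integrals -/

section TailRegularity

variable {N : ℕ} {Ω : Set (Space N)} {X : Type*} [NormedAddCommGroup X] [NormedSpace ℝ X]

/-- The tail is the marginal of f(x,s) restricted to t < s. It may persist as t tends to -∞, so only
bounded time intervals are integrated. -/
theorem locallyIntegrable_tail {f : Spacetime N → X} (hf : Integrable f) :
    LocallyIntegrable (tail f) := by
  have key : ∀ a b : ℝ, IntegrableOn (tail f) (univ ×ˢ Icc a b) := by
    intro a b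
    let i : ℝ → ℝ := (Icc a b).indicator fun _ => 1
    have hi : Integrable i := (integrableOn_const (by simp)).integrable_indicator measurableSet_Icc
    have h1 : Integrable (fun p : Spacetime N × ℝ => i p.2 • f p.1) (volume.prod volume) :=
      (hi.smul_prod hf).swap
    have h2 := ((integrable_comp_swapTimes h1).indicator measurableSet_lt_times).integral_prod_left
    rw [← integrable_indicator_iff (MeasurableSet.univ.prod measurableSet_Icc)]
    refine h2.congr (Eventually.of_forall fun q => ?_)
    simp only
    by_cases hq : q.2 ∈ Icc a b
    · rw [indicator_of_mem (mem_prod.2 ⟨mem_univ _, hq⟩), tail_eq_integral_indicator]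
      refine integral_congr_ae (Eventually.of_forall fun s => ?_)
      by_cases h : q.2 < s <;> simp [indicator, h, swapTimes, i, hq.1, hq.2]
    · rw [indicator_of_notMem (fun h => hq h.2)]
      refine integral_eq_zero_of_ae (Eventually.of_forall fun s => ?_)
      by_cases h : q.2 < s <;> simp [indicator, h, swapTimes, i]
      intro h1 h2
      exact absurd ⟨h1, h2⟩ hq
  intro q
  refine ⟨univ ×ˢ Icc (q.2 - 1) (q.2 + 1), ?_, key _ _⟩
  exact prod_mem_nhds univ_mem (Icc_mem_nhds (by linarith) (by linarith))

theorem norm_tail_indicator_le {f : Spacetime N → X} {M T : ℝ} (hT : 0 ≤ T)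
    (hM : ∀ q ∈ Ω ×ˢ Ioo (0 : ℝ) T, ‖f q‖ ≤ M) (q : Spacetime N) (hM0 : 0 ≤ M) :
    ‖tail ((Ω ×ˢ Ioo (0 : ℝ) T).indicator f) q‖ ≤ M * T := by
  rw [tail_eq_integral_indicator]
  have h1 : ∫ s, (Ioo (0 : ℝ) T).indicator (fun _ => M) s = M * T := by
    rw [integral_indicator measurableSet_Ioo]
    simp [hT, mul_comm]
  rw [← h1]
  refine norm_integral_le_of_norm_le
    ((integrableOn_const (by simp)).integrable_indicator measurableSet_Ioo)
    (Eventually.of_forall fun s => ?_)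
  by_cases hs : s ∈ Ioo 0 T
  · rw [indicator_of_mem hs]
    refine (norm_indicator_le_norm_self _ _).trans ?_
    by_cases hx : (q.1, s) ∈ Ω ×ˢ Ioo (0 : ℝ) T
    · rw [indicator_of_mem hx]; exact hM _ hx
    · rw [indicator_of_notMem hx, norm_zero]; exact hM0
  · rw [indicator_of_notMem hs]
    refine (norm_indicator_le_norm_self _ _).trans ?_
    rw [indicator_of_notMem (fun h => hs h.2), norm_zero]

theorem tail_indicator_of_le {f : Spacetime N → X} {T : ℝ} {q : Spacetime N} (hq : T ≤ q.2) :
    tail ((Ω ×ˢ Ioo (0 : ℝ) T).indicator f) q = 0 :=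
  setIntegral_eq_zero_of_forall_eq_zero fun _ hs =>
    indicator_of_notMem (fun h => absurd (hq.trans_lt hs) (not_lt.2 h.2.2.le)) _

/-- Dominated convergence: moving q changes the lower limit of integration, but for fixed s the
integrand is discontinuous at q₀ only if s = q₀.2. -/
theorem continuousOn_tail_indicator (hΩ : IsOpen Ω) {f : Spacetime N → ℝ} {M T : ℝ}
    (hf : ContinuousOn f (openCylinder Ω)) (hM : ∀ q ∈ Ω ×ˢ Ioo (0 : ℝ) T, ‖f q‖ ≤ M)
    (hM0 : 0 ≤ M) :
    ContinuousOn (tail ((Ω ×ˢ Ioo (0 : ℝ) T).indicator f)) (openCylinder Ω) := by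
  have hO := isOpen_openCylinder hΩ
  rw [hO.continuousOn_iff]
  intro q₀ hq₀
  have hslice : ∀ x ∈ Ω, ∀ s, (Ω ×ˢ Ioo (0 : ℝ) T).indicator f (x, s) =
      (Ioo (0 : ℝ) T).indicator (fun s => f (x, s)) s := by
    intro x hx s
    by_cases hs : s ∈ Ioo 0 T
    · rw [indicator_of_mem hs, indicator_of_mem (mem_prod.2 ⟨hx, hs⟩)]
    · rw [indicator_of_notMem hs, indicator_of_notMem (fun h => hs h.2)]
  have e : tail ((Ω ×ˢ Ioo (0 : ℝ) T).indicator f) = fun q =>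
      ∫ s, (Ioi q.2).indicator (fun s => (Ω ×ˢ Ioo (0 : ℝ) T).indicator f (q.1, s)) s :=
    funext fun q => tail_eq_integral_indicator _ _
  rw [e]
  refine continuousAt_of_dominated (bound := (Ioo (0 : ℝ) T).indicator fun _ => M) ?_ ?_
    ((integrableOn_const (by simp)).integrable_indicator measurableSet_Ioo) ?_
  · filter_upwards [hO.mem_nhds hq₀] with q hq
    refine AEStronglyMeasurable.indicator ?_ measurableSet_Ioi
    have : (fun s => (Ω ×ˢ Ioo (0 : ℝ) T).indicator f (q.1, s)) =
        (Ioo (0 : ℝ) T).indicator (fun s => f (q.1, s)) := funext (hslice _ hq.1)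
    rw [this, aestronglyMeasurable_indicator_iff measurableSet_Ioo]
    refine ContinuousOn.aestronglyMeasurable ?_ measurableSet_Ioo
    exact hf.comp (by fun_prop) fun s hs => ⟨hq.1, hs.1⟩
  · refine Eventually.of_forall fun q => Eventually.of_forall fun s => ?_
    refine (norm_indicator_le_norm_self _ _).trans ?_
    by_cases hx : (q.1, s) ∈ Ω ×ˢ Ioo (0 : ℝ) T
    · rw [indicator_of_mem hx, indicator_of_mem hx.2]; exact hM _ hx
    · rw [indicator_of_notMem hx, norm_zero]; exact indicator_nonneg (fun _ _ => hM0) _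
  · filter_upwards [(measure_eq_zero_iff_ae_notMem.1 (Real.volume_singleton (a := q₀.2)))] with s hs
    have hs' : s ≠ q₀.2 := hs
    have hk : ContinuousAt (fun q : Spacetime N => (Ω ×ˢ Ioo (0 : ℝ) T).indicator f (q.1, s)) q₀ := by
      have h1 : (fun q : Spacetime N => (Ω ×ˢ Ioo (0 : ℝ) T).indicator f (q.1, s)) =ᶠ[𝓝 q₀]
          fun q => (Ioo (0 : ℝ) T).indicator (fun s => f (q.1, s)) s := by
        filter_upwards [hO.mem_nhds hq₀] with q hq using hslice _ hq.1 _
      refine ContinuousAt.congr ?_ h1.symm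
      by_cases hsT : s ∈ Ioo 0 T
      · simp only [indicator_of_mem hsT]
        exact ContinuousAt.comp (f := fun q : Spacetime N => (q.1, s)) (g := f)
          (hf.continuousAt (hO.mem_nhds ⟨hq₀.1, hsT.1⟩)) (by fun_prop)
      · simp only [indicator_of_notMem hsT]
        exact continuousAt_const
    rcases lt_or_gt_of_ne hs' with h | h
    · have : (fun q : Spacetime N => (Ioi q.2).indicator
          (fun s => (Ω ×ˢ Ioo (0 : ℝ) T).indicator f (q.1, s)) s) =ᶠ[𝓝 q₀] fun _ => 0 := by
        filter_upwards [continuous_snd.continuousAt.eventually (lt_mem_nhds h)] with q hq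
        exact indicator_of_notMem (fun h' => lt_asymm hq h') _
      exact (continuousAt_const (y := (0 : ℝ))).congr this.symm
    · refine hk.congr ?_
      filter_upwards [continuous_snd.continuousAt.eventually (gt_mem_nhds h)] with q hq
      exact (indicator_of_mem (show s ∈ Ioi q.2 from hq)
        (fun s => (Ω ×ˢ Ioo (0 : ℝ) T).indicator f (q.1, s))).symm

end TailRegularity

/-! ### The flux across wave fronts -/

section Flux

variable {N : ℕ} {c : ℝ} {Ω : Set (Space N)} {G u : Spacetime N → ℝ}
  {F Z : ℕ → Set (Spacetime N)}

/-- The Hadamard conditions make the flux through a front continuous across it. -/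
theorem HadamardConditionsAt.exists_tendsto {R Γ : Set (Spacetime N)} {q : Spacetime N}
    (hc : 0 < c) (hq : q ∈ Γ) (hR : ∀ p ∈ R, p ∉ Γ) (h : HadamardConditionsAt c u R Γ q) :
    ∃ (W : Set (Spacetime N)) (ψ : Spacetime N → ℝ), q ∈ W ∧ IsFrontChart c Γ W ψ ∧
      (∃ M : ℝ, ∀ᶠ p in 𝓝[R] q, ‖waveFlux c u p‖ ≤ M) ∧
      ∃ l, Tendsto (fun p => fderiv ℝ ψ q (waveFlux c u p)) (𝓝[R] q) (𝓝 l) := by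
  obtain ⟨W, ψ, hqW, hψ, -, a₁, a₂, g₁, g₂, ht₁, hg₁, ht₂, hg₂, hjump⟩ := h
  -- Points of R near q are not on the front, so each is either ahead of it or behind it, and limits
  -- along R reduce to the two one-sided limits.
  have hle : 𝓝[R] q ≤ 𝓝[R ∩ {y ∈ W | 0 < ψ y}] q ⊔ 𝓝[R ∩ {y ∈ W | ψ y < 0}] q := by
    rw [← nhdsWithin_union, ← nhdsWithin_inter_of_mem'
      (mem_nhdsWithin_of_mem_nhds (hψ.isOpen.mem_nhds hqW) : W ∈ 𝓝[R] q)]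
    refine nhdsWithin_mono q fun p hp => ?_
    rcases lt_trichotomy (ψ p) 0 with h | h | h
    · exact Or.inr ⟨hp.1, hp.2, h⟩
    · exact absurd (hψ.mem hp.2 h) (hR p hp.1)
    · exact Or.inl ⟨hp.1, hp.2, h⟩
  have flux : ∀ {a : ℝ} {g : Space N} {l : Filter (Spacetime N)},
      Tendsto (timeDeriv u) l (𝓝 a) → Tendsto (spaceGrad u) l (𝓝 g) →
      Tendsto (waveFlux c u) l (𝓝 (g, -(a / c ^ 2))) := fun ht hg =>
    hg.prodMk_nhds (ht.div_const _).neg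
  have h1 := flux ht₁ hg₁
  have h2 := flux ht₂ hg₂
  refine ⟨W, ψ, hqW, hψ, ⟨max (‖(g₁, -(a₁ / c ^ 2))‖ + 1) (‖(g₂, -(a₂ / c ^ 2))‖ + 1), ?_⟩, ?_⟩
  · refine Eventually.filter_mono hle (eventually_sup.2 ⟨?_, ?_⟩)
    · filter_upwards [h1.norm.eventually (gt_mem_nhds (lt_add_one _))] with p hp
      exact hp.le.trans (le_max_left _ _)
    · filter_upwards [h2.norm.eventually (gt_mem_nhds (lt_add_one _))] with p hp
      exact hp.le.trans (le_max_right _ _)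
  · have hd : DifferentiableAt ℝ ψ q := (hψ.contDiffAt hqW).differentiableAt one_ne_zero
    have hne : ‖spaceGrad ψ q‖ ≠ 0 := norm_ne_zero_iff.2 (hψ.grad_ne_zero q ⟨hq, hqW⟩)
    -- Inserting ψ_t = -c‖∇ψ‖ turns the normal component of the wave flux into a positive multiple
    -- of u_t + c m·∇u. Its continuity across the front is thus the Hadamard condition.
    have val : ∀ (a : ℝ) (g : Space N), fderiv ℝ ψ q (g, -(a / c ^ 2)) =
        ‖spaceGrad ψ q‖ / c * (a + c * ⟪‖spaceGrad ψ q‖⁻¹ • spaceGrad ψ q, g⟫_ℝ) := by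
      intro a g
      rw [fderiv_apply_eq hd, hψ.characteristic q ⟨hq, hqW⟩, inner_smul_left]
      simp only [conj_trivial]
      field_simp
      ring
    have e : fderiv ℝ ψ q (g₁, -(a₁ / c ^ 2)) = fderiv ℝ ψ q (g₂, -(a₂ / c ^ 2)) := by
      rw [val, val, hjump]
    refine ⟨fderiv ℝ ψ q (g₁, -(a₁ / c ^ 2)), Tendsto.mono_left ?_ hle⟩
    refine Tendsto.sup ?_ ?_
    · exact ((fderiv ℝ ψ q).continuous.tendsto _).comp h1
    · rw [e]
      exact ((fderiv ℝ ψ q).continuous.tendsto _).comp h2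

theorem IsClassicalSolution.memLp_waveFlux (hN : 0 < N) (hc : 0 < c)
    (hu : IsClassicalSolution c Ω G u F Z) (T : ℝ) :
    MemLp (waveFlux c u) 2 (volume.restrict (Ω ×ˢ Ioo (0 : ℝ) T)) := by
  refine MemLp.of_fst_snd ⟨hu.memLp_spaceGrad hN T, ?_⟩
  have := ((hu.memLp_timeDeriv hN hc T).const_mul (c ^ 2)⁻¹).neg
  simpa only [waveFlux, div_eq_inv_mul, Pi.neg_def] using this

theorem IsClassicalSolution.integrableOn_waveFlux (hN : 0 < N) (hc : 0 < c)
    (hΩ : Bornology.IsBounded Ω) (hu : IsClassicalSolution c Ω G u F Z) (T : ℝ) :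
    IntegrableOn (waveFlux c u) (Ω ×ˢ Ioo (0 : ℝ) T) :=
  have : IsFiniteMeasure ((volume : Measure (Spacetime N)).restrict (Ω ×ˢ Ioo (0 : ℝ) T)) :=
    isFiniteMeasure_restrict.2 (volume_prod_Ioo_lt_top hΩ T).ne
  (hu.memLp_waveFlux hN hc T).integrable one_le_two

/-- The product rule for a function with a weak gradient and the flux of a classical solution,
across the wave fronts and the exceptional sets. -/
theorem IsClassicalSolution.weakDiv_smul_waveFlux (hN : 0 < N) (hc : 0 < c)
    (hΩ : IsLyapunovDomain Ω) (hG : LocallyIntegrableOn G (openCylinder Ω))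
    (hu : IsClassicalSolution c Ω G u F Z) {φ r : Spacetime N → ℝ} {P : Spacetime N → Space N}
    (H : HasWeakGrad φ P r (openCylinder Ω)) (hφ : ContinuousOn φ (openCylinder Ω))
    (hP : LocallyIntegrableOn P (openCylinder Ω)) (hr : LocallyIntegrableOn r (openCylinder Ω))
    (hPu : LocallyIntegrableOn (fun q => ⟪P q, spaceGrad u q⟫_ℝ) (openCylinder Ω))
    (hru : LocallyIntegrableOn (fun q => r q * timeDeriv u q) (openCylinder Ω)) :
    WeakDiv volume (fun q => φ q • waveFlux c u q)
      (fun q => (⟪P q, spaceGrad u q⟫_ℝ - r q * timeDeriv u q / c ^ 2) + φ q * G q)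
      (openCylinder Ω) := by
  have hO := isOpen_openCylinder hΩ.isOpen
  have hflux := locallyIntegrableOn_openCylinder hΩ.isOpen
    (hu.integrableOn_waveFlux hN hc hΩ.isBounded)
  have hflux2 := locallyIntegrableOn_openCylinder hΩ.isOpen
    fun T => (hu.memLp_waveFlux hN hc T).norm.integrable_sq
  have hV : LocallyIntegrableOn (fun q => φ q • waveFlux c u q) (openCylinder Ω) :=
    hflux.continuousOn_smul hO.isLocallyClosed hφ
  have hV2 : LocallyIntegrableOn (fun q => ‖φ q • waveFlux c u q‖ ^ 2) (openCylinder Ω) := by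
    have := hflux2.continuousOn_mul (hφ.norm.pow 2) hO.isLocallyClosed
    simpa only [norm_smul, mul_pow, Pi.pow_apply] using this
  have hh : LocallyIntegrableOn (fun q =>
      (⟪P q, spaceGrad u q⟫_ℝ - r q * timeDeriv u q / c ^ 2) + φ q * G q) (openCylinder Ω) := by
    have := hG.continuousOn_mul hφ hO.isLocallyClosed
    have h2 : LocallyIntegrableOn (fun q => r q * timeDeriv u q / c ^ 2) (openCylinder Ω) := by
      simpa only [div_eq_inv_mul, Pi.smul_def, smul_eq_mul] using hru.smul (c ^ 2)⁻¹
    exact (hPu.sub h2).add this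
  have hRF : ∀ k, ∀ p ∈ regularRegion Ω F Z, p ∉ F k := fun k p hp h =>
    hp.2 (Or.inl (mem_iUnion.2 ⟨k, h⟩))
  choose C hC hFC using fun k => (hu.front k).exists_iUnion_isClosed
  have hCF : ∀ k j, C k j ⊆ F k := fun k j => by rw [hFC k]; exact subset_iUnion _ j
  -- Off the exceptional sets the flux is bounded near each point of a front, but not uniformly
  -- along the front. Fixing bound m and radius 1/(m+1) gives closed pieces C k j ∩ B m, which
  -- together cover the front up to the exceptional sets.
  let B : ℕ → Set (Spacetime N) := fun m => {q | ∀ᵐ p, p ∈ Metric.ball q (1 / ((m : ℝ) + 1)) →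
    p ∈ openCylinder Ω → ‖waveFlux c u p‖ ≤ m}
  refine WeakDiv.of_locallyRemovable (ι := ℕ ⊕ (ℕ × ℕ × ℕ)) hO hV hh
    (Sum.elim Z fun i => C i.1 i.2.1 ∩ B i.2.2) ?_ ?_ ?_
  · rintro (k | i)
    exacts [hu.isClosed_exceptional k, (hC _ _).inter (isClosed_setOf_ae_ball _ _ _)]
  · rintro (k | ⟨k, j, m⟩)
    · exact hu.removable_exceptional hN hO hV hV2 hh k
    refine LocallyRemovable.of_hypersurface (finrank_spacetime hN) hO hV hh
      (hu.ae_mem_regular hN) (hu.hausdorffMeasure_exceptional hN) ?_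
    rintro q ⟨⟨hqC, hqB⟩, hqO⟩
    obtain ⟨W, ψ, hqW, hψ⟩ := hu.front k q (hCF k j hqC)
    have hU : IsOpen (openCylinder Ω ∩ (fun p => ‖φ p‖) ⁻¹' Iio (‖φ q‖ + 1)) :=
      hφ.norm.isOpen_inter_preimage hO isOpen_Iio
    refine ⟨W ∩ (Metric.ball q (1 / ((m : ℝ) + 1)) ∩
        (openCylinder Ω ∩ (fun p => ‖φ p‖) ⁻¹' Iio (‖φ q‖ + 1))), ψ,
      hψ.isOpen.inter (Metric.isOpen_ball.inter hU),
      ⟨hqW, Metric.mem_ball_self (by positivity), hqO, by simp⟩, hψ.contDiffAt hqW,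
      hψ.eq_zero ⟨hCF k j hqC, hqW⟩, hψ.fderiv_ne_zero ⟨hCF k j hqC, hqW⟩,
      fun p hp => hψ.eq_zero ⟨hCF k j hp.1.1, hp.2.1⟩, ⟨(‖φ q‖ + 1) * m, ?_⟩, ?_⟩
    · filter_upwards [hqB] with p hp hpU
      rw [norm_smul]
      have h1 : ‖φ p‖ < ‖φ q‖ + 1 := hpU.2.2.2
      have h2 := hp hpU.2.1 hpU.2.2.1
      gcongr
    · rintro p ⟨hpW, -, hpO, -⟩ hp0 hpZ
      have hpF := hψ.mem hpW hp0
      -- The jump condition at p comes with its own local equation ψ', possibly different from ψ;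
      -- both describe the same front near p.
      obtain ⟨W', ψ', hpW', hψ', -, l, hl⟩ :=
        (hu.hadamard k p ⟨hpF, hpZ⟩).exists_tendsto hc hpF (hRF k)
      refine ⟨ψ', fderiv ℝ ψ' p, hψ'.fderiv_ne_zero ⟨hpF, hpW'⟩,
        ((hψ'.contDiffAt hpW').differentiableAt one_ne_zero).hasFDerivAt, ?_, φ p * l, ?_⟩
      · filter_upwards [hψ.isOpen.mem_nhds hpW, hψ'.isOpen.mem_nhds hpW'] with p' h1 h2 h3
        exact hψ'.eq_zero ⟨hψ.mem h1 h3, h2⟩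
      · simp only [map_smul, smul_eq_mul]
        exact ((hφ.continuousAt (hO.mem_nhds hpO)).mono_left nhdsWithin_le_nhds).mul hl
  · rintro q ⟨hqO, hq⟩
    have hqZ : q ∉ ⋃ j, Z j := by
      intro h
      obtain ⟨j, hj⟩ := mem_iUnion.1 h
      exact hq (mem_iUnion.2 ⟨Sum.inl j, hj⟩)
    have hqR : q ∈ regularRegion Ω F Z := by
      refine ⟨hqO, ?_⟩
      rintro (h | h)
      · obtain ⟨k, hk⟩ := mem_iUnion.1 h
        obtain ⟨-, -, -, -, ⟨M, hM⟩, -⟩ := (hu.hadamard k q ⟨hk, hqZ⟩).exists_tendsto hc hk (hRF k)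
        obtain ⟨ε, hε, hM⟩ := Metric.mem_nhdsWithin_iff.1 hM
        have hj := hk
        rw [hFC k] at hj
        obtain ⟨j, hj⟩ := mem_iUnion.1 hj
        obtain ⟨m, hm⟩ := exists_nat_ge (max M ε⁻¹)
        refine hq (mem_iUnion.2 ⟨Sum.inr (k, j, m), hj, ?_⟩)
        filter_upwards [hu.ae_mem_regular hN] with p hp hpB hpO
        have hm1 : (1 : ℝ) / (m + 1) ≤ ε := by
          rw [div_le_iff₀ (by positivity)]
          have h1 : ε⁻¹ ≤ m := (le_max_right _ _).trans hm
          have h2 : ε * ε⁻¹ = 1 := mul_inv_cancel₀ hε.ne'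
          nlinarith
        have := hM ⟨Metric.ball_subset_ball hm1 hpB, hp hpO⟩
        exact le_trans this ((le_max_left _ _).trans hm)
      · exact hqZ h
    exact ⟨_, hu.isOpen_regular, hqR, H.weakDiv_waveFlux hφ hP hr hu.isOpen_regular
      regularRegion_subset hu.contDiffOn hu.waveEq⟩

end Flux

/-! ### Null sets in hypersurfaces -/

section HausdorffNull

theorem exists_hausdorffMeasure_image_graph_lt_top {E W : Type*} [NormedAddCommGroup E]
    [NormedSpace ℝ E] [MeasurableSpace E] [BorelSpace E] [NormedAddCommGroup W] [NormedSpace ℝ W]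
    [FiniteDimensional ℝ W] {k : ℕ} (hk : Module.finrank ℝ W = k) (L : E ≃L[ℝ] W × ℝ)
    {τ : W → ℝ} {y : W} (hτ : ContDiffAt ℝ 1 τ y) :
    ∃ t ∈ 𝓝 y, μH[(k : ℝ)] ((fun y => L.symm (y, τ y)) '' t) < ⊤ := by
  borelize W
  obtain ⟨C, s, hs, hlip⟩ := hτ.exists_lipschitzOnWith
  have hg := (L.symm.toContinuousLinearMap.lipschitz).comp_lipschitzOnWith
      (LipschitzWith.id.lipschitzOnWith.prodMk
        (hlip.mono (inter_subset_left (t := Metric.ball y 1))))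
  have hfin : μH[(k : ℝ)] (s ∩ Metric.ball y 1) < ⊤ := by
    rw [← hk]
    exact (measure_mono inter_subset_right).trans_lt Metric.isBounded_ball.measure_lt_top
  exact ⟨s ∩ Metric.ball y 1, inter_mem hs (Metric.ball_mem_nhds _ one_pos),
    (hg.hausdorffMeasure_image_le k.cast_nonneg).trans_lt (ENNReal.mul_lt_top
      (ENNReal.rpow_lt_top_of_nonneg k.cast_nonneg ENNReal.coe_ne_top) hfin)⟩

/-- The zero set of a `C¹` function without critical points has locally finite Hausdorff measure
of codimension one. -/
theorem exists_hausdorffMeasure_lt_top_of_fderiv_ne_zero {E : Type*} [NormedAddCommGroup E]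
    [NormedSpace ℝ E] [MeasurableSpace E] [BorelSpace E] [FiniteDimensional ℝ E] {k : ℕ}
    (hk : Module.finrank ℝ E = k + 1) {ψ : E → ℝ} {x : E} (hψ : ContDiffAt ℝ 1 ψ x) (h0 : ψ x = 0)
    (hd : fderiv ℝ ψ x ≠ 0) : ∃ U ∈ 𝓝 x, μH[(k : ℝ)] ({y | ψ y = 0} ∩ U) < ⊤ := by
  obtain ⟨e, he⟩ := exists_kerProdEquiv hd
  obtain ⟨U, W₀, τ, hU, hxU, hW, hτ, H⟩ := exists_kerProdEquiv_graph hψ h0 he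
  have hkr : Module.finrank ℝ (LinearMap.ker (fderiv ℝ ψ x : E →ₗ[ℝ] ℝ)) = k := by
    have h1 := (kerProdEquiv _ e he).toLinearEquiv.finrank_eq
    rw [Module.finrank_prod, Module.finrank_self, hk] at h1
    omega
  obtain ⟨t, ht, hfin⟩ := exists_hausdorffMeasure_image_graph_lt_top hkr (kerProdEquiv _ e he)
    (hτ.contDiffAt (hW.mem_nhds (H x hxU).1))
  refine ⟨U ∩ (fun q => (kerProdEquiv _ e he q).1) ⁻¹' t, inter_mem (hU.mem_nhds hxU)
    ((continuous_fst.comp (kerProdEquiv _ e he).continuous).continuousAt.preimage_mem_nhds ht),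
    (measure_mono ?_).trans_lt hfin⟩
  rintro p ⟨hp0, hpU, hpt⟩
  refine ⟨(kerProdEquiv _ e he p).1, hpt, ?_⟩
  have h2 := (H p hpU).2.1 hp0
  simp only
  rw [← h2]
  exact (kerProdEquiv _ e he).symm_apply_apply p

/-- The slice t = 0 has dimension N, and the projection to space is 1-Lipschitz, so a set of
vanishing N-dimensional Hausdorff measure meets it over a null set of x. -/
theorem ae_initial_notMem {N : ℕ} (hN : 0 < N) {Z : Set (Spacetime N)}
    (hZ : μH[((N - 1 : ℕ) : ℝ) + 1] Z = 0) : ∀ᵐ x : Space N, (x, (0 : ℝ)) ∉ Z := by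
  have h1 := (LipschitzWith.prod_fst (α := Space N) (β := ℝ)).hausdorffMeasure_image_le
    (d := ((N - 1 : ℕ) : ℝ) + 1) (by positivity) Z
  rw [hZ, mul_zero, nonpos_iff_eq_zero, natCast_pred hN, sub_add_cancel] at h1
  have h2 : volume (Prod.fst '' Z) = 0 := by
    have : (volume : Measure (Space N)) ≪ μH[(Module.finrank ℝ (Space N) : ℝ)] :=
      Measure.absolutelyContinuous_isAddHaarMeasure _ _
    refine this ?_
    rwa [finrank_euclideanSpace_fin]
  filter_upwards [measure_eq_zero_iff_ae_notMem.1 h2] with x hx hxZ using hx ⟨_, hxZ, rfl⟩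

end HausdorffNull

/-! ### Extension across the boundary of the cylinder -/

section Extension

variable {N : ℕ} {Ω : Set (Space N)} {ι : Type*} [Countable ι] {Z : ι → Set (Spacetime N)}
  {R : Set (Spacetime N)} {V : Spacetime N → Spacetime N} {h : Spacetime N → ℝ}

theorem locallyIntegrable_indicator_openCylinder {X : Type*} [NormedAddCommGroup X]
    (hΩ : IsOpen Ω) {f : Spacetime N → X} (hf : ∀ T : ℝ, IntegrableOn f (Ω ×ˢ Ioo (0 : ℝ) T)) :
    LocallyIntegrable ((openCylinder Ω).indicator f) := by
  have hO := isOpen_openCylinder hΩ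
  intro q
  refine ⟨univ ×ˢ Iio (q.2 + 1), prod_mem_nhds univ_mem (Iio_mem_nhds (lt_add_one _)), ?_⟩
  rw [IntegrableOn, integrable_indicator_iff hO.measurableSet, IntegrableOn,
    Measure.restrict_restrict hO.measurableSet]
  refine (hf (q.2 + 1)).mono_set ?_
  rintro p ⟨hp, -, hp2⟩
  exact ⟨hp.1, hp.2, hp2⟩

theorem locallyRemovable_exceptional (hN : 0 < N) {C : Set (Spacetime N)} (hC : IsClosed C)
    (hCm : μH[(N : ℝ) - 1] C < ⊤) {O : Set (Spacetime N)} (hO : IsOpen O)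
    (hV : LocallyIntegrableOn V O) (hV2 : LocallyIntegrableOn (fun q => ‖V q‖ ^ 2) O)
    (hh : LocallyIntegrableOn h O) : LocallyRemovable volume V h O C := by
  refine LocallyRemovable.of_hausdorff (finrank_spacetime hN) hO hC
    (fun q _ => ⟨univ, univ_mem, ?_⟩) hV hV2 hh
  rwa [inter_univ, natCast_pred hN]

theorem hausdorffMeasure_iUnion_exceptional (hN : 0 < N)
    (hZ : ∀ i, μH[(N : ℝ) - 1] (Z i) < ⊤) : μH[((N - 1 : ℕ) : ℝ) + 1] (⋃ i, Z i) = 0 := by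
  rw [measure_iUnion_null_iff]
  intro i
  refine (Measure.hausdorffMeasure_zero_or_top (d₁ := (N : ℝ) - 1) ?_ (Z i)).resolve_right
    (hZ i).ne
  rw [natCast_pred hN]
  linarith

/-- Extension by zero to negative times. -/
theorem WeakDiv.indicator_openCylinder (hN : 0 < N) (hΩ : IsOpen Ω) (hZc : ∀ i, IsClosed (Z i))
    (hZ : ∀ i, μH[(N : ℝ) - 1] (Z i) < ⊤) (hR : ∀ᵐ q, q ∈ openCylinder Ω → q ∈ R)
    (hV : ∀ T : ℝ, IntegrableOn V (Ω ×ˢ Ioo (0 : ℝ) T))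
    (hV2 : ∀ T : ℝ, IntegrableOn (fun q => ‖V q‖ ^ 2) (Ω ×ˢ Ioo (0 : ℝ) T))
    (hh : ∀ T : ℝ, IntegrableOn h (Ω ×ˢ Ioo (0 : ℝ) T)) (H : WeakDiv volume V h (openCylinder Ω))
    (hlim : ∀ x ∈ Ω, (x, (0 : ℝ)) ∉ ⋃ i, Z i →
      Tendsto (fun q => (V q).2) (𝓝[R] (x, 0)) (𝓝 0)) :
    WeakDiv volume ((openCylinder Ω).indicator V) ((openCylinder Ω).indicator h)
      (Ω ×ˢ (univ : Set ℝ)) := by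
  have hO := isOpen_openCylinder hΩ
  have hO' : IsOpen (Ω ×ˢ (univ : Set ℝ)) := hΩ.prod isOpen_univ
  have hVi := (locallyIntegrable_indicator_openCylinder hΩ hV).locallyIntegrableOn
    (Ω ×ˢ (univ : Set ℝ))
  have hhi := (locallyIntegrable_indicator_openCylinder hΩ hh).locallyIntegrableOn
    (Ω ×ˢ (univ : Set ℝ))
  have hV2i : LocallyIntegrableOn (fun q => ‖(openCylinder Ω).indicator V q‖ ^ 2)
      (Ω ×ˢ (univ : Set ℝ)) := by
    have := (locallyIntegrable_indicator_openCylinder hΩ hV2).locallyIntegrableOn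
      (Ω ×ˢ (univ : Set ℝ))
    convert this using 2 with q
    by_cases hq : q ∈ openCylinder Ω <;> simp [hq]
  set V' := (openCylinder Ω).indicator V with hV'
  set h' := (openCylinder Ω).indicator h with hh'
  have hV0 : ∀ q, q ∉ openCylinder Ω → V' q = 0 := fun q hq => indicator_of_notMem hq _
  have hh0 : ∀ q, q ∉ openCylinder Ω → h' q = 0 := fun q hq => indicator_of_notMem hq _
  have hR' : ∀ᵐ q, q ∈ R ∪ (openCylinder Ω)ᶜ := by
    filter_upwards [hR] with q hq
    by_cases hq2 : q ∈ openCylinder Ω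
    exacts [Or.inl (hq hq2), Or.inr hq2]
  -- The zero extension has time component tending to 0 from both sides of t = 0.
  have hlim' : ∀ x ∈ Ω, (x, (0 : ℝ)) ∉ ⋃ i, Z i →
      Tendsto (fun q => (V' q).2) (𝓝[R ∪ (openCylinder Ω)ᶜ] (x, 0)) (𝓝 0) := by
    intro x hx hxZ
    rw [nhdsWithin_union]
    refine Tendsto.sup ?_ ?_
    · refine squeeze_zero_norm (fun q => ?_) (by simpa using (hlim x hx hxZ).norm)
      by_cases hq : q ∈ openCylinder Ω
      · rw [hV', indicator_of_mem hq]; exact le_rfl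
      · rw [hV0 q hq]; simp
    · refine tendsto_const_nhds.congr' ?_
      filter_upwards [self_mem_nhdsWithin] with q hq
      rw [hV0 q hq]; rfl
  let B : ℕ → Set (Spacetime N) := fun m => {q | ∀ᵐ p, p ∈ Metric.ball q (1 / ((m : ℝ) + 1)) →
    |(V' p).2| ≤ m}
  refine WeakDiv.of_locallyRemovable (ι := ι ⊕ ℕ) hO' hVi hhi
    (Sum.elim Z fun m => {q | q.2 = 0} ∩ B m) ?_ ?_ ?_
  · rintro (i | m)
    exacts [hZc i, (isClosed_eq continuous_snd continuous_const).inter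
      (isClosed_setOf_ae_ball _ _ _)]
  · rintro (i | m)
    · exact locallyRemovable_exceptional hN (hZc i) (hZ i) hO' hVi hV2i hhi
    rintro q ⟨⟨hq0, hqB⟩, hqO⟩
    refine ⟨Metric.ball q (1 / ((m : ℝ) + 1)) ∩ Ω ×ˢ univ, Metric.isOpen_ball.inter hO',
      ⟨Metric.mem_ball_self (by positivity), hqO⟩, fun U' hU' hU'o HW => ?_⟩
    -- The plane t = 0 is the graph of the zero function, so only the time component of the field
    -- has to be controlled.
    refine WeakDiv.of_diff_graph (ν := (volume : Measure (Space N)))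
      (R := R ∪ (openCylinder Ω)ᶜ) hU'o (W₀ := Ω) hΩ (τ := fun _ => 0)
      contDiffOn_const (fun p hp => (hU' hp).2.1) (M := m) ?_ ?_ ?_
      (hVi.mono_set (hU'.trans inter_subset_right)) (hhi.mono_set (hU'.trans inter_subset_right))
      ?_
    · filter_upwards [hqB] with p hp hpU
      simpa using hp (hU' hpU).1
    · filter_upwards [hR'] with p hp _ using hp
    · filter_upwards [ae_initial_notMem hN (hausdorffMeasure_iUnion_exceptional hN hZ)]
        with y hy hyΩ _
      exact ⟨0, by simpa using hlim' y hyΩ hy⟩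
    · exact HW.mono fun p hp => ⟨hp.1, fun h => hp.2 h.1⟩
  · rintro q ⟨hqO, hq⟩
    have hqZ : q ∉ ⋃ i, Z i := by
      intro h
      obtain ⟨j, hj⟩ := mem_iUnion.1 h
      exact hq (mem_iUnion.2 ⟨Sum.inl j, hj⟩)
    rcases lt_trichotomy q.2 0 with h0 | h0 | h0
    · refine ⟨univ ×ˢ Iio 0, isOpen_univ.prod isOpen_Iio, ⟨mem_univ _, h0⟩,
        WeakDiv.of_forall_eq_zero ?_ ?_⟩
      · exact fun p hp => hV0 p fun h => lt_asymm (show p.2 < 0 from hp.2) h.2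
      · exact fun p hp => hh0 p fun h => lt_asymm (show p.2 < 0 from hp.2) h.2
    · exfalso
      obtain ⟨x, t⟩ := q
      obtain rfl : t = 0 := h0
      have h1 := (hlim' x hqO.1 hqZ).abs
      rw [abs_zero] at h1
      have h1 := h1.eventually (gt_mem_nhds one_pos)
      obtain ⟨ε, hε, hM⟩ := Metric.mem_nhdsWithin_iff.1 h1
      obtain ⟨m, hm⟩ := exists_nat_ge (max 1 ε⁻¹)
      refine hq (mem_iUnion.2 ⟨Sum.inr m, rfl, ?_⟩)
      filter_upwards [hR'] with p hp hpB
      have hm1 : (1 : ℝ) / (m + 1) ≤ ε := by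
        rw [div_le_iff₀ (by positivity)]
        have h1 : ε⁻¹ ≤ m := (le_max_right _ _).trans hm
        have h2 : ε * ε⁻¹ = 1 := mul_inv_cancel₀ hε.ne'
        nlinarith
      have : |(V' p).2| < 1 := hM ⟨Metric.ball_subset_ball hm1 hpB, hp⟩
      exact this.le.trans ((le_max_left _ _).trans hm)
    · refine ⟨openCylinder Ω, hO, ⟨hqO.1, h0⟩, H.congr_ae ?_ ?_⟩
      · exact Eventually.of_forall fun p hp => (indicator_of_mem hp V).symm
      · exact Eventually.of_forall fun p hp => (indicator_of_mem hp h).symm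

end Extension

/-! ### Extension across the lateral boundary -/

section LateralExtension

variable {N : ℕ} {Ω : Set (Space N)} {ι : Type*} [Countable ι] {Z : ι → Set (Spacetime N)}
  {R : Set (Spacetime N)} {V : Spacetime N → Spacetime N} {h : Spacetime N → ℝ}

theorem IsBoundaryChart.contDiffAt {W : Set (Space N)} {ρ : Space N → ℝ}
    (hρ : IsBoundaryChart Ω W ρ) {x : Space N} (hx : x ∈ W) : ContDiffAt ℝ 1 ρ x :=
  hρ.contDiffOn.contDiffAt (hρ.isOpen.mem_nhds hx)

theorem IsBoundaryChart.fderiv_ne_zero {W : Set (Space N)} {ρ : Space N → ℝ}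
    (hρ : IsBoundaryChart Ω W ρ) {x : Space N} (hx : x ∈ W) : fderiv ℝ ρ x ≠ 0 := by
  intro h0
  apply hρ.grad_ne_zero x hx
  rw [gradient, h0, map_zero]

theorem IsBoundaryChart.eq_zero {W : Set (Space N)} {ρ : Space N → ℝ} (hΩ : IsOpen Ω)
    (hρ : IsBoundaryChart Ω W ρ) {x : Space N} (hx : x ∈ W) (hxf : x ∈ frontier Ω) : ρ x = 0 := by
  rw [hΩ.frontier_eq] at hxf
  refine le_antisymm ?_ (not_lt.1 fun hlt => hxf.2 ?_)
  · have hcl : x ∈ closure (Ω ∩ W) := by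
      have := hxf.1
      rw [mem_closure_iff_nhdsWithin_neBot] at this ⊢
      rwa [nhdsWithin_inter_of_mem' (mem_nhdsWithin_of_mem_nhds (hρ.isOpen.mem_nhds hx))]
    have hne : (𝓝[Ω ∩ W] x).NeBot := mem_closure_iff_nhdsWithin_neBot.1 hcl
    refine le_of_tendsto (x := 𝓝[Ω ∩ W] x) ((hρ.contDiffAt hx).continuousAt.mono_left nhdsWithin_le_nhds) ?_
    filter_upwards [self_mem_nhdsWithin] with y hy
    rw [hρ.inter_eq] at hy
    exact hy.2.le
  · have : x ∈ Ω ∩ W := by rw [hρ.inter_eq]; exact ⟨hx, hlt⟩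
    exact this.1

theorem IsBoundaryChart.notMem {W : Set (Space N)} {ρ : Space N → ℝ}
    (hρ : IsBoundaryChart Ω W ρ) {x : Space N} (hx : x ∈ W) (h0 : ρ x = 0) : x ∉ Ω := by
  intro hxΩ
  have : x ∈ Ω ∩ W := ⟨hxΩ, hx⟩
  rw [hρ.inter_eq] at this
  exact absurd h0 this.2.ne

/-- The edge where the lateral boundary meets the initial plane has codimension two in space-time.
It is therefore removable for square integrable fields, and no boundary behaviour is required there.
-/
theorem IsLyapunovDomain.exists_hausdorffMeasure_corner_lt_top (hN : 0 < N)
    (hΩ : IsLyapunovDomain Ω) {q : Spacetime N} (hq : q ∈ frontier Ω ×ˢ ({0} : Set ℝ)) :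
    ∃ U ∈ 𝓝 q, μH[((N - 1 : ℕ) : ℝ)] (frontier Ω ×ˢ ({0} : Set ℝ) ∩ U) < ⊤ := by
  obtain ⟨W, ρ, hxW, hρ, -⟩ := hΩ.boundary q.1 hq.1
  obtain ⟨U, hU, hfin⟩ := exists_hausdorffMeasure_lt_top_of_fderiv_ne_zero (k := N - 1)
    (by rw [finrank_euclideanSpace_fin]; omega) (hρ.contDiffAt hxW)
    (hρ.eq_zero hΩ.isOpen hxW hq.1) (hρ.fderiv_ne_zero hxW)
  refine ⟨(W ∩ U) ×ˢ univ, prod_mem_nhds (inter_mem (hρ.isOpen.mem_nhds hxW) hU) univ_mem, ?_⟩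
  have hl : LipschitzWith 1 (fun x : Space N => (x, (0 : ℝ))) := LipschitzWith.prodMk_right 0
  refine (measure_mono ?_).trans_lt ((hl.hausdorffMeasure_image_le (Nat.cast_nonneg (N - 1))
    ({y | ρ y = 0} ∩ U)).trans_lt (by simpa using hfin))
  rintro ⟨x, t⟩ ⟨⟨hx, ht⟩, ⟨hxW, hxU⟩, -⟩
  obtain rfl : t = 0 := ht
  exact ⟨x, ⟨hρ.eq_zero hΩ.isOpen hxW hx, hxU⟩, rfl⟩

/-- Extension by zero across the lateral boundary, for a field with vanishing normal component. -/
theorem WeakDiv.indicator_openCylinder_univ (hN : 0 < N) (hΩ : IsLyapunovDomain Ω)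
    (hZc : ∀ i, IsClosed (Z i))
    (hZ : ∀ i, μH[(N : ℝ) - 1] (Z i) < ⊤) (hR : ∀ᵐ q, q ∈ openCylinder Ω → q ∈ R)
    (hV : ∀ T : ℝ, IntegrableOn V (Ω ×ˢ Ioo (0 : ℝ) T))
    (hV2 : ∀ T : ℝ, IntegrableOn (fun q => ‖V q‖ ^ 2) (Ω ×ˢ Ioo (0 : ℝ) T))
    (hh : ∀ T : ℝ, IntegrableOn h (Ω ×ˢ Ioo (0 : ℝ) T))
    (H : WeakDiv volume ((openCylinder Ω).indicator V) ((openCylinder Ω).indicator h)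
      (Ω ×ˢ (univ : Set ℝ)))
    (hlim : ∀ x ∈ frontier Ω, ∀ t : ℝ, 0 < t → (x, t) ∉ ⋃ i, Z i →
      (∃ M : ℝ, ∀ᶠ q in 𝓝[R] (x, t), ‖V q‖ ≤ M) ∧ ∀ n, IsExteriorUnitNormal Ω x n →
        Tendsto (fun q => ⟪n, (V q).1⟫_ℝ) (𝓝[R] (x, t)) (𝓝 0)) :
    WeakDiv volume ((openCylinder Ω).indicator V) ((openCylinder Ω).indicator h) univ := by
  have hΩo := hΩ.isOpen
  have hO := isOpen_openCylinder hΩo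
  have hVi := (locallyIntegrable_indicator_openCylinder hΩo hV).locallyIntegrableOn univ
  have hhi := (locallyIntegrable_indicator_openCylinder hΩo hh).locallyIntegrableOn univ
  have hV2i : LocallyIntegrableOn (fun q => ‖(openCylinder Ω).indicator V q‖ ^ 2) univ := by
    have := (locallyIntegrable_indicator_openCylinder hΩo hV2).locallyIntegrableOn univ
    convert this using 2 with q
    by_cases hq : q ∈ openCylinder Ω <;> simp [hq]
  set V' := (openCylinder Ω).indicator V with hV'
  set h' := (openCylinder Ω).indicator h with hh'
  have hV0 : ∀ q, q ∉ openCylinder Ω → V' q = 0 := fun q hq => indicator_of_notMem hq _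
  have hh0 : ∀ q, q ∉ openCylinder Ω → h' q = 0 := fun q hq => indicator_of_notMem hq _
  have hVle : ∀ q, ‖V' q‖ ≤ ‖V q‖ := fun q => norm_indicator_le_norm_self _ _
  have hR' : ∀ᵐ q, q ∈ R ∪ (openCylinder Ω)ᶜ := by
    filter_upwards [hR] with q hq
    by_cases hq2 : q ∈ openCylinder Ω
    exacts [Or.inl (hq hq2), Or.inr hq2]
  let B : ℕ → Set (Spacetime N) := fun m => {q | ∀ᵐ p, p ∈ Metric.ball q (1 / ((m : ℝ) + 1)) →
    ‖V' p‖ ≤ m}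
  -- The lateral boundary at positive times is not closed. It is exhausted by the closed parts t ≥
  -- 1/(l+1), each cut with the set where the essential bound m holds; the edge t = 0 is a separate
  -- removable set.
  refine WeakDiv.of_locallyRemovable (ι := ι ⊕ Unit ⊕ ℕ × ℕ) isOpen_univ hVi hhi
    (Sum.elim Z (Sum.elim (fun _ => frontier Ω ×ˢ ({0} : Set ℝ))
      fun i => frontier Ω ×ˢ Ici (1 / ((i.1 : ℝ) + 1)) ∩ B i.2)) ?_ ?_ ?_
  · rintro (i | i | i)
    exacts [hZc i, isClosed_frontier.prod isClosed_singleton,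
      (isClosed_frontier.prod isClosed_Ici).inter (isClosed_setOf_ae_ball _ _ _)]
  · rintro (i | i | ⟨l, m⟩)
    · exact locallyRemovable_exceptional hN (hZc i) (hZ i) isOpen_univ hVi hV2i hhi
    · exact LocallyRemovable.of_hausdorff (finrank_spacetime hN) isOpen_univ
        (isClosed_frontier.prod isClosed_singleton)
        (fun q hq => hΩ.exists_hausdorffMeasure_corner_lt_top hN hq.1) hVi hV2i hhi
    refine LocallyRemovable.of_hypersurface (R := R ∪ (openCylinder Ω)ᶜ) (finrank_spacetime hN)
      isOpen_univ hVi hhi (by filter_upwards [hR'] with p hp _ using hp)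
      (hausdorffMeasure_iUnion_exceptional hN hZ) ?_
    rintro q ⟨⟨⟨hqf, hqt⟩, hqB⟩, -⟩
    have hq0 : 0 < q.2 := lt_of_lt_of_le (by positivity) hqt
    obtain ⟨W, ρ, hqW, hρ, -⟩ := hΩ.boundary q.1 hqf
    have hfd : ∀ p : Spacetime N, p.1 ∈ W → HasFDerivAt (fun p : Spacetime N => ρ p.1)
        ((fderiv ℝ ρ p.1).comp (ContinuousLinearMap.fst ℝ (Space N) ℝ)) p := fun p hp =>
      HasFDerivAt.comp p ((hρ.contDiffAt hp).differentiableAt one_ne_zero).hasFDerivAt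
        (hasFDerivAt_fst (𝕜 := ℝ) (E := Space N) (F := ℝ) (p := p))
    have hne : ∀ p : Spacetime N, p.1 ∈ W →
        (fderiv ℝ ρ p.1).comp (ContinuousLinearMap.fst ℝ (Space N) ℝ) ≠ 0 := by
      intro p hp h0
      refine hρ.fderiv_ne_zero hp (ContinuousLinearMap.ext fun v => ?_)
      simpa using congrArg (fun f => f (v, 0)) h0
    refine ⟨Metric.ball q (1 / ((m : ℝ) + 1)) ∩ W ×ˢ Ioi 0, fun p => ρ p.1,
      Metric.isOpen_ball.inter (hρ.isOpen.prod isOpen_Ioi),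
      ⟨Metric.mem_ball_self (by positivity), hqW, hq0⟩,
      ContDiffAt.comp (g := ρ) q (hρ.contDiffAt hqW) contDiffAt_fst, hρ.eq_zero hΩo hqW hqf,
      by rw [(hfd q hqW).fderiv]; exact hne q hqW,
      fun p hp => hρ.eq_zero hΩo hp.2.2.1 hp.1.1.1, ⟨m, ?_⟩, ?_⟩
    · filter_upwards [hqB] with p hp hpU using hp hpU.1
    · rintro p ⟨-, hpW, hpt⟩ hp0 hpZ
      refine ⟨_, _, hne p hpW, hfd p hpW, Eventually.of_forall fun _ => id, 0, ?_⟩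
      by_cases hpf : p.1 ∈ frontier Ω
      · have h1 := (hlim p.1 hpf p.2 hpt hpZ).2 _ ⟨W, ρ, hpW, hρ, rfl⟩
        have hne' : ‖gradient ρ p.1‖ ≠ 0 := norm_ne_zero_iff.2 (hρ.grad_ne_zero _ hpW)
        rw [nhdsWithin_union]
        refine Tendsto.sup ?_ ?_
        · refine squeeze_zero_norm (fun p' => ?_)
            (by simpa using h1.norm.const_mul ‖gradient ρ p.1‖)
          have e : ((fderiv ℝ ρ p.1).comp (ContinuousLinearMap.fst ℝ (Space N) ℝ)) (V' p') =
              ‖gradient ρ p.1‖ * ⟪‖gradient ρ p.1‖⁻¹ • gradient ρ p.1, (V' p').1⟫_ℝ := by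
            rw [inner_smul_left, inner_gradient_left]
            simp only [conj_trivial, ContinuousLinearMap.comp_apply, ContinuousLinearMap.coe_fst']
            rw [mul_inv_cancel_left₀ hne']
          rw [e, norm_mul, norm_norm]
          refine mul_le_mul_of_nonneg_left ?_ (norm_nonneg _)
          by_cases hp' : p' ∈ openCylinder Ω
          · rw [hV', indicator_of_mem hp']; exact le_rfl
          · rw [hV0 _ hp']; simp
        · refine tendsto_const_nhds.congr' ?_
          filter_upwards [self_mem_nhdsWithin] with p' hp'
          rw [hV0 _ hp', map_zero]
      -- A zero of ρ off the boundary lies outside the closure of Ω, so the extended field vanishes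
      -- near it.
      · have hpc : p.1 ∉ closure Ω := by
          intro h
          rw [hΩo.frontier_eq] at hpf
          exact hpf ⟨h, hρ.notMem hpW hp0⟩
        refine tendsto_const_nhds.congr' (mem_nhdsWithin_of_mem_nhds ?_)
        filter_upwards [(isClosed_closure.isOpen_compl.preimage continuous_fst).mem_nhds hpc]
          with p' hp'
        show (0 : ℝ) = _
        rw [hV0 _ fun h => hp' (subset_closure h.1), map_zero]
  · rintro q ⟨-, hq⟩
    have hqZ : q ∉ ⋃ i, Z i := by
      intro h
      obtain ⟨j, hj⟩ := mem_iUnion.1 h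
      exact hq (mem_iUnion.2 ⟨Sum.inl j, hj⟩)
    have zero : ∀ S : Set (Spacetime N), (∀ p ∈ S, p ∉ openCylinder Ω) →
        WeakDiv volume V' h' S := fun S hS =>
      WeakDiv.of_forall_eq_zero (fun p hp => hV0 p (hS p hp)) fun p hp => hh0 p (hS p hp)
    by_cases hqΩ : q.1 ∈ Ω
    · exact ⟨_, hΩo.prod isOpen_univ, mem_prod.2 ⟨hqΩ, mem_univ _⟩, H⟩
    by_cases hqc : q.1 ∈ closure Ω
    swap
    · exact ⟨_, isClosed_closure.isOpen_compl.preimage continuous_fst, hqc,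
        zero _ fun p hp h => hp (subset_closure h.1)⟩
    have hqf : q.1 ∈ frontier Ω := by rw [hΩo.frontier_eq]; exact ⟨hqc, hqΩ⟩
    rcases lt_trichotomy q.2 0 with h0 | h0 | h0
    · exact ⟨univ ×ˢ Iio 0, isOpen_univ.prod isOpen_Iio, ⟨mem_univ _, h0⟩,
        zero _ fun p hp h => lt_asymm (show p.2 < 0 from hp.2) h.2⟩
    · exact absurd (mem_iUnion.2 ⟨Sum.inr (Sum.inl ()), mem_prod.2 ⟨hqf, h0⟩⟩) hq
    · exfalso
      obtain ⟨⟨M, hM⟩, -⟩ := hlim q.1 hqf q.2 h0 hqZ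
      obtain ⟨ε, hε, hM⟩ := Metric.mem_nhdsWithin_iff.1 hM
      obtain ⟨m, hm⟩ := exists_nat_ge (max (max M 0) ε⁻¹)
      obtain ⟨l, hl⟩ := exists_nat_one_div_lt h0
      refine hq (mem_iUnion.2 ⟨Sum.inr (Sum.inr (l, m)), ⟨hqf, hl.le⟩, ?_⟩)
      filter_upwards [hR'] with p hp hpB
      have hm1 : (1 : ℝ) / (m + 1) ≤ ε := by
        rw [div_le_iff₀ (by positivity)]
        have h1 : ε⁻¹ ≤ m := (le_max_right _ _).trans hm
        have h2 : ε * ε⁻¹ = 1 := mul_inv_cancel₀ hε.ne'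
        nlinarith
      have hm2 : max M 0 ≤ m := (le_max_left _ _).trans hm
      rcases hp with hp | hp
      · exact ((hVle p).trans (hM ⟨Metric.ball_subset_ball hm1 hpB, hp⟩)).trans
          ((le_max_left _ _).trans hm2)
      · rw [hV0 p hp, norm_zero]
        exact (le_max_right _ _).trans hm2

end LateralExtension

/-! ### Multipliers -/

section Multiplier

variable {N : ℕ} {c : ℝ} {Ω : Set (Space N)} {G u v : Spacetime N → ℝ}
  {F Z F' Z' : ℕ → Set (Spacetime N)}

/-- A bounded continuous function `φ` with weak gradient `(P, r)`, regular enough for the wave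
equation to be multiplied by `φ`. -/
structure IsMultiplier (Ω : Set (Space N)) (φ : Spacetime N → ℝ) (P : Spacetime N → Space N)
    (r : Spacetime N → ℝ) : Prop where
  hasWeakGrad : HasWeakGrad φ P r (openCylinder Ω)
  continuousOn : ContinuousOn φ (openCylinder Ω)
  bounded : ∃ M, ∀ q, ‖φ q‖ ≤ M
  locallyIntegrableOn_fst : LocallyIntegrableOn P (openCylinder Ω)
  locallyIntegrableOn_snd : LocallyIntegrableOn r (openCylinder Ω)
  integrableOn_inner : ∀ g : Spacetime N → Space N,
    (∀ T : ℝ, MemLp g 2 (volume.restrict (Ω ×ˢ Ioo (0 : ℝ) T))) →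
      ∀ T : ℝ, IntegrableOn (fun q => ⟪P q, g q⟫_ℝ) (Ω ×ˢ Ioo (0 : ℝ) T)
  integrableOn_mul : ∀ g : Spacetime N → ℝ, (∀ T : ℝ, IntegrableOn g (Ω ×ˢ Ioo (0 : ℝ) T)) →
      ∀ T : ℝ, IntegrableOn (fun q => r q * g q) (Ω ×ˢ Ioo (0 : ℝ) T)

theorem measurableSet_prod_Ioo (hΩ : IsOpen Ω) (T : ℝ) : MeasurableSet (Ω ×ˢ Ioo (0 : ℝ) T) :=
  hΩ.measurableSet.prod measurableSet_Ioo

theorem integrable_indicator_of_memLp_two {X : Type*} [NormedAddCommGroup X] (hΩ : IsOpen Ω)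
    (hΩb : Bornology.IsBounded Ω) {f : Spacetime N → X} {T : ℝ}
    (hf : MemLp f 2 (volume.restrict (Ω ×ˢ Ioo (0 : ℝ) T))) :
    Integrable ((Ω ×ˢ Ioo (0 : ℝ) T).indicator f) ∧
      Integrable (fun q => ‖(Ω ×ˢ Ioo (0 : ℝ) T).indicator f q‖ ^ 2) := by
  have : IsFiniteMeasure ((volume : Measure (Spacetime N)).restrict (Ω ×ˢ Ioo (0 : ℝ) T)) :=
    isFiniteMeasure_restrict.2 (volume_prod_Ioo_lt_top hΩb T).ne
  have hQ := measurableSet_prod_Ioo hΩ T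
  refine ⟨IntegrableOn.integrable_indicator (hf.integrable one_le_two) hQ, ?_⟩
  have h1 : IntegrableOn (fun q => ‖f q‖ ^ 2) (Ω ×ˢ Ioo (0 : ℝ) T) := hf.norm.integrable_sq
  refine (h1.integrable_indicator hQ).congr (Eventually.of_forall fun q => ?_)
  by_cases hq : q ∈ Ω ×ˢ Ioo (0 : ℝ) T <;> simp [hq]

theorem indicator_prod_Ioo_eq_zero {X : Type*} [Zero X] {f : Spacetime N → X} {S T : ℝ}
    (hTS : T ≤ S) (q : Spacetime N) (hq : q.2 ∉ Icc 0 S) :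
    (Ω ×ˢ Ioo (0 : ℝ) T).indicator f q = 0 :=
  indicator_of_notMem (fun h => hq ⟨h.2.1.le, h.2.2.le.trans hTS⟩) _

/-- The tail of a bounded continuous f is again bounded and continuous. Its spatial gradient is a
tail of a square integrable field, which pairs integrably with square integrable fields, and its
time derivative -f is bounded. -/
theorem HasWeakGrad.isMultiplier_tail (hΩ : IsOpen Ω) (hΩb : Bornology.IsBounded Ω)
    {f : Spacetime N → ℝ} {P : Spacetime N → Space N} {r : Spacetime N → ℝ}
    (H : HasWeakGrad f P r (openCylinder Ω)) (hf : ContinuousOn f (openCylinder Ω)) {M T : ℝ}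
    (hT : 0 ≤ T) (hM0 : 0 ≤ M) (hM : ∀ q ∈ Ω ×ˢ Ioo (0 : ℝ) T, ‖f q‖ ≤ M)
    (hP : MemLp P 2 (volume.restrict (Ω ×ˢ Ioo (0 : ℝ) T))) :
    IsMultiplier Ω (tail ((Ω ×ˢ Ioo (0 : ℝ) T).indicator f))
      (tail ((Ω ×ˢ Ioo (0 : ℝ) T).indicator P))
      (fun q => -(Ω ×ˢ Ioo (0 : ℝ) T).indicator f q) := by
  have hQ := measurableSet_prod_Ioo hΩ T
  have hfm : AEStronglyMeasurable f (volume.restrict (Ω ×ˢ Ioo (0 : ℝ) T)) :=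
    (hf.mono (IsClassicalSolution.prod_Ioo_subset T)).aestronglyMeasurable hQ
  have hfi : IntegrableOn f (Ω ×ˢ Ioo (0 : ℝ) T) :=
    (integrableOn_const (C := M) (volume_prod_Ioo_lt_top hΩb T).ne).mono' hfm
      (by filter_upwards [ae_restrict_mem hQ] with q hq using hM q hq)
  obtain ⟨hP1, hP2⟩ := integrable_indicator_of_memLp_two hΩ hΩb hP
  have hPi : IntegrableOn P (Ω ×ˢ Ioo (0 : ℝ) T) := (integrable_indicator_iff hQ).1 hP1
  have hki := hfi.integrable_indicator hQ
  refine ⟨H.tail_indicator hΩ hΩb hfi hPi, continuousOn_tail_indicator hΩ hf hM hM0,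
    ⟨M * T, fun q => norm_tail_indicator_le hT hM q hM0⟩,
    (locallyIntegrable_tail hP1).locallyIntegrableOn _,
    hki.neg.locallyIntegrable.locallyIntegrableOn _, fun g hg S => ?_, fun g hg S => ?_⟩
  · let S' := max S T
    have hQ' := measurableSet_prod_Ioo hΩ S'
    obtain ⟨hg1, hg2⟩ := integrable_indicator_of_memLp_two hΩ hΩb (hg S')
    have := (integrable_and_integral_inner_tail hP1 hP2 hg1.aestronglyMeasurable hg2
      (indicator_prod_Ioo_eq_zero (le_max_right S T))
      (indicator_prod_Ioo_eq_zero (le_refl S'))).2.2.1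
    have h2 : IntegrableOn (fun q => ⟪tail ((Ω ×ˢ Ioo (0 : ℝ) T).indicator P) q, g q⟫_ℝ)
        (Ω ×ˢ Ioo (0 : ℝ) S') := by
      refine this.integrableOn.congr_fun (fun q hq => ?_) hQ'
      simp only [indicator_of_mem hq]
    exact h2.mono_set (prod_mono subset_rfl (Ioo_subset_Ioo_right (le_max_left S T)))
  · refine Integrable.bdd_mul (c := M) (hg S) hki.neg.aestronglyMeasurable.restrict
      (Eventually.of_forall fun q => ?_)
    rw [norm_neg]
    by_cases hq : q ∈ Ω ×ˢ Ioo (0 : ℝ) T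
    · rw [indicator_of_mem hq]; exact hM q hq
    · rw [indicator_of_notMem hq, norm_zero]; exact hM0

/-- The flux of the difference of `u` and `v`. -/
noncomputable def fluxDiff (c : ℝ) (u v : Spacetime N → ℝ) (q : Spacetime N) : Spacetime N :=
  (spaceGrad u q - spaceGrad v q, -((timeDeriv u q - timeDeriv v q) / c ^ 2))

namespace IsMultiplier

variable {φ r : Spacetime N → ℝ} {P : Spacetime N → Space N}

theorem integrableOn_smul {X : Type*} [NormedAddCommGroup X] [NormedSpace ℝ X] (hΩ : IsOpen Ω)
    (hφ : IsMultiplier Ω φ P r) {g : Spacetime N → X} {T : ℝ}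
    (hg : IntegrableOn g (Ω ×ˢ Ioo (0 : ℝ) T)) :
    IntegrableOn (fun q => φ q • g q) (Ω ×ˢ Ioo (0 : ℝ) T) := by
  obtain ⟨M, hM⟩ := hφ.bounded
  exact Integrable.bdd_smul (C := M) hg ((hφ.continuousOn.mono
    (IsClassicalSolution.prod_Ioo_subset T)).aestronglyMeasurable (measurableSet_prod_Ioo hΩ T))
    (Eventually.of_forall hM)

theorem memLp_smul {X : Type*} [NormedAddCommGroup X] [NormedSpace ℝ X] (hΩ : IsOpen Ω)
    (hφ : IsMultiplier Ω φ P r) {g : Spacetime N → X} {T : ℝ}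
    (hg : MemLp g 2 (volume.restrict (Ω ×ˢ Ioo (0 : ℝ) T))) :
    MemLp (fun q => φ q • g q) 2 (volume.restrict (Ω ×ˢ Ioo (0 : ℝ) T)) := by
  obtain ⟨M, hM⟩ := hφ.bounded
  have hm := (hφ.continuousOn.mono
    (IsClassicalSolution.prod_Ioo_subset T)).aestronglyMeasurable (μ := volume)
    (measurableSet_prod_Ioo hΩ T)
  refine hg.of_le_mul (c := M) (hm.smul hg.aestronglyMeasurable) (Eventually.of_forall fun q => ?_)
  rw [norm_smul]
  exact mul_le_mul_of_nonneg_right (hM q) (norm_nonneg _)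

/-- Each solution satisfies the Hadamard conditions only on its own fronts, so the product rule is
applied to u and v separately with the same φ. The terms φ G, which are only locally integrable,
then cancel. -/
theorem weakDiv_fluxDiff (hN : 0 < N) (hc : 0 < c) (hΩ : IsLyapunovDomain Ω)
    (hG : LocallyIntegrableOn G (openCylinder Ω)) (hu : IsClassicalSolution c Ω G u F Z)
    (hv : IsClassicalSolution c Ω G v F' Z') (hφ : IsMultiplier Ω φ P r) :
    WeakDiv volume (fun q => φ q • fluxDiff c u v q)
      (fun q => ⟪P q, spaceGrad u q - spaceGrad v q⟫_ℝ -
        r q * (timeDeriv u q - timeDeriv v q) / c ^ 2) (openCylinder Ω) := by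
  have hΩo := hΩ.isOpen
  have hO := isOpen_openCylinder hΩo
  have key : ∀ {u : Spacetime N → ℝ} {F Z : ℕ → Set (Spacetime N)},
      IsClassicalSolution c Ω G u F Z →
      WeakDiv volume (fun q => φ q • waveFlux c u q)
        (fun q => (⟪P q, spaceGrad u q⟫_ℝ - r q * timeDeriv u q / c ^ 2) + φ q * G q)
        (openCylinder Ω) ∧ LocallyIntegrableOn (fun q => φ q • waveFlux c u q) (openCylinder Ω) ∧
      LocallyIntegrableOn (fun q => (⟪P q, spaceGrad u q⟫_ℝ - r q * timeDeriv u q / c ^ 2) +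
        φ q * G q) (openCylinder Ω) := by
    intro u F Z hu
    have h1 := hφ.integrableOn_inner _ (hu.memLp_spaceGrad hN)
    have h2 := hφ.integrableOn_mul _ (hu.integrableOn_timeDeriv hN hc hΩ.isBounded)
    refine ⟨hu.weakDiv_smul_waveFlux hN hc hΩ hG hφ.hasWeakGrad hφ.continuousOn
      hφ.locallyIntegrableOn_fst hφ.locallyIntegrableOn_snd
      (locallyIntegrableOn_openCylinder hΩo h1) (locallyIntegrableOn_openCylinder hΩo h2),
      locallyIntegrableOn_openCylinder hΩo fun T => hφ.integrableOn_smul hΩo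
        (hu.integrableOn_waveFlux hN hc hΩ.isBounded T), ?_⟩
    exact (locallyIntegrableOn_openCylinder hΩo fun T => (h1 T).sub ((h2 T).div_const _)).add
      (hG.continuousOn_mul hφ.continuousOn hO.isLocallyClosed)
  obtain ⟨a1, a2, a3⟩ := key hu
  obtain ⟨b1, b2, b3⟩ := key hv
  refine (a1.sub b1 a2 a3 b2 b3).congr_ae (Eventually.of_forall fun q _ => ?_)
    (Eventually.of_forall fun q _ => ?_)
  · rw [← smul_sub]
    congr 1
    ext1
    · rfl
    · simp only [waveFlux, fluxDiff, Prod.snd_sub]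
      ring
  · rw [inner_sub_right]
    ring

end IsMultiplier

end Multiplier

/-! ### The pairing of a multiplier with the flux -/

/-- Divergence theorem without boundary terms: test with a cutoff equal to 1 near S, where its
differential vanishes. -/
theorem WeakDiv.integral_eq_zero {E : Type*} [NormedAddCommGroup E] [NormedSpace ℝ E]
    [MeasurableSpace E] [BorelSpace E] [FiniteDimensional ℝ E] {μ : Measure E} {V : E → E}
    {h : E → ℝ} (H : WeakDiv μ V h univ) {S : Set E} (hS : Bornology.IsBounded S)
    (hV : ∀ q ∉ S, V q = 0) (hh : ∀ q ∉ S, h q = 0) : ∫ q, h q ∂μ = 0 := by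
  obtain ⟨ρ, hρ, hSρ⟩ := hS.subset_ball_lt 0 0
  let f : ContDiffBump (0 : E) := ⟨ρ, ρ + 1, hρ, lt_add_one ρ⟩
  rw [← H f ⟨f.contDiff, f.hasCompactSupport, subset_univ _⟩]
  refine integral_congr_ae (Eventually.of_forall fun q => ?_)
  by_cases hq : q ∈ S
  · have h1 : (f : E → ℝ) =ᶠ[𝓝 q] fun _ => 1 := by
      filter_upwards [Metric.isOpen_ball.mem_nhds (hSρ hq)] with p hp
      exact f.one_of_mem_closedBall (Metric.ball_subset_closedBall hp)
    simp only
    rw [h1.fderiv_eq, h1.self_of_nhds]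
    simp
  · simp [hV q hq, hh q hq]

section Pairing

variable {N : ℕ} {c : ℝ} {Ω : Set (Space N)} {G u v : Spacetime N → ℝ}
  {F Z F' Z' : ℕ → Set (Spacetime N)}

namespace IsMultiplier

variable {φ r : Spacetime N → ℝ} {P : Spacetime N → Space N}

theorem memLp_fluxDiff (hN : 0 < N) (hc : 0 < c) (hu : IsClassicalSolution c Ω G u F Z)
    (hv : IsClassicalSolution c Ω G v F' Z') (T : ℝ) :
    MemLp (fluxDiff c u v) 2 (volume.restrict (Ω ×ˢ Ioo (0 : ℝ) T)) := by
  have := (hu.memLp_waveFlux hN hc T).sub (hv.memLp_waveFlux hN hc T)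
  have e : fluxDiff c u v = waveFlux c u - waveFlux c v := by
    refine funext fun q => ?_
    simp only [fluxDiff, waveFlux, Pi.sub_apply, Prod.mk_sub_mk]
    congr 1
    ring
  rwa [e]

theorem integrableOn_fluxDiff (hN : 0 < N) (hc : 0 < c) (hΩ : Bornology.IsBounded Ω)
    (hu : IsClassicalSolution c Ω G u F Z)
    (hv : IsClassicalSolution c Ω G v F' Z') (T : ℝ) :
    IntegrableOn (fluxDiff c u v) (Ω ×ˢ Ioo (0 : ℝ) T) :=
  have : IsFiniteMeasure ((volume : Measure (Spacetime N)).restrict (Ω ×ˢ Ioo (0 : ℝ) T)) :=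
    isFiniteMeasure_restrict.2 (volume_prod_Ioo_lt_top hΩ T).ne
  (memLp_fluxDiff hN hc hu hv T).integrable one_le_two

theorem integrableOn_pairing (hN : 0 < N) (hc : 0 < c) (hΩ : Bornology.IsBounded Ω)
    (hu : IsClassicalSolution c Ω G u F Z) (hv : IsClassicalSolution c Ω G v F' Z')
    (hφ : IsMultiplier Ω φ P r) (T : ℝ) :
    IntegrableOn (fun q => ⟪P q, spaceGrad u q - spaceGrad v q⟫_ℝ -
        r q * (timeDeriv u q - timeDeriv v q) / c ^ 2) (Ω ×ˢ Ioo (0 : ℝ) T) :=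
  (hφ.integrableOn_inner _ (fun T => (hu.memLp_spaceGrad hN T).sub (hv.memLp_spaceGrad hN T)) T).sub
    ((hφ.integrableOn_mul _ (fun T => (hu.integrableOn_timeDeriv hN hc hΩ T).sub
      (hv.integrableOn_timeDeriv hN hc hΩ T)) T).div_const _)

theorem ae_mem_regular_inter (hN : 0 < N) (hu : IsClassicalSolution c Ω G u F Z)
    (hv : IsClassicalSolution c Ω G v F' Z') : ∀ᵐ q, q ∈ openCylinder Ω →
      q ∈ regularRegion Ω F Z ∩ regularRegion Ω F' Z' := by
  filter_upwards [hu.ae_mem_regular hN, hv.ae_mem_regular hN] with q h1 h2 hq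
    using ⟨h1 hq, h2 hq⟩

/-- Both time derivatives tend to the same initial velocity and φ is bounded, so the time component
of the flux tends to 0 at t = 0 and the field extends by zero. -/
theorem weakDiv_indicator_fluxDiff (hN : 0 < N) (hc : 0 < c) (hΩ : IsLyapunovDomain Ω)
    (hG : LocallyIntegrableOn G (openCylinder Ω)) (hu : IsClassicalSolution c Ω G u F Z)
    (hv : IsClassicalSolution c Ω G v F' Z') {u₀ v₀ : Space N → ℝ}
    (hui : HasInitialData Ω u₀ v₀ u F Z) (hvi : HasInitialData Ω u₀ v₀ v F' Z')
    (hφ : IsMultiplier Ω φ P r) :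
    WeakDiv volume ((openCylinder Ω).indicator fun q => φ q • fluxDiff c u v q)
      ((openCylinder Ω).indicator fun q => ⟪P q, spaceGrad u q - spaceGrad v q⟫_ℝ -
        r q * (timeDeriv u q - timeDeriv v q) / c ^ 2) (Ω ×ˢ (univ : Set ℝ)) := by
  refine WeakDiv.indicator_openCylinder (Z := Sum.elim Z Z')
    (R := regularRegion Ω F Z ∩ regularRegion Ω F' Z') hN hΩ.isOpen
    (by rintro (i | i); exacts [hu.isClosed_exceptional i, hv.isClosed_exceptional i])
    (by rintro (i | i); exacts [hu.measure_exceptional i, hv.measure_exceptional i])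
    (ae_mem_regular_inter hN hu hv)
    (fun T => hφ.integrableOn_smul hΩ.isOpen (integrableOn_fluxDiff hN hc hΩ.isBounded hu hv T))
    (fun T => (hφ.memLp_smul hΩ.isOpen (memLp_fluxDiff hN hc hu hv T)).norm.integrable_sq)
    (hφ.integrableOn_pairing hN hc hΩ.isBounded hu hv)
    (hφ.weakDiv_fluxDiff hN hc hΩ hG hu hv) ?_
  intro x hx hxZ
  rw [iUnion_sumElim, mem_union, not_or] at hxZ
  have h1 := (hui.velocity x hx hxZ.1).mono_left (nhdsWithin_mono _ inter_subset_left :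
    𝓝[regularRegion Ω F Z ∩ regularRegion Ω F' Z'] (x, (0 : ℝ)) ≤ _)
  have h2 := (hvi.velocity x hx hxZ.2).mono_left (nhdsWithin_mono _ inter_subset_right :
    𝓝[regularRegion Ω F Z ∩ regularRegion Ω F' Z'] (x, (0 : ℝ)) ≤ _)
  have h3 := ((h1.sub h2).div_const (c ^ 2)).neg
  rw [sub_self, zero_div, neg_zero] at h3
  obtain ⟨M, hM⟩ := hφ.bounded
  exact (h3.zero_mul_isBoundedUnder_le (isBoundedUnder_of ⟨M, hM⟩)).congr fun q => mul_comm _ _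

/-- At the lateral boundary the flux stays bounded, because the derivatives have limits, and its
normal component tends to p - p = 0. -/
theorem weakDiv_indicator_fluxDiff_of_neumann (hN : 0 < N) (hc : 0 < c) (hΩ : IsLyapunovDomain Ω)
    (hG : LocallyIntegrableOn G (openCylinder Ω)) (hu : IsClassicalSolution c Ω G u F Z)
    (hv : IsClassicalSolution c Ω G v F' Z') {u₀ v₀ : Space N → ℝ}
    (hui : HasInitialData Ω u₀ v₀ u F Z) (hvi : HasInitialData Ω u₀ v₀ v F' Z')
    {p : Spacetime N → ℝ} (hup : HasNeumannData Ω p u F Z) (hvp : HasNeumannData Ω p v F' Z')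
    (hφ : IsMultiplier Ω φ P r) :
    WeakDiv volume ((openCylinder Ω).indicator fun q => φ q • fluxDiff c u v q)
      ((openCylinder Ω).indicator fun q => ⟪P q, spaceGrad u q - spaceGrad v q⟫_ℝ -
        r q * (timeDeriv u q - timeDeriv v q) / c ^ 2) univ := by
  refine WeakDiv.indicator_openCylinder_univ (Z := Sum.elim Z Z')
    (R := regularRegion Ω F Z ∩ regularRegion Ω F' Z') hN hΩ
    (by rintro (i | i); exacts [hu.isClosed_exceptional i, hv.isClosed_exceptional i])
    (by rintro (i | i); exacts [hu.measure_exceptional i, hv.measure_exceptional i])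
    (ae_mem_regular_inter hN hu hv)
    (fun T => hφ.integrableOn_smul hΩ.isOpen (integrableOn_fluxDiff hN hc hΩ.isBounded hu hv T))
    (fun T => (hφ.memLp_smul hΩ.isOpen (memLp_fluxDiff hN hc hu hv T)).norm.integrable_sq)
    (hφ.integrableOn_pairing hN hc hΩ.isBounded hu hv)
    (hφ.weakDiv_indicator_fluxDiff hN hc hΩ hG hu hv hui hvi) ?_
  intro x hx t ht hxZ
  rw [iUnion_sumElim, mem_union, not_or] at hxZ
  obtain ⟨⟨a, ha⟩, g, hg, hgn⟩ := hup x hx t ht hxZ.1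
  obtain ⟨⟨a', ha'⟩, g', hg', hgn'⟩ := hvp x hx t ht hxZ.2
  have le1 : 𝓝[regularRegion Ω F Z ∩ regularRegion Ω F' Z'] (x, t) ≤
    𝓝[regularRegion Ω F Z] (x, t) := nhdsWithin_mono _ inter_subset_left
  have le2 : 𝓝[regularRegion Ω F Z ∩ regularRegion Ω F' Z'] (x, t) ≤
    𝓝[regularRegion Ω F' Z'] (x, t) := nhdsWithin_mono _ inter_subset_right
  have hgd := (hg.mono_left le1).sub (hg'.mono_left le2)
  have htd := (ha.mono_left le1).sub (ha'.mono_left le2)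
  have hfd := hgd.prodMk_nhds (htd.div_const (c ^ 2)).neg
  obtain ⟨M, hM⟩ := hφ.bounded
  have hM0 : 0 ≤ M := (norm_nonneg _).trans (hM 0)
  refine ⟨⟨M * (‖(g - g', -((a - a') / c ^ 2))‖ + 1), ?_⟩, fun n hn => ?_⟩
  · filter_upwards [hfd.norm.eventually (gt_mem_nhds (lt_add_one _))] with q hq
    rw [norm_smul]
    exact mul_le_mul (hM q) hq.le (norm_nonneg _) hM0
  · have h0 := (tendsto_const_nhds (x := n)).inner (𝕜 := ℝ) hgd
    rw [inner_sub_right, hgn n hn, hgn' n hn, sub_self] at h0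
    refine (h0.zero_mul_isBoundedUnder_le (isBoundedUnder_of ⟨M, hM⟩)).congr fun q => ?_
    rw [mul_comm]
    simp [fluxDiff, inner_smul_right]

/-- The Dirichlet variant: a multiplier vanishing near the lateral boundary makes the identity
trivial there, so nothing about the derivatives at that boundary enters. -/
theorem weakDiv_indicator_fluxDiff_of_vanishing (hN : 0 < N) (hc : 0 < c)
    (hΩ : IsLyapunovDomain Ω) (hG : LocallyIntegrableOn G (openCylinder Ω))
    (hu : IsClassicalSolution c Ω G u F Z)
    (hv : IsClassicalSolution c Ω G v F' Z') {u₀ v₀ : Space N → ℝ}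
    (hui : HasInitialData Ω u₀ v₀ u F Z) (hvi : HasInitialData Ω u₀ v₀ v F' Z')
    (hφ : IsMultiplier Ω φ P r)
    (h0 : ∀ x ∈ frontier Ω, ∃ U : Set (Space N), IsOpen U ∧ x ∈ U ∧
      ∀ q ∈ openCylinder Ω, q.1 ∈ U → φ q = 0 ∧ P q = 0 ∧ r q = 0) :
    WeakDiv volume ((openCylinder Ω).indicator fun q => φ q • fluxDiff c u v q)
      ((openCylinder Ω).indicator fun q => ⟪P q, spaceGrad u q - spaceGrad v q⟫_ℝ -
        r q * (timeDeriv u q - timeDeriv v q) / c ^ 2) univ := by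
  have H := hφ.weakDiv_indicator_fluxDiff hN hc hΩ hG hu hv hui hvi
  refine WeakDiv.of_locally
    ((locallyIntegrable_indicator_openCylinder hΩ.isOpen fun T => hφ.integrableOn_smul hΩ.isOpen
      (integrableOn_fluxDiff hN hc hΩ.isBounded hu hv T)).locallyIntegrableOn _)
    ((locallyIntegrable_indicator_openCylinder hΩ.isOpen
      (hφ.integrableOn_pairing hN hc hΩ.isBounded hu hv)).locallyIntegrableOn _) fun q _ => ?_
  by_cases hqΩ : q.1 ∈ Ω
  · exact ⟨_, hΩ.isOpen.prod isOpen_univ, mem_prod.2 ⟨hqΩ, mem_univ _⟩, H⟩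
  by_cases hqc : q.1 ∈ closure Ω
  · obtain ⟨U, hU, hqU, h0⟩ := h0 q.1 (by rw [hΩ.isOpen.frontier_eq]; exact ⟨hqc, hqΩ⟩)
    refine ⟨_, hU.preimage continuous_fst, hqU, WeakDiv.of_forall_eq_zero ?_ ?_⟩
    · intro p hp
      by_cases hpD : p ∈ openCylinder Ω
      · rw [indicator_of_mem hpD, (h0 p hpD hp).1, zero_smul]
      · exact indicator_of_notMem hpD _
    · intro p hp
      by_cases hpD : p ∈ openCylinder Ω
      · rw [indicator_of_mem hpD, (h0 p hpD hp).2.1, (h0 p hpD hp).2.2]; simp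
      · exact indicator_of_notMem hpD _
  · exact ⟨_, isClosed_closure.isOpen_compl.preimage continuous_fst, hqc,
      WeakDiv.of_forall_eq_zero
        (fun p hp => indicator_of_notMem (fun h => hp (subset_closure h.1)) _)
        (fun p hp => indicator_of_notMem (fun h => hp (subset_closure h.1)) _)⟩

end IsMultiplier

/-- The energy identity for a tail multiplier. -/
theorem integral_inner_tail_add_eq_zero {f : Spacetime N → ℝ} {P p : Spacetime N → Space N}
    {r : Spacetime N → ℝ} {T : ℝ} (hΩ : IsOpen Ω) (hΩb : Bornology.IsBounded Ω)
    (h1 : Integrable fun q => ⟪tail ((Ω ×ˢ Ioo (0 : ℝ) T).indicator P) q,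
      (Ω ×ˢ Ioo (0 : ℝ) T).indicator p q⟫_ℝ)
    (h2 : IntegrableOn (fun q => f q * r q) (Ω ×ˢ Ioo (0 : ℝ) T))
    (H : WeakDiv volume ((openCylinder Ω).indicator fun q =>
        tail ((Ω ×ˢ Ioo (0 : ℝ) T).indicator f) q • fluxDiff c u v q)
      ((openCylinder Ω).indicator fun q => ⟪tail ((Ω ×ˢ Ioo (0 : ℝ) T).indicator P) q, p q⟫_ℝ -
        -(Ω ×ˢ Ioo (0 : ℝ) T).indicator f q * r q / c ^ 2) univ) :
    (∫ q, ⟪tail ((Ω ×ˢ Ioo (0 : ℝ) T).indicator P) q, (Ω ×ˢ Ioo (0 : ℝ) T).indicator p q⟫_ℝ) +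
      (∫ q in Ω ×ˢ Ioo (0 : ℝ) T, f q * r q) / c ^ 2 = 0 := by
  have hQ := measurableSet_prod_Ioo hΩ T
  have hout : ∀ q ∈ openCylinder Ω, q ∉ Ω ×ˢ Ioo (0 : ℝ) T → T ≤ q.2 := fun q hq hqQ =>
    not_lt.1 fun h => hqQ ⟨hq.1, hq.2, h⟩
  have h0 := H.integral_eq_zero (S := Ω ×ˢ Ioo (0 : ℝ) T) (hΩb.prod (Metric.isBounded_Ioo 0 T))
    (fun q hq => ?_) (fun q hq => ?_)
  · refine Eq.trans ?_ h0
    rw [← integral_indicator hQ, ← integral_div, ← integral_add h1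
      ((h2.integrable_indicator hQ).div_const _)]
    refine integral_congr_ae (Eventually.of_forall fun q => ?_)
    by_cases hq : q ∈ Ω ×ˢ Ioo (0 : ℝ) T
    · have hqD := IsClassicalSolution.prod_Ioo_subset T hq
      simp only [indicator_of_mem hq, indicator_of_mem hqD]
      ring
    · simp only [indicator_of_notMem hq]
      by_cases hqD : q ∈ openCylinder Ω
      · rw [indicator_of_mem hqD, tail_indicator_of_le (hout q hqD hq), indicator_of_notMem hq]; simp
      · rw [indicator_of_notMem hqD]; simp
  · by_cases hqD : q ∈ openCylinder Ω
    · rw [indicator_of_mem hqD, tail_indicator_of_le (hout q hqD hq), zero_smul]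
    · exact indicator_of_notMem hqD _
  · by_cases hqD : q ∈ openCylinder Ω
    · rw [indicator_of_mem hqD, tail_indicator_of_le (hout q hqD hq), indicator_of_notMem hq]; simp
    · exact indicator_of_notMem hqD _

end Pairing

/-! ### Positivity of the tail pairing -/

section Positivity

variable {N : ℕ}

/-- By Fubini the integral is ∫ ‖∫ p(x,s) ds‖² dx. -/
theorem integral_inner_slices_nonneg {p : Spacetime N → Space N} (hp : Integrable p)
    (hk : Integrable (fun q : Spacetime N × ℝ => ⟪p (q.1.1, q.2), p q.1⟫_ℝ)
      (volume.prod volume)) :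
    0 ≤ ∫ q : Spacetime N × ℝ, ⟪p (q.1.1, q.2), p q.1⟫_ℝ ∂(volume.prod volume) := by
  let J : Space N → Space N := fun x => ∫ s, p (x, s)
  have e1 : ∀ᵐ q : Spacetime N, ∫ s, ⟪p (q.1, s), p q⟫_ℝ = ⟪J q.1, p q⟫_ℝ := by
    filter_upwards [ae_integrable_slice hp] with q hq
    rw [real_inner_comm, ← integral_inner hq]
    exact integral_congr_ae (Eventually.of_forall fun s => real_inner_comm _ _)
  have i1 : Integrable (fun q : Spacetime N => ⟪J q.1, p q⟫_ℝ) :=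
    hk.integral_prod_left.congr e1
  rw [integral_prod _ hk, integral_congr_ae e1]
  have i2 : Integrable (fun q : Space N × ℝ => ⟪J q.1, p q⟫_ℝ)
    ((volume : Measure (Space N)).prod (volume : Measure ℝ)) := i1
  have i3 : Integrable p ((volume : Measure (Space N)).prod (volume : Measure ℝ)) := hp
  refine (integral_nonneg_of_ae ?_).trans_eq (integral_prod _ i2).symm
  filter_upwards [i3.prod_right_ae] with x hx
  rw [integral_inner hx]
  exact real_inner_self_nonneg

/-- The pairing integrates ⟪p(x,s), p(x,t)⟫ over t < s. The integrand is symmetric and the diagonal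
is null, so this is half the integral over all pairs of times, which is a square. -/
theorem integral_inner_tail_nonneg {p : Spacetime N → Space N} (hp : Integrable p)
    (hp2 : Integrable (fun q => ‖p q‖ ^ 2)) {a b : ℝ} (hs : ∀ q, q.2 ∉ Icc a b → p q = 0) :
    0 ≤ ∫ q, ⟪tail p q, p q⟫_ℝ := by
  obtain ⟨h1, h2, -, h4⟩ :=
    integrable_and_integral_inner_tail hp hp2 hp.aestronglyMeasurable hp2 hs hs
  rw [h4]
  let κ : Spacetime N × ℝ → ℝ := fun q => ⟪p (q.1.1, q.2), p q.1⟫_ℝ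
  let g : Spacetime N × ℝ → ℝ := {q : Spacetime N × ℝ | q.1.2 < q.2}.indicator κ
  have hsw : ∫ q, g (swapTimes N q) ∂(volume.prod volume) = ∫ q, g q ∂(volume.prod volume) := by
    have hmp := measurePreserving_swapTimes (N := N)
    conv_rhs => rw [← hmp.map_eq]
    rw [integral_map hmp.measurable.aemeasurable]
    rw [hmp.map_eq]
    exact h1.aestronglyMeasurable
  have hsum : ∀ᵐ q ∂((volume : Measure (Spacetime N)).prod (volume : Measure ℝ)),
      g q + g (swapTimes N q) = κ q := by
    have := ae_notMem_graph (ν := (volume : Measure (Spacetime N))) isOpen_univ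
      (W₀ := univ) (τ := Prod.snd) continuous_snd.continuousOn (fun _ _ => mem_univ _)
    filter_upwards [this] with q hq
    have hκ : κ (swapTimes N q) = κ q := real_inner_comm _ _
    rcases lt_or_gt_of_ne (hq (mem_univ _)) with h | h
    · have e1 : g q = 0 := indicator_of_notMem
        (s := {q : Spacetime N × ℝ | q.1.2 < q.2}) (fun h' => lt_asymm h h') _
      have e2 : g (swapTimes N q) = κ (swapTimes N q) := indicator_of_mem
        (s := {q : Spacetime N × ℝ | q.1.2 < q.2}) h _
      rw [e1, e2, hκ, zero_add]
    · have e1 : g q = κ q := indicator_of_mem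
        (s := {q : Spacetime N × ℝ | q.1.2 < q.2}) h _
      have e2 : g (swapTimes N q) = 0 := indicator_of_notMem
        (s := {q : Spacetime N × ℝ | q.1.2 < q.2}) (fun h' => lt_asymm h h') _
      rw [e1, e2, add_zero]
  have htot := integral_congr_ae hsum
  rw [integral_add h1 (integrable_comp_swapTimes h1), hsw] at htot
  have h0 := integral_inner_slices_nonneg hp h2
  have : ∫ q, κ q ∂(volume.prod volume) = ∫ q : Spacetime N × ℝ, ⟪p (q.1.1, q.2), p q.1⟫_ℝ
    ∂(volume.prod volume) := rfl
  show 0 ≤ ∫ q, g q ∂(volume.prod volume)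
  linarith

end Positivity

/-! ### The energy inequality -/

section EnergyInequality

variable {N : ℕ} {c : ℝ} {Ω : Set (Space N)} {G u v : Spacetime N → ℝ}
  {F Z F' Z' : ℕ → Set (Spacetime N)}

namespace IsClassicalSolution

theorem exists_bound_comp_sub (hΩ : Bornology.IsBounded Ω) (hu : IsClassicalSolution c Ω G u F Z)
    (hv : IsClassicalSolution c Ω G v F' Z') {H : ℝ → ℝ} (hH : Continuous H) (T : ℝ) :
    ∃ M, 0 ≤ M ∧ ∀ q ∈ Ω ×ˢ Ioo (0 : ℝ) T, ‖H (u q - v q)‖ ≤ M := by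
  have hcpt : IsCompact (closure Ω ×ˢ Icc (0 : ℝ) T) := hΩ.isCompact_closure.prod isCompact_Icc
  have hsub : closure Ω ×ˢ Icc (0 : ℝ) T ⊆ closedCylinder Ω :=
    prod_mono subset_rfl Icc_subset_Ici_self
  have hc : ContinuousOn (fun q => H (u q - v q)) (closure Ω ×ˢ Icc (0 : ℝ) T) :=
    hH.comp_continuousOn ((hu.continuousOn.mono hsub).sub (hv.continuousOn.mono hsub))
  obtain ⟨M, hM⟩ := hcpt.exists_bound_of_continuousOn hc
  exact ⟨max M 0, le_max_right _ _, fun q hq =>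
    (hM q (prod_mono subset_closure Ioo_subset_Icc_self hq)).trans (le_max_left _ _)⟩

theorem continuousOn_comp_sub (hu : IsClassicalSolution c Ω G u F Z)
    (hv : IsClassicalSolution c Ω G v F' Z') {H : ℝ → ℝ} (hH : Continuous H) :
    ContinuousOn (fun q => H (u q - v q)) (openCylinder Ω) :=
  hH.comp_continuousOn (hu.continuousOn_openCylinder.sub hv.continuousOn_openCylinder)

theorem memLp_smul_spaceGrad_sub (hN : 0 < N) (hΩ : IsLyapunovDomain Ω)
    (hu : IsClassicalSolution c Ω G u F Z) (hv : IsClassicalSolution c Ω G v F' Z') {H : ℝ → ℝ}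
    (hH : Continuous H) (T : ℝ) :
    MemLp (fun q => H (u q - v q) • (spaceGrad u q - spaceGrad v q)) 2
      (volume.restrict (Ω ×ˢ Ioo (0 : ℝ) T)) := by
  obtain ⟨M, -, hM⟩ := hu.exists_bound_comp_sub hΩ.isBounded hv hH T
  have hp := (hu.memLp_spaceGrad hN T).sub (hv.memLp_spaceGrad hN T)
  have hm := ((hu.continuousOn_comp_sub hv hH).mono
    (IsClassicalSolution.prod_Ioo_subset T)).aestronglyMeasurable (μ := volume)
    (measurableSet_prod_Ioo hΩ.isOpen T)
  refine hp.of_le_mul (c := M) (hm.smul hp.aestronglyMeasurable) ?_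
  filter_upwards [ae_restrict_mem (measurableSet_prod_Ioo hΩ.isOpen T)] with q hq
  rw [norm_smul]
  exact mul_le_mul_of_nonneg_right (hM q hq) (norm_nonneg _)

theorem isMultiplier_tail (hN : 0 < N) (hc : 0 < c) (hΩ : IsLyapunovDomain Ω)
    (hu : IsClassicalSolution c Ω G u F Z) (hv : IsClassicalSolution c Ω G v F' Z') {H : ℝ → ℝ}
    (hH : ContDiff ℝ 1 H) {T : ℝ} (hT : 0 ≤ T) :
    IsMultiplier Ω (tail ((Ω ×ˢ Ioo (0 : ℝ) T).indicator fun q => H (u q - v q)))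
      (tail ((Ω ×ˢ Ioo (0 : ℝ) T).indicator fun q =>
        deriv H (u q - v q) • (spaceGrad u q - spaceGrad v q)))
      (fun q => -(Ω ×ˢ Ioo (0 : ℝ) T).indicator (fun q => H (u q - v q)) q) := by
  obtain ⟨M, hM0, hM⟩ := hu.exists_bound_comp_sub hΩ.isBounded hv hH.continuous T
  exact (hu.hasWeakGrad_comp_sub hN hc hΩ hv hH).isMultiplier_tail hΩ.isOpen hΩ.isBounded
    (hu.continuousOn_comp_sub hv hH.continuous) hT hM0 hM
    (hu.memLp_smul_spaceGrad_sub hN hΩ hv (hH.continuous_deriv le_rfl) T)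

theorem integrableOn_mul_timeDeriv_sub (hN : 0 < N) (hc : 0 < c) (hΩ : IsLyapunovDomain Ω)
    (hu : IsClassicalSolution c Ω G u F Z) (hv : IsClassicalSolution c Ω G v F' Z') {H : ℝ → ℝ}
    (hH : Continuous H) (T : ℝ) :
    IntegrableOn (fun q => H (u q - v q) * (timeDeriv u q - timeDeriv v q))
      (Ω ×ˢ Ioo (0 : ℝ) T) := by
  obtain ⟨M, -, hM⟩ := hu.exists_bound_comp_sub hΩ.isBounded hv hH T
  have hm := ((hu.continuousOn_comp_sub hv hH).mono
    (IsClassicalSolution.prod_Ioo_subset T)).aestronglyMeasurable (μ := volume)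
    (measurableSet_prod_Ioo hΩ.isOpen T)
  refine Integrable.bdd_mul (c := M) ((hu.integrableOn_timeDeriv hN hc hΩ.isBounded T).sub
    (hv.integrableOn_timeDeriv hN hc hΩ.isBounded T)) hm ?_
  filter_upwards [ae_restrict_mem (measurableSet_prod_Ioo hΩ.isOpen T)] with q hq using hM q hq

/-- The energy identity for the multiplier made from `H (u - v)`. -/
theorem integral_tail_add_eq_zero (hN : 0 < N) (hc : 0 < c) (hΩ : IsLyapunovDomain Ω)
    (hu : IsClassicalSolution c Ω G u F Z) (hv : IsClassicalSolution c Ω G v F' Z') {H : ℝ → ℝ}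
    (hH : ContDiff ℝ 1 H) {T : ℝ}
    (hW : WeakDiv volume ((openCylinder Ω).indicator fun q =>
        tail ((Ω ×ˢ Ioo (0 : ℝ) T).indicator fun q => H (u q - v q)) q • fluxDiff c u v q)
      ((openCylinder Ω).indicator fun q => ⟪tail ((Ω ×ˢ Ioo (0 : ℝ) T).indicator fun q =>
        deriv H (u q - v q) • (spaceGrad u q - spaceGrad v q)) q,
          spaceGrad u q - spaceGrad v q⟫_ℝ -
        -(Ω ×ˢ Ioo (0 : ℝ) T).indicator (fun q => H (u q - v q)) q *
          (timeDeriv u q - timeDeriv v q) / c ^ 2) univ) :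
    (∫ p : Spacetime N × ℝ, {p : Spacetime N × ℝ | p.1.2 < p.2}.indicator (fun p =>
        ⟪(Ω ×ˢ Ioo (0 : ℝ) T).indicator (fun q =>
          deriv H (u q - v q) • (spaceGrad u q - spaceGrad v q)) (p.1.1, p.2),
          (Ω ×ˢ Ioo (0 : ℝ) T).indicator (fun q => spaceGrad u q - spaceGrad v q) p.1⟫_ℝ) p
          ∂(volume.prod volume)) +
      (∫ q in Ω ×ˢ Ioo (0 : ℝ) T, H (u q - v q) * (timeDeriv u q - timeDeriv v q)) / c ^ 2
      = 0 := by
  obtain ⟨i1, i2⟩ := integrable_indicator_of_memLp_two hΩ.isOpen hΩ.isBounded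
    (hu.memLp_smul_spaceGrad_sub hN hΩ hv (hH.continuous_deriv le_rfl) T)
  obtain ⟨j1, j2⟩ := integrable_indicator_of_memLp_two hΩ.isOpen hΩ.isBounded
    ((hu.memLp_spaceGrad hN T).sub (hv.memLp_spaceGrad hN T))
  obtain ⟨-, -, h3, h4⟩ := integrable_and_integral_inner_tail i1 i2 j1.aestronglyMeasurable j2
    (indicator_prod_Ioo_eq_zero (le_refl T)) (indicator_prod_Ioo_eq_zero (le_refl T))
  have := integral_inner_tail_add_eq_zero hΩ.isOpen hΩ.isBounded h3
    (hu.integrableOn_mul_timeDeriv_sub hN hc hΩ hv hH.continuous T) hW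
  rw [h4] at this
  exact this

/-- The gradient term in the energy identity is nonnegative, so the remaining term is nonpositive.
The identity is taken as a hypothesis because the two boundary value problems reach it differently.
-/
theorem integral_mul_timeDeriv_nonpos_of_identity (hN : 0 < N) (hc : 0 < c)
    (hΩ : IsLyapunovDomain Ω)
    (hu : IsClassicalSolution c Ω G u F Z) (hv : IsClassicalSolution c Ω G v F' Z') {T : ℝ}
    (h : (∫ p : Spacetime N × ℝ, {p : Spacetime N × ℝ | p.1.2 < p.2}.indicator (fun p =>
        ⟪(Ω ×ˢ Ioo (0 : ℝ) T).indicator (fun q => spaceGrad u q - spaceGrad v q) (p.1.1, p.2),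
          (Ω ×ˢ Ioo (0 : ℝ) T).indicator (fun q => spaceGrad u q - spaceGrad v q) p.1⟫_ℝ) p
          ∂(volume.prod volume)) +
      (∫ q in Ω ×ˢ Ioo (0 : ℝ) T, (u q - v q) * (timeDeriv u q - timeDeriv v q)) / c ^ 2 = 0) :
    ∫ q in Ω ×ˢ Ioo (0 : ℝ) T, (u q - v q) * (timeDeriv u q - timeDeriv v q) ≤ 0 := by
  obtain ⟨j1, j2⟩ := integrable_indicator_of_memLp_two hΩ.isOpen hΩ.isBounded
    ((hu.memLp_spaceGrad hN T).sub (hv.memLp_spaceGrad hN T))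
  obtain ⟨-, -, -, h4⟩ := integrable_and_integral_inner_tail j1 j2 j1.aestronglyMeasurable j2
    (indicator_prod_Ioo_eq_zero (le_refl T)) (indicator_prod_Ioo_eq_zero (le_refl T))
  have h0 := integral_inner_tail_nonneg j1 j2 (indicator_prod_Ioo_eq_zero (le_refl T))
  rw [h4] at h0
  have h5 : (∫ q in Ω ×ˢ Ioo (0 : ℝ) T, (u q - v q) * (timeDeriv u q - timeDeriv v q)) / c ^ 2
    ≤ 0 := by
    refine le_trans (le_of_eq ?_) (neg_nonpos.2 h0)
    exact eq_neg_of_add_eq_zero_right h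
  have hc2 : 0 < c ^ 2 := by positivity
  by_contra hcon
  exact absurd h5 (not_le.2 (div_pos (not_le.1 hcon) hc2))

theorem integral_mul_timeDeriv_nonpos_of_neumann (hN : 0 < N) (hc : 0 < c)
    (hΩ : IsLyapunovDomain Ω) (hG : LocallyIntegrableOn G (openCylinder Ω))
    (hu : IsClassicalSolution c Ω G u F Z)
    (hv : IsClassicalSolution c Ω G v F' Z') {u₀ v₀ : Space N → ℝ}
    (hui : HasInitialData Ω u₀ v₀ u F Z) (hvi : HasInitialData Ω u₀ v₀ v F' Z')
    {p : Spacetime N → ℝ} (hup : HasNeumannData Ω p u F Z) (hvp : HasNeumannData Ω p v F' Z')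
    {T : ℝ} (hT : 0 ≤ T) :
    ∫ q in Ω ×ˢ Ioo (0 : ℝ) T, (u q - v q) * (timeDeriv u q - timeDeriv v q) ≤ 0 := by
  have hm := hu.isMultiplier_tail hN hc hΩ hv (H := fun s => s) contDiff_id hT
  have := hu.integral_tail_add_eq_zero hN hc hΩ hv (H := fun s => s) contDiff_id
    (hm.weakDiv_indicator_fluxDiff_of_neumann hN hc hΩ hG hu hv hui hvi hup hvp)
  refine hu.integral_mul_timeDeriv_nonpos_of_identity hN hc hΩ hv ?_
  simpa only [deriv_id'', one_smul] using this

end IsClassicalSolution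

end EnergyInequality

/-! ### Truncation near zero -/

/-- `C¹` functions vanishing near `0` that approximate the identity together with their
derivatives. -/
theorem exists_truncation : ∃ H : ℕ → ℝ → ℝ, (∀ n, ContDiff ℝ 1 (H n)) ∧
    (∃ B, 0 ≤ B ∧ ∀ n s, |deriv (H n) s| ≤ B) ∧ (∀ n s, |H n s| ≤ |s|) ∧
    (∀ n, ∃ δ, 0 < δ ∧ ∀ s, |s| < δ → H n s = 0 ∧ deriv (H n) s = 0) ∧
    (∀ s, s ≠ 0 → Tendsto (fun n => deriv (H n) s) atTop (𝓝 1)) ∧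
    ∀ s, Tendsto (fun n => H n s) atTop (𝓝 s) := by
  obtain ⟨C, hC0, hC⟩ := exists_deriv_smoothTransition_bound
  -- The transition is 0 for |s| ≤ 1/(n+1). Its derivative can be nonzero only where ((n+1)s)² ≤ 2,
  -- so the second term of the derivative of H n is at most 4C, uniformly in n.
  let g : ℕ → ℝ → ℝ := fun n s => (((n : ℝ) + 1) * s) ^ 2 - 1
  let H : ℕ → ℝ → ℝ := fun n s => s * Real.smoothTransition (g n s)
  have hg : ∀ n, ContDiff ℝ 1 (g n) := fun n => by fun_prop
  have hH : ∀ n, ContDiff ℝ 1 (H n) := fun n =>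
    contDiff_id.mul (Real.smoothTransition.contDiff.comp (hg n))
  have hd : ∀ n s, deriv (H n) s = Real.smoothTransition (g n s) +
      2 * (((n : ℝ) + 1) * s) ^ 2 * deriv Real.smoothTransition (g n s) := by
    intro n s
    have h1 : HasDerivAt (g n) (2 * (((n : ℝ) + 1) * s) * ((n : ℝ) + 1)) s := by
      have : HasDerivAt (g n) _ s :=
        (((hasDerivAt_id s).const_mul ((n : ℝ) + 1)).pow 2).sub_const 1
      refine this.congr_deriv ?_
      simp only [id]
      push_cast
      ring
    have h2 : HasDerivAt Real.smoothTransition (deriv Real.smoothTransition (g n s)) (g n s) :=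
      ((Real.smoothTransition.contDiff (n := 1)).differentiable one_ne_zero _).hasDerivAt
    have h3 := (hasDerivAt_id s).mul (h2.comp s h1)
    have h4 : HasDerivAt (H n) _ s := h3
    rw [h4.deriv]
    simp only [id, Function.comp]
    ring
  have hlt : ∀ (n : ℕ) (s : ℝ), |s| < 1 / ((n : ℝ) + 1) → g n s ≤ 0 := by
    intro n s hs
    have hn : (0 : ℝ) < n + 1 := by positivity
    rw [lt_div_iff₀ hn, mul_comm] at hs
    have : |((n : ℝ) + 1) * s| ≤ 1 := by rw [abs_mul, abs_of_pos hn]; exact hs.le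
    have := (sq_le_one_iff_abs_le_one _).2 this
    simp only [g]
    linarith
  have hz : ∀ (n : ℕ) (s : ℝ), |s| < 1 / ((n : ℝ) + 1) → H n s = 0 := fun n s hs => by
    simp only [H]
    rw [Real.smoothTransition.zero_of_nonpos (hlt n s hs), mul_zero]
  have hlarge : ∀ s, s ≠ 0 → ∀ᶠ n : ℕ in atTop, 1 < g n s := by
    intro s hs
    have h1 : Tendsto (fun n : ℕ => ((n : ℝ) + 1) * |s|) atTop atTop :=
      (tendsto_natCast_atTop_atTop.atTop_add tendsto_const_nhds).atTop_mul_const (abs_pos.2 hs)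
    filter_upwards [h1.eventually_ge_atTop 2] with n hn
    have e : (((n : ℝ) + 1) * s) ^ 2 = (((n : ℝ) + 1) * |s|) ^ 2 := by
      rw [mul_pow, mul_pow, sq_abs]
    simp only [g]
    rw [e]
    nlinarith
  refine ⟨H, hH, ⟨1 + 4 * C, by positivity, fun n s => ?_⟩, fun n s => ?_, fun n =>
    ⟨1 / ((n : ℝ) + 1), by positivity, fun s hs => ⟨hz n s hs, ?_⟩⟩, fun s hs => ?_, fun s => ?_⟩
  · rw [hd]
    have h1 : |Real.smoothTransition (g n s)| ≤ 1 := by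
      rw [abs_of_nonneg (Real.smoothTransition.nonneg _)]
      exact Real.smoothTransition.le_one _
    refine (abs_add_le _ _).trans (add_le_add h1 ?_)
    by_cases h2 : 1 < g n s
    · rw [(hC _).2 h2, mul_zero, abs_zero]; positivity
    · have h3 : 0 ≤ 2 * (((n : ℝ) + 1) * s) ^ 2 := by positivity
      have h4 : 2 * (((n : ℝ) + 1) * s) ^ 2 ≤ 4 := by
        simp only [g] at h2
        linarith
      rw [abs_mul, abs_of_nonneg h3]
      exact mul_le_mul h4 (hC _).1 (abs_nonneg _) (by norm_num)
  · simp only [H]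
    rw [abs_mul, abs_of_nonneg (Real.smoothTransition.nonneg _)]
    exact mul_le_of_le_one_right (abs_nonneg _) (Real.smoothTransition.le_one _)
  · have : H n =ᶠ[𝓝 s] fun _ => 0 := by
      filter_upwards [continuous_abs.continuousAt.eventually (gt_mem_nhds hs)] with s' hs'
      exact hz n s' hs'
    rw [this.deriv_eq, deriv_const]
  · refine tendsto_const_nhds.congr' ?_
    filter_upwards [hlarge s hs] with n hn
    rw [hd, (hC _).2 hn, Real.smoothTransition.one_of_one_le hn.le]
    simp
  · by_cases hs : s = 0
    · subst hs
      simp [H]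
    · refine tendsto_const_nhds.congr' ?_
      filter_upwards [hlarge s hs] with n hn
      simp only [H]
      rw [Real.smoothTransition.one_of_one_le hn.le, mul_one]

section Dirichlet

variable {N : ℕ} {c : ℝ} {Ω : Set (Space N)} {G u v : Spacetime N → ℝ}
  {F Z F' Z' : ℕ → Set (Spacetime N)}

namespace IsClassicalSolution

/-- The gradient of `u - v` vanishes almost everywhere on the zero set of `u - v`. -/
theorem ae_spaceGrad_sub_eq_zero (hN : 0 < N) (hu : IsClassicalSolution c Ω G u F Z)
    (hv : IsClassicalSolution c Ω G v F' Z') :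
    ∀ᵐ q, q ∈ openCylinder Ω → u q - v q = 0 → spaceGrad u q - spaceGrad v q = 0 := by
  have hnull : volume {q | q ∈ regularRegion Ω F Z ∩ regularRegion Ω F' Z' ∧ u q - v q = 0 ∧
      fderiv ℝ (fun q => u q - v q) q ≠ 0} = 0 := by
    refine measure_null_of_locally_null _ ?_
    rintro q ⟨hq, h0, hd⟩
    have hcd : ContDiffAt ℝ 1 (fun q => u q - v q) q :=
      ((hu.contDiffOn.contDiffAt (hu.isOpen_regular.mem_nhds hq.1)).of_le one_le_two).sub
        ((hv.contDiffOn.contDiffAt (hv.isOpen_regular.mem_nhds hq.2)).of_le one_le_two)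
    obtain ⟨U, hU, hqU, hae⟩ := ae_notMem_hypersurface (μ := volume) hcd h0 hd
    refine ⟨_, inter_mem_nhdsWithin _ (hU.mem_nhds hqU), ?_⟩
    refine measure_mono_null ?_ hae
    rintro p ⟨⟨-, hp, -⟩, hpU⟩ h
    exact h hpU hp
  filter_upwards [IsMultiplier.ae_mem_regular_inter hN hu hv,
    measure_eq_zero_iff_ae_notMem.1 hnull] with q hR hq hqD h0
  have hd : fderiv ℝ (fun q => u q - v q) q = 0 := by
    by_contra h
    exact hq ⟨hR hqD, h0, h⟩
  have hdu := hu.differentiableAt (hR hqD).1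
  have hdv := hv.differentiableAt (hR hqD).2
  refine ext_inner_right ℝ fun e => ?_
  rw [inner_sub_left, inner_spaceGrad hdu, inner_spaceGrad hdv, inner_zero_left]
  rw [fderiv_fun_sub hdu hdv] at hd
  simpa using congrArg (fun f => f (e, 0)) hd

/-- u - v is continuous up to the boundary and vanishes on the compact segment {x} × [0, T]; the
tube lemma gives a neighbourhood of x that serves all these times. -/
theorem exists_isOpen_abs_sub_lt (hu : IsClassicalSolution c Ω G u F Z)
    (hv : IsClassicalSolution c Ω G v F' Z') {uS : Spacetime N → ℝ}
    (hus : HasDirichletData Ω uS u) (hvs : HasDirichletData Ω uS v) {x : Space N}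
    (hx : x ∈ frontier Ω) (T : ℝ) {δ : ℝ} (hδ : 0 < δ) :
    ∃ U, IsOpen U ∧ x ∈ U ∧ ∀ q ∈ Ω ×ˢ Ioo (0 : ℝ) T, q.1 ∈ U → |u q - v q| < δ := by
  have hc : ContinuousOn (fun q => |u q - v q|) (closedCylinder Ω) :=
    (hu.continuousOn.sub hv.continuousOn).abs
  obtain ⟨O, hO, hOe⟩ := continuousOn_iff'.1 hc (Iio δ) isOpen_Iio
  have hsub : ({x} : Set (Space N)) ×ˢ Icc 0 T ⊆ O := by
    rintro ⟨y, t⟩ ⟨hy, ht⟩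
    obtain rfl : y = x := hy
    have : (y, t) ∈ (fun q => |u q - v q|) ⁻¹' Iio δ ∩ closedCylinder Ω := by
      refine ⟨?_, frontier_subset_closure hx, ht.1⟩
      show |u (y, t) - v (y, t)| < δ
      rw [hus y hx t ht.1, hvs y hx t ht.1, sub_self, abs_zero]
      exact hδ
    rw [hOe] at this
    exact this.1
  obtain ⟨U, V, hU, -, hxU, hV, hUV⟩ := generalized_tube_lemma isCompact_singleton isCompact_Icc hO
    hsub
  refine ⟨U, hU, hxU rfl, fun q hq hqU => ?_⟩
  have : q ∈ O ∩ closedCylinder Ω := ⟨hUV ⟨hqU, hV (Ioo_subset_Icc_self hq.2)⟩,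
    subset_closure hq.1, hq.2.1.le⟩
  rw [← hOe] at this
  exact this.1

/-- The energy identity holds for the multiplier built from H n (u - v), which vanishes near the
lateral boundary. Passing to the limit in n gives the identity for u - v itself, although its own
tail need not vanish near the boundary. -/
theorem integral_mul_timeDeriv_nonpos_of_dirichlet (hN : 0 < N) (hc : 0 < c)
    (hΩ : IsLyapunovDomain Ω) (hG : LocallyIntegrableOn G (openCylinder Ω))
    (hu : IsClassicalSolution c Ω G u F Z)
    (hv : IsClassicalSolution c Ω G v F' Z') {u₀ v₀ : Space N → ℝ}
    (hui : HasInitialData Ω u₀ v₀ u F Z) (hvi : HasInitialData Ω u₀ v₀ v F' Z')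
    {uS : Spacetime N → ℝ} (hus : HasDirichletData Ω uS u) (hvs : HasDirichletData Ω uS v)
    {T : ℝ} (hT : 0 ≤ T) :
    ∫ q in Ω ×ˢ Ioo (0 : ℝ) T, (u q - v q) * (timeDeriv u q - timeDeriv v q) ≤ 0 := by
  have hQ := measurableSet_prod_Ioo hΩ.isOpen T
  refine hu.integral_mul_timeDeriv_nonpos_of_identity hN hc hΩ hv ?_
  obtain ⟨H, hH, ⟨B, hB0, hB⟩, hHle, hH0, hH', hHlim⟩ := exists_truncation
  let w : Spacetime N → ℝ := fun q => u q - v q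
  let p : Spacetime N → Space N := fun q => spaceGrad u q - spaceGrad v q
  let r : Spacetime N → ℝ := fun q => timeDeriv u q - timeDeriv v q
  let κ : Spacetime N × ℝ → ℝ := {p : Spacetime N × ℝ | p.1.2 < p.2}.indicator fun z =>
    ⟪(Ω ×ˢ Ioo (0 : ℝ) T).indicator p (z.1.1, z.2), (Ω ×ˢ Ioo (0 : ℝ) T).indicator p z.1⟫_ℝ
  have hpt : ∀ n z, deriv (H n) (w (z.1.1, z.2)) * κ z =
      {p : Spacetime N × ℝ | p.1.2 < p.2}.indicator (fun z =>
        ⟪(Ω ×ˢ Ioo (0 : ℝ) T).indicator (fun q => deriv (H n) (u q - v q) •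
          (spaceGrad u q - spaceGrad v q)) (z.1.1, z.2),
          (Ω ×ˢ Ioo (0 : ℝ) T).indicator p z.1⟫_ℝ) z := by
    intro n z
    by_cases hz : z.1.2 < z.2
    · by_cases hz2 : (z.1.1, z.2) ∈ Ω ×ˢ Ioo (0 : ℝ) T
      · simp only [κ, indicator_of_mem (s := {p : Spacetime N × ℝ | p.1.2 < p.2}) hz,
          indicator_of_mem hz2, real_inner_smul_left, w, p]
      · simp only [κ, indicator_of_mem (s := {p : Spacetime N × ℝ | p.1.2 < p.2}) hz,
          indicator_of_notMem hz2, inner_zero_left, mul_zero]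
    · simp only [κ, indicator_of_notMem (s := {p : Spacetime N × ℝ | p.1.2 < p.2}) hz, mul_zero]
  have hid : ∀ n, (∫ z, deriv (H n) (w (z.1.1, z.2)) * κ z ∂(volume.prod volume)) +
      (∫ q in Ω ×ˢ Ioo (0 : ℝ) T, H n (w q) * r q) / c ^ 2 = 0 := by
    intro n
    obtain ⟨δ, hδ, hHδ⟩ := hH0 n
    have hm := hu.isMultiplier_tail hN hc hΩ hv (hH n) hT
    have hW := hm.weakDiv_indicator_fluxDiff_of_vanishing hN hc hΩ hG hu hv hui hvi
      (fun x hx => ?_)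
    · refine Eq.trans ?_ (hu.integral_tail_add_eq_zero hN hc hΩ hv (hH n) hW)
      congr 1
      exact integral_congr_ae (Eventually.of_forall (hpt n))
    · obtain ⟨U, hU, hxU, hUδ⟩ := hu.exists_isOpen_abs_sub_lt hv hus hvs hx T hδ
      have z1 : ∀ q : Spacetime N, q.1 ∈ U →
          (Ω ×ˢ Ioo (0 : ℝ) T).indicator (fun q => H n (u q - v q)) q = 0 := by
        intro q hqU
        by_cases hq : q ∈ Ω ×ˢ Ioo (0 : ℝ) T
        · rw [indicator_of_mem hq]; exact (hHδ _ (hUδ q hq hqU)).1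
        · exact indicator_of_notMem hq _
      have z2 : ∀ q : Spacetime N, q.1 ∈ U → (Ω ×ˢ Ioo (0 : ℝ) T).indicator
          (fun q => deriv (H n) (u q - v q) • (spaceGrad u q - spaceGrad v q)) q = 0 := by
        intro q hqU
        by_cases hq : q ∈ Ω ×ˢ Ioo (0 : ℝ) T
        · rw [indicator_of_mem hq, (hHδ _ (hUδ q hq hqU)).2, zero_smul]
        · exact indicator_of_notMem hq _
      exact ⟨U, hU, hxU, fun q _ hqU =>
        ⟨setIntegral_eq_zero_of_forall_eq_zero fun s _ => z1 (q.1, s) hqU,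
          setIntegral_eq_zero_of_forall_eq_zero fun s _ => z2 (q.1, s) hqU,
          by rw [z1 q hqU, neg_zero]⟩⟩
  obtain ⟨j1, j2⟩ := integrable_indicator_of_memLp_two hΩ.isOpen hΩ.isBounded
    ((hu.memLp_spaceGrad hN T).sub (hv.memLp_spaceGrad hN T))
  have hκ : Integrable κ (volume.prod volume) := (integrable_and_integral_inner_tail j1 j2
    j1.aestronglyMeasurable j2 (indicator_prod_Ioo_eq_zero (le_refl T))
    (indicator_prod_Ioo_eq_zero (le_refl T))).1
  have hwr : IntegrableOn (fun q => w q * r q) (Ω ×ˢ Ioo (0 : ℝ) T) :=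
    hu.integrableOn_mul_timeDeriv_sub hN hc hΩ hv (H := fun s => s) continuous_id T
  have hpull : ∀ {A : Spacetime N → Prop}, (∀ᵐ q, A q) →
      ∀ᵐ z ∂((volume : Measure (Spacetime N)).prod (volume : Measure ℝ)), A (z.1.1, z.2) := by
    intro A hA
    exact measurePreserving_swapTimes.quasiMeasurePreserving.ae
      (Measure.quasiMeasurePreserving_fst.ae hA)
  have l1 : Tendsto (fun n => ∫ z, deriv (H n) (w (z.1.1, z.2)) * κ z ∂(volume.prod volume)) atTop
      (𝓝 (∫ z, κ z ∂(volume.prod volume))) := by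
    -- The derivatives of H n do not tend to 1 at 0, where they all vanish. This does no harm, since
    -- the gradient of u - v, hence κ, is zero almost everywhere on the zero set.
    have key : ∀ᵐ z ∂((volume : Measure (Spacetime N)).prod (volume : Measure ℝ)),
        κ z = 0 ∨ ((z.1.1, z.2) ∈ Ω ×ˢ Ioo (0 : ℝ) T ∧ w (z.1.1, z.2) ≠ 0) := by
      filter_upwards [hpull (hu.ae_spaceGrad_sub_eq_zero hN hv)] with z hz
      by_cases hz2 : (z.1.1, z.2) ∈ Ω ×ˢ Ioo (0 : ℝ) T
      · by_cases hw : w (z.1.1, z.2) = 0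
        · left
          have : p (z.1.1, z.2) = 0 := hz (prod_Ioo_subset T hz2) hw
          simp only [κ, indicator]
          split_ifs <;> simp [this]
        · exact Or.inr ⟨hz2, hw⟩
      · left
        simp only [κ]
        refine indicator_apply_eq_zero.2 fun _ => ?_
        rw [indicator_of_notMem hz2, inner_zero_left]
    refine tendsto_integral_of_dominated_convergence (fun z => B * ‖κ z‖) (fun n => ?_)
      (hκ.norm.const_mul B) (fun n => Eventually.of_forall fun z => ?_) ?_
    · obtain ⟨i1, i2⟩ := integrable_indicator_of_memLp_two hΩ.isOpen hΩ.isBounded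
        (hu.memLp_smul_spaceGrad_sub hN hΩ hv ((hH n).continuous_deriv le_rfl) T)
      refine (integrable_and_integral_inner_tail i1 i2 j1.aestronglyMeasurable j2
        (indicator_prod_Ioo_eq_zero (le_refl T))
        (indicator_prod_Ioo_eq_zero (le_refl T))).1.aestronglyMeasurable.congr ?_
      exact Eventually.of_forall fun z => (hpt n z).symm
    · rw [norm_mul]
      exact mul_le_mul_of_nonneg_right (hB n _) (norm_nonneg _)
    · filter_upwards [key] with z hz
      rcases hz with hz | ⟨-, hz⟩
      · simp [hz]
      · simpa using (hH' _ hz).mul_const (κ z)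
  have l2 : Tendsto (fun n => ∫ q in Ω ×ˢ Ioo (0 : ℝ) T, H n (w q) * r q) atTop
      (𝓝 (∫ q in Ω ×ˢ Ioo (0 : ℝ) T, w q * r q)) := by
    refine tendsto_integral_of_dominated_convergence (fun q => ‖w q * r q‖) (fun n => ?_)
      hwr.norm (fun n => Eventually.of_forall fun q => ?_) (Eventually.of_forall fun q => ?_)
    · exact (hu.integrableOn_mul_timeDeriv_sub hN hc hΩ hv (hH n).continuous T).aestronglyMeasurable
    · rw [norm_mul, norm_mul]
      exact mul_le_mul_of_nonneg_right (hHle n _) (norm_nonneg _)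
    · exact (hHlim _).mul_const _
  have l3 := l1.add (l2.div_const (c ^ 2))
  simp_rw [hid] at l3
  exact (tendsto_nhds_unique l3 tendsto_const_nhds)

end IsClassicalSolution

end Dirichlet

/-! ### Uniqueness from the sign of the time integrals -/

section Uniqueness

variable {N : ℕ} {c : ℝ} {Ω : Set (Space N)} {G u v : Spacetime N → ℝ}
  {F Z F' Z' : ℕ → Set (Spacetime N)}

/-- Fubini: weighting by ∫_t^A k amounts to averaging the integrals over Ω × (0, s) with density
k(s). It carries the sign known for every final time over to a smooth time weight. -/
theorem integral_weight_mul {A : ℝ} {k : ℝ → ℝ} (hk : Continuous k) {g : Spacetime N → ℝ}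
    (hΩ : IsOpen Ω) (hg : IntegrableOn g (Ω ×ˢ Ioo (0 : ℝ) A)) :
    ∫ q in Ω ×ˢ Ioo (0 : ℝ) A, (∫ s in q.2..A, k s) * g q =
      ∫ s in Ioo (0 : ℝ) A, k s * ∫ q in Ω ×ˢ Ioo (0 : ℝ) s, g q := by
  have hki : IntegrableOn k (Ioo 0 A) :=
    (hk.integrableOn_Icc (a := 0) (b := A)).mono_set Ioo_subset_Icc_self
  have hS : MeasurableSet {z : Spacetime N × ℝ | z.1.2 < z.2} :=
    measurableSet_lt (by fun_prop) (by fun_prop)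
  have hi := (Integrable.mul_prod hg hki).indicator hS
  have hsw := integral_integral_swap (μ := volume.restrict (Ω ×ˢ Ioo (0 : ℝ) A))
    (ν := volume.restrict (Ioo (0 : ℝ) A)) (f := fun q s =>
      {z : Spacetime N × ℝ | z.1.2 < z.2}.indicator (fun z => g z.1 * k z.2) (q, s)) hi
  refine Eq.trans ?_ (hsw.trans ?_)
  · refine setIntegral_congr_fun (measurableSet_prod_Ioo hΩ A) fun q hq => ?_
    have e : (fun s => {z : Spacetime N × ℝ | z.1.2 < z.2}.indicator
        (fun z => g z.1 * k z.2) (q, s)) = (Ioi q.2).indicator fun s => g q * k s := by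
      funext s
      by_cases h : q.2 < s
      · rw [indicator_of_mem (s := {z : Spacetime N × ℝ | z.1.2 < z.2}) h,
          indicator_of_mem (s := Ioi q.2) h]
      · rw [indicator_of_notMem (s := {z : Spacetime N × ℝ | z.1.2 < z.2}) h,
          indicator_of_notMem (s := Ioi q.2) h]
    simp only [e]
    rw [setIntegral_indicator measurableSet_Ioi, integral_const_mul, mul_comm,
      intervalIntegral.integral_of_le hq.2.2.le, integral_Ioc_eq_integral_Ioo]
    have : Ioo 0 A ∩ Ioi q.2 = Ioo q.2 A := by
      ext s
      exact ⟨fun h => ⟨h.2, h.1.2⟩, fun h => ⟨⟨hq.2.1.trans h.1, h.2⟩, h.1⟩⟩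
    rw [this]
  · refine setIntegral_congr_fun measurableSet_Ioo fun s hs => ?_
    have e : (fun q => {z : Spacetime N × ℝ | z.1.2 < z.2}.indicator
        (fun z => g z.1 * k z.2) (q, s)) =
        {q : Spacetime N | q.2 < s}.indicator fun q => k s * g q := by
      funext q
      by_cases h : q.2 < s
      · rw [indicator_of_mem (s := {z : Spacetime N × ℝ | z.1.2 < z.2}) h,
          indicator_of_mem (s := {q : Spacetime N | q.2 < s}) h, mul_comm]
      · rw [indicator_of_notMem (s := {z : Spacetime N × ℝ | z.1.2 < z.2}) h,
          indicator_of_notMem (s := {q : Spacetime N | q.2 < s}) h]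
    simp only [e]
    rw [setIntegral_indicator (measurableSet_lt measurable_snd measurable_const),
      integral_const_mul]
    have : Ω ×ˢ Ioo (0 : ℝ) A ∩ {q : Spacetime N | q.2 < s} = Ω ×ˢ Ioo (0 : ℝ) s := by
      ext q
      exact ⟨fun h => ⟨h.1.1, h.1.2.1, h.2⟩, fun h => ⟨⟨h.1, h.2.1, h.2.2.trans hs.2⟩, h.2.2⟩⟩
    rw [this]

namespace IsClassicalSolution

theorem continuousWithinAt_comp_sub (hu : IsClassicalSolution c Ω G u F Z)
    (hv : IsClassicalSolution c Ω G v F' Z') {H : ℝ → ℝ} (hH : Continuous H) {q : Spacetime N}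
    (hq : q ∈ closedCylinder Ω) :
    Tendsto (fun q => H (u q - v q)) (𝓝[regularRegion Ω F Z ∩ regularRegion Ω F' Z'] q)
      (𝓝 (H (u q - v q))) :=
  ((hH.comp_continuousOn (hu.continuousOn.sub hv.continuousOn)) q hq).mono
    fun _ hp => openCylinder_subset_closedCylinder hp.1.1

/-- The field points in the time direction, so it is tangent to the lateral boundary and crosses it
without any boundary condition. At t = 0 it tends to H(0) = 0 by the common initial values. -/
theorem weakDiv_indicator_comp_sub (hN : 0 < N) (hc : 0 < c) (hΩ : IsLyapunovDomain Ω)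
    (hu : IsClassicalSolution c Ω G u F Z) (hv : IsClassicalSolution c Ω G v F' Z')
    (hini : ∀ x ∈ Ω, u (x, 0) = v (x, 0)) {H : ℝ → ℝ} (hH : ContDiff ℝ 1 H) (hH0 : H 0 = 0) :
    WeakDiv volume ((openCylinder Ω).indicator fun q => H (u q - v q) • ((0, 1) : Spacetime N))
      ((openCylinder Ω).indicator fun q =>
        deriv H (u q - v q) * (timeDeriv u q - timeDeriv v q)) univ := by
  have hb := hu.exists_bound_comp_sub hΩ.isBounded hv hH.continuous
  have hcts := (hu.continuousOn_comp_sub hv hH.continuous).smul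
    (continuousOn_const (c := ((0, 1) : Spacetime N)))
  have hnorm : ∀ q, ‖H (u q - v q) • ((0, 1) : Spacetime N)‖ = ‖H (u q - v q)‖ := fun q => by
    rw [norm_smul]; simp [Prod.norm_def]
  have hV : ∀ T : ℝ, IntegrableOn (fun q => H (u q - v q) • ((0, 1) : Spacetime N))
      (Ω ×ˢ Ioo (0 : ℝ) T) := fun T => by
    obtain ⟨M, -, hM⟩ := hb T
    refine IntegrableOn.of_bound (volume_prod_Ioo_lt_top hΩ.isBounded T)
      ((hcts.mono (prod_Ioo_subset T)).aestronglyMeasurable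
        (measurableSet_prod_Ioo hΩ.isOpen T)) M ?_
    filter_upwards [ae_restrict_mem (measurableSet_prod_Ioo hΩ.isOpen T)] with q hq
    rw [hnorm]
    exact hM q hq
  have hV2 : ∀ T : ℝ, IntegrableOn (fun q => ‖H (u q - v q) • ((0, 1) : Spacetime N)‖ ^ 2)
      (Ω ×ˢ Ioo (0 : ℝ) T) := fun T => by
    obtain ⟨M, -, hM⟩ := hb T
    refine IntegrableOn.of_bound (volume_prod_Ioo_lt_top hΩ.isBounded T)
      (((hcts.mono (prod_Ioo_subset T)).norm.pow 2).aestronglyMeasurable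
        (measurableSet_prod_Ioo hΩ.isOpen T)) (M ^ 2) ?_
    filter_upwards [ae_restrict_mem (measurableSet_prod_Ioo hΩ.isOpen T)] with q hq
    rw [norm_pow, norm_norm, hnorm]
    exact pow_le_pow_left₀ (norm_nonneg _) (hM q hq) 2
  have hh := hu.integrableOn_mul_timeDeriv_sub hN hc hΩ hv (hH.continuous_deriv le_rfl)
  have hD : WeakDiv volume (fun q => H (u q - v q) • ((0, 1) : Spacetime N))
      (fun q => deriv H (u q - v q) * (timeDeriv u q - timeDeriv v q)) (openCylinder Ω) := by
    have := hu.hasWeakGrad_comp_sub hN hc hΩ hv hH (0, 1)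
    simpa using this
  have hZc : ∀ i, IsClosed (Sum.elim Z Z' i) := by
    rintro (i | i)
    exacts [hu.isClosed_exceptional i, hv.isClosed_exceptional i]
  have hZm : ∀ i, μH[(N : ℝ) - 1] (Sum.elim Z Z' i) < ⊤ := by
    rintro (i | i)
    exacts [hu.measure_exceptional i, hv.measure_exceptional i]
  have hR := IsMultiplier.ae_mem_regular_inter hN hu hv
  refine WeakDiv.indicator_openCylinder_univ hN hΩ hZc hZm hR hV hV2 hh
    (WeakDiv.indicator_openCylinder hN hΩ.isOpen hZc hZm hR hV hV2 hh hD fun x hx _ => ?_)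
    fun x hx t ht _ => ⟨?_, fun n _ => ?_⟩
  · have := hu.continuousWithinAt_comp_sub hv hH.continuous (q := (x, 0))
      ⟨subset_closure hx, le_refl (0 : ℝ)⟩
    rw [hini x hx, sub_self, hH0] at this
    simpa using this
  · have := (hu.continuousWithinAt_comp_sub hv hH.continuous (q := (x, t))
      ⟨frontier_subset_closure hx, ht.le⟩).norm
    refine ⟨‖H (u (x, t) - v (x, t))‖ + 1, ?_⟩
    filter_upwards [this.eventually_lt_const (lt_add_one _)] with q hq
    rw [hnorm]
    exact hq.le
  · simpa using tendsto_const_nhds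

/-- Integration by parts in time against Θ: there is no term at t = A because Θ and its derivative
vanish from there on, and none at t = 0 because H(u - v) vanishes there. The bump f only makes the
test function compactly supported. -/
theorem integral_deriv_mul_add_eq_zero (hN : 0 < N) (hc : 0 < c) (hΩ : IsLyapunovDomain Ω)
    (hu : IsClassicalSolution c Ω G u F Z) (hv : IsClassicalSolution c Ω G v F' Z')
    (hini : ∀ x ∈ Ω, u (x, 0) = v (x, 0)) {H : ℝ → ℝ} (hH : ContDiff ℝ 1 H) (hH0 : H 0 = 0)
    {A : ℝ} {Θ : ℝ → ℝ} (hΘ : ContDiff ℝ 1 Θ) (hΘA : ∀ t, A ≤ t → Θ t = 0 ∧ deriv Θ t = 0) :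
    ∫ q in Ω ×ˢ Ioo (0 : ℝ) A, (deriv Θ q.2 * H (u q - v q) +
      Θ q.2 * (deriv H (u q - v q) * (timeDeriv u q - timeDeriv v q))) = 0 := by
  have hbd : Bornology.IsBounded (Ω ×ˢ Ioo (0 : ℝ) A) := hΩ.isBounded.prod (Metric.isBounded_Ioo 0 A)
  obtain ⟨ρ, hρ, hSρ⟩ := hbd.subset_ball_lt 0 0
  let f : ContDiffBump (0 : Spacetime N) := ⟨ρ, ρ + 1, hρ, lt_add_one ρ⟩
  have hφ : IsTestFun (fun q : Spacetime N => f q * Θ q.2) univ :=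
    ⟨f.contDiff.mul (hΘ.comp contDiff_snd), f.hasCompactSupport.mul_right, subset_univ _⟩
  refine Eq.trans ?_ (hu.weakDiv_indicator_comp_sub hN hc hΩ hv hini hH hH0 _ hφ)
  rw [← integral_indicator (measurableSet_prod_Ioo hΩ.isOpen A)]
  refine integral_congr_ae (Eventually.of_forall fun q => ?_)
  have h1 : HasFDerivAt (fun q : Spacetime N => Θ q.2)
      (deriv Θ q.2 • ContinuousLinearMap.snd ℝ (Space N) ℝ) q :=
    ((hΘ.differentiable one_ne_zero q.2).hasDerivAt).comp_hasFDerivAt q hasFDerivAt_snd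
  have h2 : HasFDerivAt f (fderiv ℝ f q) q :=
    ((f.contDiff (n := 1)).differentiable one_ne_zero q).hasFDerivAt
  have h3 := (h2.fun_mul h1).fderiv
  simp only [h3]
  by_cases hqD : q ∈ openCylinder Ω
  · by_cases hqA : q.2 < A
    · have hq : q ∈ Ω ×ˢ Ioo (0 : ℝ) A := ⟨hqD.1, hqD.2, hqA⟩
      have e1 : (f : Spacetime N → ℝ) =ᶠ[𝓝 q] fun _ => 1 := by
        filter_upwards [Metric.isOpen_ball.mem_nhds (hSρ hq)] with p hp
        exact f.one_of_mem_closedBall (Metric.ball_subset_closedBall hp)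
      rw [indicator_of_mem hq, indicator_of_mem hqD, indicator_of_mem hqD, e1.fderiv_eq,
        e1.self_of_nhds]
      simp [mul_comm]
    · have hq : q ∉ Ω ×ˢ Ioo (0 : ℝ) A := fun h => hqA h.2.2
      obtain ⟨e1, e2⟩ := hΘA q.2 (not_lt.1 hqA)
      rw [indicator_of_notMem hq, e1, e2]
      simp
  · have hq : q ∉ Ω ×ˢ Ioo (0 : ℝ) A := fun h => hqD (prod_Ioo_subset A h)
    rw [indicator_of_notMem hq, indicator_of_notMem hqD, indicator_of_notMem hqD]
    simp

theorem eqOn_of_integral_nonpos (hN : 0 < N) (hc : 0 < c) (hΩ : IsLyapunovDomain Ω)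
    (hu : IsClassicalSolution c Ω G u F Z) (hv : IsClassicalSolution c Ω G v F' Z')
    (hini : ∀ x ∈ Ω, u (x, 0) = v (x, 0))
    (hneg : ∀ T, 0 ≤ T →
      ∫ q in Ω ×ˢ Ioo (0 : ℝ) T, (u q - v q) * (timeDeriv u q - timeDeriv v q) ≤ 0) :
    EqOn u v (closedCylinder Ω) := by
  have hslab : ∀ A : ℝ, EqOn u v (Ω ×ˢ Ioo (0 : ℝ) A) := by
    intro A
    have hQm := measurableSet_prod_Ioo hΩ.isOpen A
    -- Any continuous density positive on (0, A) and zero from A on would do. Its integral Θ is then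
    -- C¹ with Θ' = -k, and integration by parts with H(s) = s²/2 gives ∫ k (u-v)²/2 = ∫ Θ
    -- (u-v)(u-v)_t ≤ 0.
    let k : ℝ → ℝ := fun s => max (A - s) 0
    have hk : Continuous k := by fun_prop
    let Θ : ℝ → ℝ := fun t => ∫ s in t..A, k s
    have hd : ∀ t, HasDerivAt Θ (-k t) t := fun t =>
      intervalIntegral.integral_hasDerivAt_left (hk.intervalIntegrable _ _)
        (hk.stronglyMeasurableAtFilter _ _) hk.continuousAt
    have hd' : deriv Θ = fun t => -k t := funext fun t => (hd t).deriv
    have hΘ : ContDiff ℝ 1 Θ := contDiff_one_iff_deriv.2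
      ⟨fun t => (hd t).differentiableAt, by rw [hd']; exact hk.neg⟩
    have hkA : ∀ t, A ≤ t → k t = 0 := fun t ht => max_eq_right (by linarith)
    have hΘA : ∀ t, A ≤ t → Θ t = 0 ∧ deriv Θ t = 0 := fun t ht => by
      refine ⟨?_, by simp only [hd', hkA t ht, neg_zero]⟩
      refine (intervalIntegral.integral_congr (g := fun _ => (0 : ℝ)) fun s hs => ?_).trans
        (by simp)
      rw [uIcc_of_ge ht] at hs
      exact hkA s hs.1
    have hHd : ∀ s : ℝ, deriv (fun s : ℝ => s ^ 2 / 2) s = s := fun s => by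
      simp
    have hid := hu.integral_deriv_mul_add_eq_zero hN hc hΩ hv hini
      (H := fun s => s ^ 2 / 2) (by fun_prop) (by norm_num) hΘ hΘA
    simp only [hHd, hd'] at hid
    have hwr := hu.integrableOn_mul_timeDeriv_sub hN hc hΩ hv (H := fun s => s) continuous_id A
    obtain ⟨M, -, hM⟩ := hu.exists_bound_comp_sub hΩ.isBounded hv
      (H := fun s => s ^ 2 / 2) (by fun_prop) A
    have i1 : IntegrableOn (fun q : Spacetime N => k q.2 * ((u q - v q) ^ 2 / 2))
        (Ω ×ˢ Ioo (0 : ℝ) A) := by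
      refine IntegrableOn.of_bound (volume_prod_Ioo_lt_top hΩ.isBounded A)
        (((hk.comp continuous_snd).continuousOn.mul ((hu.continuousOn_comp_sub hv
          (H := fun s => s ^ 2 / 2) (by fun_prop)).mono (prod_Ioo_subset A))).aestronglyMeasurable
            hQm) (A * M) ?_
      filter_upwards [ae_restrict_mem hQm] with q hq
      rw [norm_mul]
      refine mul_le_mul ?_ (hM q hq) (norm_nonneg _) (hq.2.1.trans hq.2.2).le
      have h1 := hq.2.1
      have h2 := hq.2.2
      simp only [k, Real.norm_eq_abs]
      rw [max_eq_left (by linarith), abs_of_nonneg (by linarith)]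
      linarith
    have i2 : IntegrableOn (fun q : Spacetime N =>
        Θ q.2 * ((u q - v q) * (timeDeriv u q - timeDeriv v q))) (Ω ×ˢ Ioo (0 : ℝ) A) := by
      obtain ⟨B, hB⟩ := isCompact_Icc.exists_bound_of_continuousOn
        (hΘ.continuous.continuousOn (s := Icc 0 A))
      refine Integrable.bdd_mul (c := B) hwr
        (hΘ.continuous.comp continuous_snd).aestronglyMeasurable ?_
      filter_upwards [ae_restrict_mem hQm] with q hq
      exact hB _ (Ioo_subset_Icc_self hq.2)
    have hneg' : ∫ q in Ω ×ˢ Ioo (0 : ℝ) A,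
        Θ q.2 * ((u q - v q) * (timeDeriv u q - timeDeriv v q)) ≤ 0 := by
      rw [integral_weight_mul hk hΩ.isOpen hwr]
      refine setIntegral_nonpos measurableSet_Ioo fun s hs => ?_
      exact mul_nonpos_of_nonneg_of_nonpos (le_max_right _ _) (hneg s hs.1.le)
    have hle : ∫ q in Ω ×ˢ Ioo (0 : ℝ) A, k q.2 * ((u q - v q) ^ 2 / 2) ≤ 0 := by
      have e : ∀ q : Spacetime N, -k q.2 * ((u q - v q) ^ 2 / 2) +
          Θ q.2 * ((u q - v q) * (timeDeriv u q - timeDeriv v q)) =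
          Θ q.2 * ((u q - v q) * (timeDeriv u q - timeDeriv v q)) -
            k q.2 * ((u q - v q) ^ 2 / 2) := fun q => by ring
      simp only [e] at hid
      rw [integral_sub i2 i1] at hid
      linarith
    have hnn : ∀ q : Spacetime N, 0 ≤ k q.2 * ((u q - v q) ^ 2 / 2) := fun q =>
      mul_nonneg (le_max_right _ _) (by positivity)
    have hzero := (setIntegral_eq_zero_iff_of_nonneg_ae (Eventually.of_forall hnn) i1).1
      (le_antisymm hle (integral_nonneg hnn))
    -- The integral determines u - v only almost everywhere; continuity upgrades this to equality on
    -- the slab, and finally on the closed cylinder.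
    refine Measure.eqOn_open_of_ae_eq (μ := volume) ?_ (hΩ.isOpen.prod isOpen_Ioo)
      (hu.continuousOn_openCylinder.mono (prod_Ioo_subset A))
      (hv.continuousOn_openCylinder.mono (prod_Ioo_subset A))
    filter_upwards [hzero, ae_restrict_mem hQm] with q hq hqA
    have hkq : k q.2 ≠ 0 := ((sub_pos.2 hqA.2.2).trans_le (le_max_left _ _)).ne'
    have h0 : k q.2 * ((u q - v q) ^ 2 / 2) = 0 := hq
    have h1 := (mul_eq_zero.1 h0).resolve_left hkq
    have h2 : (u q - v q) ^ 2 = 0 := by linarith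
    exact sub_eq_zero.1 (pow_eq_zero_iff two_ne_zero |>.1 h2)
  have hopen : EqOn u v (openCylinder Ω) := fun q hq =>
    hslab (q.2 + 1) ⟨hq.1, hq.2, lt_add_one _⟩
  refine hopen.of_subset_closure hu.continuousOn hv.continuousOn
    openCylinder_subset_closedCylinder ?_
  rw [closedCylinder, openCylinder, closure_prod_eq, closure_Ioi]

end IsClassicalSolution

end Uniqueness

theorem theorem2p2 {N : ℕ} (hN : 0 < N) {c : ℝ} (hc : 0 < c)
    {Ω : Set (Space N)} (hΩ : IsLyapunovDomain Ω)
    {G : Spacetime N → ℝ} (hG : LocallyIntegrableOn G (openCylinder Ω))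
    (u₀ v₀ : Space N → ℝ) :
    (∀ uS u v : Spacetime N → ℝ,
      SolvesFirstBVP c Ω G u₀ v₀ uS u → SolvesFirstBVP c Ω G u₀ v₀ uS v →
        EqOn u v (closedCylinder Ω)) ∧
    (∀ p u v : Spacetime N → ℝ,
      SolvesSecondBVP c Ω G u₀ v₀ p u → SolvesSecondBVP c Ω G u₀ v₀ p v →
        EqOn u v (closedCylinder Ω)) := by
  constructor
  · rintro uS u v ⟨F, Z, hu, hui, hus⟩ ⟨F', Z', hv, hvi, hvs⟩
    refine hu.eqOn_of_integral_nonpos hN hc hΩ hv (fun x hx => ?_) fun T hT =>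
      hu.integral_mul_timeDeriv_nonpos_of_dirichlet hN hc hΩ hG hv hui hvi hus hvs hT
    rw [hui.value x (subset_closure hx), hvi.value x (subset_closure hx)]
  · rintro p u v ⟨F, Z, hu, hui, hup⟩ ⟨F', Z', hv, hvi, hvp⟩
    refine hu.eqOn_of_integral_nonpos hN hc hΩ hv (fun x hx => ?_) fun T hT =>
      hu.integral_mul_timeDeriv_nonpos_of_neumann hN hc hΩ hG hv hui hvi hup hvp hT
    rw [hui.value x (subset_closure hx), hvi.value x (subset_closure hx)]
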